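/- Let $d\ge 1$ be an integer, $\beta\ge 0$, $h\in\mathbb{R}$ and $\beta_c=\frac{1}{2d}$. For $n\ge 1$ let $\varepsilon=(\varepsilon_1,\dots,\varepsilon_n)$ be the spins of the Curie-Weiss model, i.e. the random vector in $\{-1,1\}^n$ with \[P(\varepsilon=\sigma)=\frac{1}{Z}\exp\Big\{\frac{d\beta}{n}\Big(\sum_{j=1}^n\sigma_j\Big)^2+h\sum_{j=1}^n\sigma_j\Big\},\qquad \sigma\in\{-1,1\}^n,\] where $Z$ is the normalizing constant, and let \[Q_n=\sup_{x\in\mathbb{R}}\ \sup_{|v_1|,\dots,|v_n|\ge 1}P\Big(\sum_{i=1}^n v_i\varepsilon_i\in(x-1,x+1)\Big).\] Then, as $n\to+\infty$ along the even integers, $Q_n$ has the following full asymptotic expansions. In each case the real coefficients $H_0,H_1,H_2,\dots$ depend only on $d,\beta,h$ (not on $M$ or $n$), and the expansion holds for every integer $M\ge 0$. (1) If $h=0$ and $\beta<\beta_c$, then $Q_n=\sum_{p=0}^{M}H_p\,n^{-p-\frac12}+o(n^{-M-\frac12})$ with $H_0=\sqrt{\frac{2}{\pi}}$. (2) If $h=0$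 and $\beta=\beta_c$, then $Q_n=\sum_{p=0}^{M}H_p\,n^{-\frac p2-\frac12}+o(n^{-\frac M2-\frac12})$ with $H_0=\sqrt{\frac{2}{\pi}}$ and $H_1=\frac{2\sqrt3\sqrt\pi}{\Gamma(1/4)^2}$. (3) If $h=0$ and $\beta>\beta_c$, then $Q_n=\sum_{p=0}^{M}H_p\,n^{-p-\frac12}+o(n^{-M-\frac12})$ with $H_0=\sqrt{\frac{2}{\pi}}\cosh t_*$, where $t_*=2d\beta z_*$ and $z_*$ is the maximal solution of the mean-field equation $\tanh\big(\frac{\beta}{\beta_c}z\big)=z$ (which exists). (4) If $h\ne 0$, then $Q_n=\sum_{p=0}^{M}H_p\,n^{-p-\frac12}+o(n^{-M-\frac12})$ with $H_0=\sqrt{\frac{2}{\pi}}\cosh t_*$, where $t_*=2d\beta z_*+|h|$ and $z_*$ is the maximal solution of the mean-field equation $\tanh\big(\frac{\beta}{\beta_c}z+|h|\big)=z$ (which exists). -/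

import Mathlib

open scoped Asymptotics

namespace CurieWeiss

/-- The unnormalised weight `exp((dβ/n) (∑ σ_j)² + h ∑ σ_j)` of a configuration
`σ ∈ {-1, 1}ⁿ`; the spins are the two units `±1` of `ℤ`. -/
noncomputable def weight (d : ℕ) (β h : ℝ) {n : ℕ} (σ : Fin n → ℤˣ) : ℝ :=
  Real.exp ((d : ℝ) * β / (n : ℝ) * (∑ j, ((σ j : ℤ) : ℝ)) ^ 2 + h * ∑ j, ((σ j : ℤ) : ℝ))

/-- The normalizing constant `Z_{d,β,h}` of the model on `n` vertices. -/
noncomputable def partitionFunction (d : ℕ) (β h : ℝ) (n : ℕ) : ℝ :=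
  ∑ σ : Fin n → ℤˣ, weight d β h σ

/-- The probability, under the Curie-Weiss law on `n` vertices, that the spin vector lies
in the set `A` of configurations. -/
noncomputable def prob (d : ℕ) (β h : ℝ) {n : ℕ} (A : Set (Fin n → ℤˣ)) : ℝ :=
  (∑ σ : Fin n → ℤˣ, A.indicator (weight d β h) σ) / partitionFunction d β h n

/-- `Q_n = sup_{x ∈ ℝ} sup_{|v_1|, …, |v_n| ≥ 1} P(∑ v_i ε_i ∈ (x - 1, x + 1))`. -/
noncomputable def Q (d : ℕ) (β h : ℝ) (n : ℕ) : ℝ :=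
  ⨆ x : ℝ, ⨆ v : {v : Fin n → ℝ // ∀ i, 1 ≤ |v i|},
    prob d β h {σ : Fin n → ℤˣ | ∑ i, v.1 i * ((σ i : ℤ) : ℝ) ∈ Set.Ioo (x - 1) (x + 1)}

/-- The critical parameter `β_c = 1 / (2d)`. -/
noncomputable def betaC (d : ℕ) : ℝ := 1 / (2 * (d : ℝ))

/-- The solutions `z` of the mean-field equation `tanh((β/β_c) z + |h|) = z`. -/
def meanFieldSolutions (d : ℕ) (β h : ℝ) : Set ℝ :=
  {z : ℝ | Real.tanh (β / betaC d * z + |h|) = z}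

/-- The filter "`n → +∞` along the even natural numbers". -/
def evenAtTop : Filter ℕ := Filter.atTop ⊓ Filter.principal {n : ℕ | Even n}

end CurieWeiss

/-!
The supremum `Q` can be evaluated exactly for even `n = 2k`. The Hubbard–Stratonovich
transformation writes the Curie–Weiss weight as a Gaussian mixture, over a field `x`, of product
weights with tilt `θ = κ x + h`, where `κ = √(2dβ)` (`integral_gaussian_mul_exp`). For a fixed tilt
the configurations with `∑ v_i σ_i` in an open interval of length `2` form, after flipping signs so
that `v_i > 0`, an antichain. A weighted Lubell–Yamamoto–Meshalkin inequality (`sum_antichain_le`,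
resting on the log-concavity of elementary symmetric functions) bounds an antichain by the heaviest
level, and the triangle inequality in the Fourier representation of a level gives the bound
`π⁻¹ ∫ (4 (cosh² θ - sin² u))^k du`. The coefficients `(1, …, 1, -1, …, -1)` with `x = 0` attain
it for every tilt at once, so they are extremal for the mixture too (`Q_eq_div`).

Dividing by the value of the integrands at the maximum of the field density, `√n Q_n` becomes
`√(2/π)` times a quotient of two integrals over the plane of the `n`-th powers of densities with a
strict peak (`IsPeak.sqrt_mul_div_eq`). Near the peak both have the form
`exp (-(y^{2r} g(y) + u² K(y, u)))` with the same `g`; in the denominator `K = 1/2`, and in the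
numerator `K(y, 0) = 1 / (2 cosh² (κ (a + y) + |h|))`. Here `r = 1` unless `h = 0` and `κ = 1`,
where `r = 2`. After the rescaling `(y, u) = (ε s, ε^r t)`, `ε = n^{-1/(2r)}`, each integral is a
smooth function of `ε` up to exponentially small errors (`laplace_method`), and the substitution
`(s, t) ↦ (-s, (-1)^r t)` makes it even. The full expansion is then Taylor's formula for the
quotient (`exists_expansion_of_smooth`), in powers of `ε² = n^{-1/r}`.

The leading coefficient is `√(2/π)` times the ratio of the Gaussian integrals in `u`, that is
`cosh (κ a + |h|)`, and `κ a + |h| = 2dβz + |h|` for `z = tanh (κ a + |h|)`, the maximal solution of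
the mean-field equation, because `a` is the largest critical point of the phase. At the critical
point `H 1` is half the second derivative of the quotient; there numerator and denominator differ
only by `∬ s² t² exp (-s⁴/12 - t²/2)` (`deriv_deriv_critical`), and the reflection formula for `Γ`
turns the ratio of quartic moments into the stated constant.

For `h = 0` and low temperature the phase has two symmetric minima; the integrals are even in the
field, so that they can be restricted to the half-line containing the positive one.
-/

/-! ### A weighted Lubell–Yamamoto–Meshalkin inequality -/

namespace CurieWeiss

variable {ι : Type*}

/-- The total weight `∑ f(S) ∏_{i ∈ S} λ_i` over the `c`-element subsets `S` of `g`. -/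
noncomputable def levelSum (l : ι → ℝ) (f : Finset ι → ℝ) (g : Finset ι) (c : ℕ) : ℝ :=
  ∑ S ∈ g.powersetCard c, f S * ∏ i ∈ S, l i

/-- The elementary symmetric function of the weights on `g`. -/
noncomputable def levelMass (l : ι → ℝ) (g : Finset ι) (c : ℕ) : ℝ := levelSum l (fun _ => 1) g c

theorem levelSum_zero (l : ι → ℝ) (f : Finset ι → ℝ) (g : Finset ι) :
    levelSum l f g 0 = f ∅ := by
  simp [levelSum]

theorem levelSum_insert [DecidableEq ι] (l : ι → ℝ) (f : Finset ι → ℝ) {g : Finset ι} {a : ι}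
    (ha : a ∉ g) (c : ℕ) : levelSum l f (insert a g) (c + 1)
      = levelSum l f g (c + 1) + l a * levelSum l (fun S => f (insert a S)) g c := by
  unfold levelSum
  rw [Finset.powersetCard_succ_insert ha, Finset.sum_union, Finset.sum_image, Finset.mul_sum]
  · congr 1
    refine Finset.sum_congr rfl fun S hS => ?_
    have : a ∉ S := fun h => ha ((Finset.mem_powersetCard.1 hS).1 h)
    rw [Finset.prod_insert this]; ring
  · intro S hS T hT h
    have h1 : a ∉ S := fun h => ha ((Finset.mem_powersetCard.1 hS).1 h)
    have h2 : a ∉ T := fun h => ha ((Finset.mem_powersetCard.1 hT).1 h)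
    rw [← Finset.erase_insert h1, ← Finset.erase_insert h2]
    exact congrArg (fun U => U.erase a) h
  · rw [Finset.disjoint_left]
    intro S hS hS'
    obtain ⟨T, -, rfl⟩ := Finset.mem_image.1 hS'
    exact ha ((Finset.mem_powersetCard.1 hS).1 (Finset.mem_insert_self a T))

theorem levelSum_of_card_lt (l : ι → ℝ) (f : Finset ι → ℝ) {g : Finset ι} {c : ℕ}
    (hc : g.card < c) : levelSum l f g c = 0 := by
  simp [levelSum, Finset.powersetCard_eq_empty.2 hc]

theorem levelMass_insert [DecidableEq ι] (l : ι → ℝ) {g : Finset ι} {a : ι} (ha : a ∉ g)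
    (c : ℕ) :
    levelMass l (insert a g) (c + 1) = levelMass l g (c + 1) + l a * levelMass l g c :=
  levelSum_insert l _ ha c

theorem levelMass_zero (l : ι → ℝ) (g : Finset ι) : levelMass l g 0 = 1 := levelSum_zero _ _ _

theorem levelMass_pos {l : ι → ℝ} (hl : ∀ i, 0 < l i) {g : Finset ι} {c : ℕ} (hc : c ≤ g.card) :
    0 < levelMass l g c := by
  unfold levelMass levelSum
  refine Finset.sum_pos (fun S _ => ?_) (Finset.powersetCard_nonempty.2 hc)
  rw [one_mul]
  exact Finset.prod_pos fun i _ => hl i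

theorem levelMass_nonneg {l : ι → ℝ} (hl : ∀ i, 0 < l i) (g : Finset ι) (c : ℕ) :
    0 ≤ levelMass l g c := by
  rcases le_or_gt c g.card with h | h
  · exact (levelMass_pos hl h).le
  · exact (levelSum_of_card_lt l _ h).ge

/-- Two consecutive ratios of a positive log-concave sequence can be compared at distance two. -/
theorem mul_le_mul_of_logConcave {a b c d : ℝ} (hb : 0 ≤ b) (hd : 0 ≤ d)
    (hc : 0 ≤ c) (h1 : a * c ≤ b ^ 2) (h2 : b * d ≤ c ^ 2) (h0 : b = 0 → d = 0)
    (h0' : c = 0 → d = 0) :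
    a * d ≤ b * c := by
  rcases hb.eq_or_lt with h | hb
  · simp [h0 h.symm]; positivity
  rcases hc.eq_or_lt with h | hc
  · simp [h0' h.symm]; positivity
  have : (a * d) * (b * c) ≤ (b * c) * (b * c) := by
    calc (a * d) * (b * c) = (a * c) * (b * d) := by ring
      _ ≤ b ^ 2 * c ^ 2 := by gcongr
      _ = _ := by ring
  exact le_of_mul_le_mul_right this (by positivity)

/-- Newton's inequality in its weak form: the elementary symmetric functions of positive
weights form a log-concave sequence. -/
theorem levelMass_logConcave [DecidableEq ι] {l : ι → ℝ} (hl : ∀ i, 0 < l i) (g : Finset ι)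
    (c : ℕ) : levelMass l g c * levelMass l g (c + 2) ≤ levelMass l g (c + 1) ^ 2 := by
  induction g using Finset.induction_on generalizing c with
  | empty =>
    have : levelMass l ∅ (c + 2) = 0 := levelSum_of_card_lt l _ (by simp)
    rw [this, mul_zero]; positivity
  | insert a g ha ih =>
    have hn := fun c => levelMass_nonneg hl g c
    have hla := (hl a).le
    have hz : ∀ {i j : ℕ}, i ≤ j → levelMass l g i = 0 → levelMass l g j = 0 := by
      intro i j hij h
      refine levelSum_of_card_lt l _ ?_
      by_contra hcon
      exact (levelMass_pos hl (by omega : i ≤ g.card)).ne' h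
    cases c with
    | zero =>
      rw [levelMass_insert l ha, levelMass_insert l ha, levelMass_zero, levelMass_zero]
      have h1 := ih 0
      rw [levelMass_zero] at h1
      have := hn 1
      nlinarith [sq_nonneg (l a), mul_nonneg hla (hn 1)]
    | succ c =>
      rw [levelMass_insert l ha, levelMass_insert l ha, levelMass_insert l ha]
      have h1 := ih c
      have h2 := ih (c + 1)
      have h3 : levelMass l g c * levelMass l g (c + 3)
          ≤ levelMass l g (c + 1) * levelMass l g (c + 2) :=
        mul_le_mul_of_logConcave (hn _) (hn _) (hn _) h1 h2 (hz (by omega)) (hz (by omega))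
      have e1 : c + 1 + 2 = c + 3 := rfl
      have e2 : c + 1 + 1 = c + 2 := rfl
      rw [e1, e2] at *
      have h4 := mul_le_mul_of_nonneg_left h3 hla
      have h5 := mul_le_mul_of_nonneg_left h1 (sq_nonneg (l a))
      nlinarith

/-- For a monotone `f` the average of `f` over the `c`-th level, with respect to product
weights, is nondecreasing in `c`. This is the normalized matching property of the weighted
cube, written without denominators. -/
theorem levelSum_mul_levelMass_le [DecidableEq ι] {l : ι → ℝ} (hl : ∀ i, 0 < l i)
    (g : Finset ι) {f : Finset ι → ℝ} (hf : Monotone f) (c : ℕ) :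
    levelSum l f g c * levelMass l g (c + 1) ≤ levelSum l f g (c + 1) * levelMass l g c := by
  induction g using Finset.induction_on generalizing c f with
  | empty =>
    have h1 : levelMass l ∅ (c + 1) = 0 := levelSum_of_card_lt l _ (by simp)
    have h2 : levelSum l f ∅ (c + 1) = 0 := levelSum_of_card_lt l _ (by simp)
    simp [h1, h2]
  | insert a g ha ih =>
    have hf1 : Monotone fun S => f (insert a S) :=
      fun S T h => hf (Finset.insert_subset_insert a h)
    have hle : ∀ c, levelSum l f g c ≤ levelSum l (fun S => f (insert a S)) g c := fun c =>
      Finset.sum_le_sum fun S _ => mul_le_mul_of_nonneg_right (hf (Finset.subset_insert a S))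
        (Finset.prod_nonneg fun i _ => (hl i).le)
    have hla := (hl a).le
    set v : ℕ → ℝ := levelSum l (fun S => f (insert a S)) g with hv
    cases c with
    | zero =>
      rw [levelMass_insert l ha, levelSum_insert l f ha, levelMass_zero, levelMass_zero,
        levelSum_zero]
      have h1 := ih hf 0
      rw [levelMass_zero, levelSum_zero] at h1
      have h2 := hle 0
      rw [levelSum_zero] at h2
      nlinarith [mul_le_mul_of_nonneg_left h2 hla]
    | succ c =>
      rw [levelMass_insert l ha, levelSum_insert l f ha, levelMass_insert l ha,
        levelSum_insert l f ha, ← hv]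
      have h1 := ih hf (c + 1)
      have h2 : v c * levelMass l g (c + 1) ≤ v (c + 1) * levelMass l g c := ih hf1 c
      have hlc := levelMass_logConcave hl g c
      -- the coefficient of `l a` is where log-concavity of the level masses enters
      have h3 : levelSum l f g (c + 1) * levelMass l g (c + 1) + v c * levelMass l g (c + 2)
          ≤ levelSum l f g (c + 2) * levelMass l g c + v (c + 1) * levelMass l g (c + 1) := by
        rcases (levelMass_nonneg hl g (c + 1)).eq_or_lt with h | hpos
        · have hc : g.card < c + 1 := by
            by_contra hcon
            exact (levelMass_pos hl (not_lt.1 hcon)).ne h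
          have e1 : levelMass l g (c + 2) = 0 := levelSum_of_card_lt l _ (by omega)
          have e2 : levelSum l f g (c + 2) = 0 := levelSum_of_card_lt l _ (by omega)
          simp [← h, e1, e2]
        · have h0 := levelMass_nonneg hl g c
          have h0' := levelMass_nonneg hl g (c + 2)
          refine le_of_mul_le_mul_right ?_ hpos
          have i1 := mul_le_mul_of_nonneg_right h1 h0
          have i2 := mul_le_mul_of_nonneg_right h2 h0'
          have i3 := mul_nonneg (sub_nonneg.2 (hle (c + 1))) (sub_nonneg.2 hlc)
          have e2 : c + 1 + 1 = c + 2 := rfl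
          rw [e2] at *
          nlinarith
      have h4 := mul_le_mul_of_nonneg_left h3 hla
      have h5 := mul_le_mul_of_nonneg_left h2 (sq_nonneg (l a))
      have e2 : c + 1 + 1 = c + 2 := rfl
      rw [e2] at *
      nlinarith

open Classical in
/-- A weighted Lubell–Yamamoto–Meshalkin inequality: for product weights on the subsets of `g`,
an antichain weighs at most as much as the heaviest level. -/
theorem sum_antichain_le {l : ι → ℝ} (hl : ∀ i, 0 < l i) (g : Finset ι) {A : Set (Finset ι)}
    (hA : IsAntichain (· ⊆ ·) A) {B : ℝ} (hB : ∀ c, levelMass l g c ≤ B) :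
    ∑ S ∈ g.powerset, (if S ∈ A then 1 else 0) * ∏ i ∈ S, l i ≤ B := by
  set a : Finset ι → ℝ := fun S => if S ∈ A then 1 else 0 with ha
  -- the indicator of the up-set generated by `A`
  set u : Finset ι → ℝ := fun S => if ∃ T ∈ A, T ⊆ S then 1 else 0 with hu
  have hstep : ∀ c, levelSum l u g c * levelMass l g (c + 1)
      ≤ (levelSum l u g (c + 1) - levelSum l a g (c + 1)) * levelMass l g c := by
    intro c
    -- members of `A` are minimal in the up-set, so removing one level of them leaves an up-set
    set u' : Finset ι → ℝ :=
      fun S => if (∃ T ∈ A, T ⊆ S) ∧ ¬ (S ∈ A ∧ S.card = c + 1) then 1 else 0 with hu'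
    have hmono : Monotone u' := by
      intro S T hST
      simp only [hu']
      split_ifs with h1 h2 h2
      · exact le_rfl
      · exfalso
        obtain ⟨⟨X, hX, hXS⟩, h1⟩ := h1
        refine h2 ⟨⟨X, hX, hXS.trans hST⟩, fun ⟨hT, hc⟩ => ?_⟩
        have : X = T := by
          by_contra hne
          exact hA hX hT hne (hXS.trans hST)
        subst this
        have : X = S := Finset.Subset.antisymm hXS hST
        subst this
        exact h1 ⟨hT, hc⟩
      · exact zero_le_one
      · exact le_rfl
    have h := levelSum_mul_levelMass_le hl g hmono c
    have e1 : levelSum l u' g c = levelSum l u g c := by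
      refine Finset.sum_congr rfl fun S hS => ?_
      have : S.card ≠ c + 1 := by rw [(Finset.mem_powersetCard.1 hS).2]; omega
      simp [hu', hu, this]
    have e2 : levelSum l u' g (c + 1) = levelSum l u g (c + 1) - levelSum l a g (c + 1) := by
      unfold levelSum
      rw [← Finset.sum_sub_distrib]
      refine Finset.sum_congr rfl fun S hS => ?_
      rw [← sub_mul]
      congr 1
      have hcard := (Finset.mem_powersetCard.1 hS).2
      simp only [hu', hu, ha]
      by_cases hS : S ∈ A
      · have : ∃ T ∈ A, T ⊆ S := ⟨S, hS, Finset.Subset.refl S⟩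
        simp [hS, hcard, this]
      · simp [hS]
    rwa [e1, e2] at h
  have hsum : ∀ c ≤ g.card, ∑ j ∈ Finset.range (c + 1), levelSum l a g j / levelMass l g j
      ≤ levelSum l u g c / levelMass l g c := by
    intro c
    induction c with
    | zero =>
      intro _
      simp only [zero_add, Finset.sum_range_one, levelMass_zero, levelSum_zero, div_one]
      simp only [ha, hu]
      split_ifs with h1 h2 h2
      · exact le_rfl
      · exact absurd ⟨∅, h1, Finset.Subset.refl _⟩ h2
      · exact zero_le_one
      · exact le_rfl
    | succ c ih =>
      intro hc
      rw [Finset.sum_range_succ]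
      have hp := levelMass_pos hl hc
      have hp' := levelMass_pos hl (show c ≤ g.card by omega)
      have h1 := ih (by omega)
      have h2 : levelSum l u g c / levelMass l g c
          ≤ (levelSum l u g (c + 1) - levelSum l a g (c + 1)) / levelMass l g (c + 1) := by
        rw [div_le_div_iff₀ hp' hp]
        exact hstep c
      rw [sub_div] at h2
      linarith
  have hprod : ∀ S : Finset ι, 0 ≤ ∏ i ∈ S, l i := fun S => Finset.prod_nonneg fun i _ => (hl i).le
  have ha0 : ∀ c, 0 ≤ levelSum l a g c := fun c => Finset.sum_nonneg fun S _ =>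
    mul_nonneg (by simp only [ha]; split_ifs <;> norm_num) (hprod S)
  have htop : levelSum l u g g.card / levelMass l g g.card ≤ 1 := by
    rw [div_le_one (levelMass_pos hl le_rfl)]
    refine Finset.sum_le_sum fun S _ => mul_le_mul_of_nonneg_right ?_ (hprod S)
    simp only [hu]; split_ifs <;> norm_num
  have hB0 : 0 ≤ B := (levelMass_nonneg hl g 0).trans (hB 0)
  rw [Finset.sum_powerset]
  calc ∑ j ∈ Finset.range (g.card + 1), ∑ S ∈ g.powersetCard j, a S * ∏ i ∈ S, l i
      ≤ ∑ j ∈ Finset.range (g.card + 1), B * (levelSum l a g j / levelMass l g j) := by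
        refine Finset.sum_le_sum fun j hj => ?_
        have hp := levelMass_pos hl (show j ≤ g.card by have := Finset.mem_range.1 hj; omega)
        rw [mul_div_assoc', le_div_iff₀ hp, mul_comm B]
        exact mul_le_mul_of_nonneg_left (hB j) (ha0 j)
    _ = B * ∑ j ∈ Finset.range (g.card + 1), levelSum l a g j / levelMass l g j := by
        rw [Finset.mul_sum]
    _ ≤ B * 1 := mul_le_mul_of_nonneg_left ((hsum _ le_rfl).trans htop) hB0
    _ = B := mul_one B

end CurieWeiss

/-! ### Littlewood–Offord for tilted product measures -/

namespace CurieWeiss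
open MeasureTheory

/-- Orthogonality of the characters on an interval of length `π`. -/
theorem integral_exp_two_mul_I (m : ℤ) :
    ∫ u in (-(Real.pi / 2))..(Real.pi / 2), Complex.exp (2 * m * Complex.I * u)
      = if m = 0 then (Real.pi : ℂ) else 0 := by
  split_ifs with h
  · subst h
    simp
  · have hm : (2 * m * Complex.I : ℂ) ≠ 0 := by
      simp [h]
    rw [integral_exp_mul_complex hm]
    have : Complex.exp (2 * m * Complex.I * ((Real.pi / 2 : ℝ) : ℂ))
        = Complex.exp (2 * m * Complex.I * ((-(Real.pi / 2) : ℝ) : ℂ)) := by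
      rw [Complex.exp_eq_exp_iff_exists_int]
      exact ⟨m, by push_cast; ring⟩
    rw [this, sub_self, zero_div]

/-- The elementary symmetric functions as Fourier coefficients of their generating polynomial. -/
theorem levelMass_eq_integral {ι : Type*} (l : ι → ℝ) (g : Finset ι) (c : ℕ) :
    (levelMass l g c : ℂ) = 1 / Real.pi * ∫ u in (-(Real.pi / 2))..(Real.pi / 2),
      Complex.exp (-(2 * c * Complex.I * u)) *
        ∏ i ∈ g, (1 + l i * Complex.exp (2 * Complex.I * u)) := by
  have key : ∀ u : ℝ, Complex.exp (-(2 * c * Complex.I * u)) *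
        ∏ i ∈ g, (1 + l i * Complex.exp (2 * Complex.I * u))
      = ∑ j ∈ Finset.range (g.card + 1),
          (levelMass l g j : ℂ) * Complex.exp (2 * ((j - c : ℤ) : ℂ) * Complex.I * u) := by
    intro u
    rw [Finset.prod_one_add, Finset.sum_powerset, Finset.mul_sum]
    refine Finset.sum_congr rfl fun j _ => ?_
    simp only [levelMass, levelSum]
    push_cast
    rw [Finset.mul_sum, Finset.sum_mul]
    refine Finset.sum_congr rfl fun S hS => ?_
    rw [Finset.prod_mul_distrib, Finset.prod_const, (Finset.mem_powersetCard.1 hS).2, one_mul,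
      ← Complex.exp_nat_mul, mul_left_comm, ← Complex.exp_add]
    congr 2
    ring
  simp_rw [key]
  rw [intervalIntegral.integral_finsetSum]
  · simp_rw [intervalIntegral.integral_const_mul, integral_exp_two_mul_I]
    have hpi : (Real.pi : ℂ) ≠ 0 := by exact_mod_cast Real.pi_ne_zero
    rcases le_or_gt c g.card with h | h
    · rw [Finset.sum_eq_single c]
      · simp; field_simp
      · intro j _ hj
        have : (j : ℤ) - c ≠ 0 := by omega
        simp [this]
      · intro h'; simp at h'; omega
    · rw [Finset.sum_eq_zero]
      · rw [levelMass, levelSum_of_card_lt l _ h]; simp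
      · intro j hj
        have : (j : ℤ) - c ≠ 0 := by have := Finset.mem_range.1 hj; omega
        simp [this]
  · intro j _
    apply Continuous.intervalIntegrable
    fun_prop

/-- The quantity `4 (cosh² θ - sin² u) = |2 cosh (θ + i u)|²`. -/
noncomputable def tiltKernel (θ u : ℝ) : ℝ := 4 * (Real.cosh θ ^ 2 - Real.sin u ^ 2)

theorem tiltKernel_nonneg (θ u : ℝ) : 0 ≤ tiltKernel θ u := by
  have h1 := Real.one_le_cosh θ
  have h2 := Real.sin_sq_le_one u
  unfold tiltKernel
  nlinarith

/-- The mass that the measure with density `exp (θ ∑ σ)` gives to the balanced configurations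
`{∑_{i ≤ k} σ_i = ∑_{i > k} σ_i}` on `2k` vertices, as a Fourier integral. -/
noncomputable def balancedMass (k : ℕ) (θ : ℝ) : ℝ :=
  1 / Real.pi * ∫ u in (-(Real.pi / 2))..(Real.pi / 2), tiltKernel θ u ^ k

theorem exp_two_mul_I_eq (u : ℝ) : Complex.exp (2 * Complex.I * u)
    = ((Real.cos (2 * u) : ℝ) : ℂ) + ((Real.sin (2 * u) : ℝ) : ℂ) * Complex.I := by
  rw [show 2 * Complex.I * (u : ℂ) = ((2 * u : ℝ) : ℂ) * Complex.I by push_cast; ring,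
    Complex.exp_mul_I, Complex.ofReal_cos, Complex.ofReal_sin]

theorem norm_one_add_exp (a u : ℝ) :
    ‖(1 + Real.exp (2 * a) * Complex.exp (2 * Complex.I * u) : ℂ)‖
      = Real.exp a * Real.sqrt (tiltKernel a u) := by
  rw [← Real.sqrt_sq (Real.exp_pos a).le, ← Real.sqrt_mul (sq_nonneg _), Complex.norm_def]
  congr 1
  rw [exp_two_mul_I_eq, Complex.normSq_apply]
  simp only [Complex.add_re, Complex.add_im, Complex.mul_re, Complex.mul_im, Complex.ofReal_re,
    Complex.ofReal_im, Complex.I_re, Complex.I_im, Complex.one_re, Complex.one_im]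
  have h1 : Real.exp (2 * a) = Real.exp a ^ 2 := by rw [sq, ← Real.exp_add]; ring_nf
  have h2 : Real.exp a * Real.cosh a = (Real.exp a ^ 2 + 1) / 2 := by
    rw [Real.cosh_eq, Real.exp_neg]; field_simp
  have h3 : Real.exp a ^ 2 * tiltKernel a u
      = (Real.exp a ^ 2 + 1) ^ 2 - 4 * Real.exp a ^ 2 * Real.sin u ^ 2 := by
    unfold tiltKernel
    linear_combination 4 * (Real.exp a * Real.cosh a + (Real.exp a ^ 2 + 1) / 2) * h2
  rw [h3, h1]
  have h4 := Real.sin_sq_add_cos_sq (2 * u)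
  have h5 : Real.cos (2 * u) = 1 - 2 * Real.sin u ^ 2 := by
    rw [Real.cos_two_mul]; linear_combination 2 * Real.sin_sq_add_cos_sq u
  linear_combination Real.exp a ^ 4 * h4 + 2 * Real.exp a ^ 2 * h5

theorem tiltKernel_mul_units (θ u : ℝ) (s : ℤˣ) :
    tiltKernel (θ * ((s : ℤ) : ℝ)) u = tiltKernel θ u := by
  rcases Int.units_eq_one_or s with rfl | rfl <;> simp [tiltKernel]

/-- For any pattern of signs, no level of the tilted cube is heavier than the balanced
configurations: the Fourier transform of the level masses is bounded by its modulus. -/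
theorem levelMass_le_balancedMass (k : ℕ) (θ : ℝ) (s : Fin (k + k) → ℤˣ) (c : ℕ) :
    levelMass (fun i => Real.exp (2 * (θ * ((s i : ℤ) : ℝ)))) Finset.univ c
      ≤ Real.exp (θ * ∑ i, ((s i : ℤ) : ℝ)) * balancedMass k θ := by
  set l : Fin (k + k) → ℝ := fun i => Real.exp (2 * (θ * ((s i : ℤ) : ℝ))) with hl
  have hpi := Real.pi_pos
  have h0 : levelMass l Finset.univ c ≤ ‖(levelMass l Finset.univ c : ℂ)‖ := by
    rw [Complex.norm_real]; exact le_abs_self _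
  refine h0.trans ?_
  rw [levelMass_eq_integral, norm_mul]
  have h1 : ‖(1 / Real.pi : ℂ)‖ = 1 / Real.pi := by
    rw [show (1 / Real.pi : ℂ) = ((1 / Real.pi : ℝ) : ℂ) by push_cast; rfl, Complex.norm_real,
      Real.norm_of_nonneg (by positivity)]
  rw [h1, balancedMass, mul_left_comm, ← intervalIntegral.integral_const_mul]
  refine mul_le_mul_of_nonneg_left ?_ (by positivity)
  refine (intervalIntegral.norm_integral_le_integral_norm (by linarith)).trans (le_of_eq ?_)
  congr 1
  ext u
  rw [norm_mul, norm_prod]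
  have h2 : ‖Complex.exp (-(2 * c * Complex.I * u))‖ = 1 := by
    rw [show -(2 * c * Complex.I * (u : ℂ)) = ((-(2 * c * u) : ℝ) : ℂ) * Complex.I by
      push_cast; ring, Complex.norm_exp_ofReal_mul_I]
  have h3 : ∀ i, ‖(1 + (l i : ℂ) * Complex.exp (2 * Complex.I * u) : ℂ)‖
      = Real.exp (θ * ((s i : ℤ) : ℝ)) * Real.sqrt (tiltKernel θ u) := by
    intro i
    rw [hl, norm_one_add_exp, tiltKernel_mul_units]
  simp_rw [h2, h3, one_mul]
  rw [Finset.prod_mul_distrib, ← Real.exp_sum, Finset.mul_sum, Finset.prod_const,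
    Finset.card_univ, Fintype.card_fin, pow_add, ← mul_pow,
    Real.mul_self_sqrt (tiltKernel_nonneg θ u)]

/-- The sign pattern `(1, …, 1, -1, …, -1)` with `k` entries of each sign. -/
def halfSigns (k : ℕ) : Fin (k + k) → ℤˣ := Fin.append (fun _ => 1) (fun _ => -1)

theorem sum_halfSigns (k : ℕ) : ∑ i, ((halfSigns k i : ℤ) : ℝ) = 0 := by
  rw [Fin.sum_univ_add]
  simp only [halfSigns, Fin.append_left, Fin.append_right]
  simp

theorem levelMass_halfSigns (k : ℕ) (θ : ℝ) :
    levelMass (fun i => Real.exp (2 * (θ * ((halfSigns k i : ℤ) : ℝ)))) Finset.univ k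
      = balancedMass k θ := by
  have h : ∀ u : ℝ, Complex.exp (-(2 * k * Complex.I * u)) *
      ∏ i : Fin (k + k), (1 + ((Real.exp (2 * (θ * ((halfSigns k i : ℤ) : ℝ))) : ℝ) : ℂ)
        * Complex.exp (2 * Complex.I * u)) = ((tiltKernel θ u ^ k : ℝ) : ℂ) := by
    intro u
    rw [Fin.prod_univ_add]
    simp only [halfSigns, Fin.append_left, Fin.append_right, Finset.prod_const, Finset.card_univ,
      Fintype.card_fin]
    rw [← mul_pow, show -(2 * k * Complex.I * (u : ℂ)) = k * (-(2 * Complex.I * u)) by ring,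
      Complex.exp_nat_mul, ← mul_pow]
    push_cast
    congr 1
    have e1 : Complex.exp (2 * Complex.I * u) = Complex.exp (Complex.I * u) ^ 2 := by
      rw [sq, ← Complex.exp_add]; ring_nf
    have e2 : Complex.exp (2 * (θ * 1)) = Complex.exp θ ^ 2 := by
      rw [sq, ← Complex.exp_add]; ring_nf
    have e3 : Complex.exp (2 * (θ * (-1))) = (Complex.exp θ ^ 2)⁻¹ := by
      rw [← e2, ← Complex.exp_neg]; ring_nf
    have e4 : ((tiltKernel θ u : ℝ) : ℂ) = 4 * (Complex.cosh θ ^ 2 - Complex.sin u ^ 2) := by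
      simp [tiltKernel]
    rw [Complex.exp_neg, e1, e2, e3, e4, Complex.cosh, Complex.sin, Complex.exp_neg,
      show -(u : ℂ) * Complex.I = -(Complex.I * u) by ring, Complex.exp_neg,
      show (u : ℂ) * Complex.I = Complex.I * u by ring]
    have n1 := Complex.exp_ne_zero (Complex.I * u)
    have n2 := Complex.exp_ne_zero (θ : ℂ)
    field_simp
    ring_nf
    simp only [Complex.I_sq]
    ring
  have := levelMass_eq_integral
    (fun i => Real.exp (2 * (θ * ((halfSigns k i : ℤ) : ℝ)))) Finset.univ k
  simp_rw [h] at this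
  rw [intervalIntegral.integral_ofReal] at this
  rw [balancedMass]
  exact_mod_cast this

/-- Configurations correspond to the sets of vertices on which they agree with the signs `s`. -/
def agreementEquiv {n : ℕ} (s : Fin n → ℤˣ) : (Fin n → ℤˣ) ≃ Finset (Fin n) where
  toFun σ := Finset.univ.filter fun i => σ i = s i
  invFun S := fun i => if i ∈ S then s i else - s i
  left_inv σ := by
    ext i
    by_cases h : σ i = s i
    · simp [h]
    · have : σ i = - s i := by
        rcases Int.units_eq_one_or (σ i) with h1 | h1 <;>
        rcases Int.units_eq_one_or (s i) with h2 | h2 <;> simp_all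
      simp [this]
  right_inv S := by
    ext i
    by_cases h : i ∈ S
    · simp [h]
    · have : ¬ (- s i = s i) := by
        rcases Int.units_eq_one_or (s i) with h2 | h2 <;> simp [h2]
      simp [h]

theorem sum_mul_agreementEquiv_symm {n : ℕ} (s : Fin n → ℤˣ) (S : Finset (Fin n)) (v : Fin n → ℝ) :
    ∑ i, v i * ((((agreementEquiv s).symm S i : ℤˣ) : ℤ) : ℝ)
      = 2 * ∑ i ∈ S, v i * ((s i : ℤ) : ℝ) - ∑ i, v i * ((s i : ℤ) : ℝ) := by
  have h : ∀ i, v i * ((((agreementEquiv s).symm S i : ℤˣ) : ℤ) : ℝ)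
      = 2 * (if i ∈ S then v i * ((s i : ℤ) : ℝ) else 0) - v i * ((s i : ℤ) : ℝ) := by
    intro i
    by_cases h : i ∈ S
    · simp [agreementEquiv, h]; ring
    · simp [agreementEquiv, h]
  simp_rw [h]
  rw [Finset.sum_sub_distrib, ← Finset.mul_sum, Finset.sum_ite_mem, Finset.univ_inter]

theorem exp_agreementEquiv_symm {n : ℕ} (s : Fin n → ℤˣ) (S : Finset (Fin n)) (θ : ℝ) :
    Real.exp (θ * ∑ i, ((((agreementEquiv s).symm S i : ℤˣ) : ℤ) : ℝ))
      = Real.exp (-(θ * ∑ i, ((s i : ℤ) : ℝ))) *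
        ∏ i ∈ S, Real.exp (2 * (θ * ((s i : ℤ) : ℝ))) := by
  have := sum_mul_agreementEquiv_symm s S (fun _ => 1)
  simp only [one_mul] at this
  rw [this, ← Real.exp_sum, ← Real.exp_add]
  congr 1
  simp only [Finset.mul_sum, mul_sub]
  rw [neg_add_eq_sub]
  congr 1
  exact Finset.sum_congr rfl fun i _ => by ring

/-- The configurations whose signed sum falls into the interval. -/
def slab {n : ℕ} (v : Fin n → ℝ) (x : ℝ) : Set (Fin n → ℤˣ) :=
  {σ | ∑ i, v i * ((σ i : ℤ) : ℝ) ∈ Set.Ioo (x - 1) (x + 1)}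

open Classical in
/-- Littlewood–Offord for the product measure with tilt `θ`: no slab is heavier than the set of
balanced configurations. -/
theorem sum_slab_exp_le (k : ℕ) (θ : ℝ) {v : Fin (k + k) → ℝ} (hv : ∀ i, 1 ≤ |v i|) (x : ℝ) :
    ∑ σ, (slab v x).indicator (fun σ => Real.exp (θ * ∑ i, ((σ i : ℤ) : ℝ))) σ
      ≤ balancedMass k θ := by
  set s : Fin (k + k) → ℤˣ := fun i => if 0 ≤ v i then 1 else -1 with hs
  have hvs : ∀ i, v i * ((s i : ℤ) : ℝ) = |v i| := by
    intro i
    simp only [hs]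
    split_ifs with h
    · simp [abs_of_nonneg h]
    · simp [abs_of_neg (not_le.1 h)]
  set A : Set (Finset (Fin (k + k))) := {S | (agreementEquiv s).symm S ∈ slab v x} with hA
  have hanti : IsAntichain (· ⊆ ·) A := by
    intro S hS T hT hne hST
    simp only [hA, slab, Set.mem_ofPred_eq, sum_mul_agreementEquiv_symm, hvs, Set.mem_Ioo]
      at hS hT
    obtain ⟨j, hjT, hjS⟩ := Finset.exists_of_ssubset (hST.ssubset_of_ne hne)
    have h1 : ∑ i ∈ insert j S, |v i| ≤ ∑ i ∈ T, |v i| :=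
      Finset.sum_le_sum_of_subset_of_nonneg (Finset.insert_subset hjT hST)
        fun i _ _ => abs_nonneg _
    rw [Finset.sum_insert hjS] at h1
    linarith [hv j]
  have h := sum_antichain_le (l := fun i => Real.exp (2 * (θ * ((s i : ℤ) : ℝ))))
    (fun i => Real.exp_pos _) Finset.univ hanti (levelMass_le_balancedMass k θ s)
  rw [← (agreementEquiv s).symm.sum_comp]
  rw [Finset.powerset_univ] at h
  calc _ = Real.exp (-(θ * ∑ i, ((s i : ℤ) : ℝ))) * ∑ S : Finset (Fin (k + k)),
        (if S ∈ A then 1 else 0) * ∏ i ∈ S, Real.exp (2 * (θ * ((s i : ℤ) : ℝ))) := by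
        rw [Finset.mul_sum]
        refine Finset.sum_congr rfl fun S _ => ?_
        rw [Set.indicator_apply, exp_agreementEquiv_symm]
        by_cases hS : (agreementEquiv s).symm S ∈ slab v x
        · have : S ∈ A := hS
          simp [hS, this]
        · have : S ∉ A := hS
          simp [hS, this]
    _ ≤ Real.exp (-(θ * ∑ i, ((s i : ℤ) : ℝ))) *
        (Real.exp (θ * ∑ i, ((s i : ℤ) : ℝ)) * balancedMass k θ) :=
        mul_le_mul_of_nonneg_left h (Real.exp_pos _).le
    _ = balancedMass k θ := by
        rw [← mul_assoc, ← Real.exp_add, neg_add_cancel, Real.exp_zero, one_mul]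

/-- The slab of the coefficients `(1, …, 1, -1, …, -1)` around `0`. -/
theorem sum_slab_halfSigns (k : ℕ) (θ : ℝ) :
    ∑ σ, (slab (fun i => ((halfSigns k i : ℤ) : ℝ)) 0).indicator
      (fun σ => Real.exp (θ * ∑ i, ((σ i : ℤ) : ℝ))) σ = balancedMass k θ := by
  classical
  rw [← levelMass_halfSigns, ← (agreementEquiv (halfSigns k)).symm.sum_comp, levelMass, levelSum,
    ← Finset.univ_filter_card_eq, Finset.sum_filter]
  refine Finset.sum_congr rfl fun S _ => ?_
  rw [Set.indicator_apply, exp_agreementEquiv_symm, sum_halfSigns]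
  have hsq : ∀ i, ((halfSigns k i : ℤ) : ℝ) * ((halfSigns k i : ℤ) : ℝ) = 1 := by
    intro i
    rcases Int.units_eq_one_or (halfSigns k i) with h | h <;> simp [h]
  have hmem : (agreementEquiv (halfSigns k)).symm S ∈ slab (fun i => ((halfSigns k i : ℤ) : ℝ)) 0
      ↔ S.card = k := by
    simp only [slab, Set.mem_ofPred_eq, sum_mul_agreementEquiv_symm, hsq, Set.mem_Ioo]
    simp only [Finset.sum_const, Finset.card_univ, Fintype.card_fin, nsmul_eq_mul, mul_one]
    constructor
    · rintro ⟨h1, h2⟩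
      have h1 : ((k : ℤ) : ℝ) < ((S.card + 1 : ℤ) : ℝ) := by push_cast at *; linarith
      have h2 : ((S.card : ℤ) : ℝ) < ((k + 1 : ℤ) : ℝ) := by push_cast at *; linarith
      have := Int.cast_lt.1 h1
      have := Int.cast_lt.1 h2
      omega
    · intro h
      rw [h]; push_cast; constructor <;> linarith
  simp [hmem]

end CurieWeiss

/-! ### The Hubbard–Stratonovich transformation -/

namespace CurieWeiss
open MeasureTheory

/-- The strength `κ = √(2 d β)` with which the Gaussian field of the Hubbard–Stratonovich
transformation acts on the spins. -/
noncomputable def coupling (d : ℕ) (β : ℝ) : ℝ := Real.sqrt (2 * d * β)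

theorem gaussian_mul_exp_eq {d : ℕ} {β : ℝ} (hβ : 0 ≤ β) (h : ℝ) {n : ℕ} (hn : 0 < n)
    (σ : Fin n → ℤˣ) (x : ℝ) :
    Real.exp (-(n * x ^ 2 / 2)) * Real.exp ((coupling d β * x + h) * ∑ i, ((σ i : ℤ) : ℝ))
      = weight d β h σ *
        Real.exp (-(n / 2 : ℝ) * (x - coupling d β * (∑ i, ((σ i : ℤ) : ℝ)) / n) ^ 2) := by
  have hn' : (n : ℝ) ≠ 0 := by positivity
  have hk : coupling d β ^ 2 = 2 * d * β := Real.sq_sqrt (by positivity)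
  rw [weight, ← Real.exp_add, ← Real.exp_add]
  congr 1
  field_simp
  linear_combination ((∑ i, ((σ i : ℤ) : ℝ)) ^ 2) * hk

theorem integrable_gaussian_mul_exp {d : ℕ} {β : ℝ} (hβ : 0 ≤ β) (h : ℝ) {n : ℕ} (hn : 0 < n)
    (σ : Fin n → ℤˣ) :
    Integrable fun x : ℝ => Real.exp (-(n * x ^ 2 / 2)) *
      Real.exp ((coupling d β * x + h) * ∑ i, ((σ i : ℤ) : ℝ)) := by
  simp_rw [gaussian_mul_exp_eq hβ h hn σ]
  have hb : (0 : ℝ) < n / 2 := by positivity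
  exact ((integrable_exp_neg_mul_sq hb).comp_sub_right _).const_mul _

/-- The Hubbard–Stratonovich transformation: the Curie–Weiss weight is a Gaussian mixture of
product weights. -/
theorem integral_gaussian_mul_exp {d : ℕ} {β : ℝ} (hβ : 0 ≤ β) (h : ℝ) {n : ℕ} (hn : 0 < n)
    (σ : Fin n → ℤˣ) :
    ∫ x : ℝ, Real.exp (-(n * x ^ 2 / 2)) *
      Real.exp ((coupling d β * x + h) * ∑ i, ((σ i : ℤ) : ℝ))
      = Real.sqrt (2 * Real.pi / n) * weight d β h σ := by
  simp_rw [gaussian_mul_exp_eq hβ h hn σ]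
  rw [integral_const_mul, integral_sub_right_eq_self
    (fun y : ℝ => Real.exp (-(n / 2 : ℝ) * y ^ 2)), integral_gaussian, mul_comm]
  congr 2
  field_simp

theorem sum_exp_mul_spins (n : ℕ) (θ : ℝ) :
    ∑ σ : Fin n → ℤˣ, Real.exp (θ * ∑ i, ((σ i : ℤ) : ℝ)) = (2 * Real.cosh θ) ^ n := by
  have h : ∑ s : ℤˣ, Real.exp (θ * ((s : ℤ) : ℝ)) = 2 * Real.cosh θ := by
    rw [show (Finset.univ : Finset ℤˣ) = {1, -1} from rfl, Finset.sum_pair (by decide),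
      Real.cosh_eq]
    simp; ring
  rw [← h, ← Fin.prod_const, Finset.prod_univ_sum, Fintype.piFinset_univ]
  refine Finset.sum_congr rfl fun σ _ => ?_
  rw [← Real.exp_sum, Finset.mul_sum]

/-- The Gaussian mixture of the balanced masses. -/
noncomputable def mixedBalanced (κ h : ℝ) (k : ℕ) : ℝ :=
  ∫ x : ℝ, Real.exp (-(((k + k : ℕ) : ℝ) * x ^ 2 / 2)) * balancedMass k (κ * x + h)

/-- The Gaussian mixture of the total masses. -/
noncomputable def mixedTotal (κ h : ℝ) (k : ℕ) : ℝ :=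
  ∫ x : ℝ, Real.exp (-(((k + k : ℕ) : ℝ) * x ^ 2 / 2)) * (2 * Real.cosh (κ * x + h)) ^ (k + k)

theorem integrable_indicator_mixture {d : ℕ} {β : ℝ} (hβ : 0 ≤ β) (h : ℝ) {n : ℕ} (hn : 0 < n)
    (A : Set (Fin n → ℤˣ)) :
    Integrable fun x : ℝ => Real.exp (-(n * x ^ 2 / 2)) * ∑ σ : Fin n → ℤˣ,
      A.indicator (fun σ => Real.exp ((coupling d β * x + h) * ∑ i, ((σ i : ℤ) : ℝ))) σ := by
  classical
  refine (integrable_congr (Filter.Eventually.of_forall fun x => Finset.mul_sum ..)).2 ?_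
  refine integrable_finsetSum _ fun σ _ => ?_
  by_cases hσ : σ ∈ A
  · simpa [hσ] using integrable_gaussian_mul_exp hβ h hn σ
  · simp [hσ]

theorem integral_indicator_mixture {d : ℕ} {β : ℝ} (hβ : 0 ≤ β) (h : ℝ) {n : ℕ} (hn : 0 < n)
    (A : Set (Fin n → ℤˣ)) :
    ∫ x : ℝ, Real.exp (-(n * x ^ 2 / 2)) * ∑ σ : Fin n → ℤˣ,
      A.indicator (fun σ => Real.exp ((coupling d β * x + h) * ∑ i, ((σ i : ℤ) : ℝ))) σ
      = Real.sqrt (2 * Real.pi / n) * ∑ σ : Fin n → ℤˣ, A.indicator (weight d β h) σ := by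
  classical
  rw [integral_congr_ae (Filter.Eventually.of_forall fun x => Finset.mul_sum ..), Finset.mul_sum,
    integral_finsetSum]
  · refine Finset.sum_congr rfl fun σ _ => ?_
    by_cases hσ : σ ∈ A
    · simpa [hσ] using integral_gaussian_mul_exp hβ h hn σ
    · simp [hσ]
  · intro σ _
    by_cases hσ : σ ∈ A
    · simpa [hσ] using integrable_gaussian_mul_exp hβ h hn σ
    · simp [hσ]

theorem partitionFunction_pos (d : ℕ) (β h : ℝ) (n : ℕ) : 0 < partitionFunction d β h n :=
  Finset.sum_pos (fun _ _ => Real.exp_pos _) Finset.univ_nonempty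

/-- On an even number of vertices the supremum defining `Q` is attained by the coefficients
`(1, …, 1, -1, …, -1)` and `x = 0`; both numerator and denominator are Gaussian mixtures. -/
theorem Q_eq_div {d : ℕ} {β : ℝ} (hβ : 0 ≤ β) (h : ℝ) {k : ℕ} (hk : 0 < k) :
    Q d β h (k + k) = mixedBalanced (coupling d β) h k / mixedTotal (coupling d β) h k := by
  have hn : 0 < k + k := by omega
  have hZ := partitionFunction_pos d β h (k + k)
  set c := Real.sqrt (2 * Real.pi / ((k + k : ℕ) : ℝ)) with hc
  have hcpos : 0 < c := Real.sqrt_pos.2 (by have := Real.pi_pos; positivity)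
  have hhalf : mixedBalanced (coupling d β) h k = c * ∑ σ : Fin (k + k) → ℤˣ,
      (slab (fun i => ((halfSigns k i : ℤ) : ℝ)) 0).indicator (weight d β h) σ := by
    rw [← integral_indicator_mixture hβ h hn, mixedBalanced]
    simp_rw [sum_slab_halfSigns]
  have htot : mixedTotal (coupling d β) h k = c * partitionFunction d β h (k + k) := by
    have := integral_indicator_mixture (d := d) hβ h hn Set.univ
    simp only [Set.indicator_univ, sum_exp_mul_spins] at this
    exact this
  rw [hhalf, htot, mul_div_mul_left _ _ hcpos.ne']
  have hle : ∀ (x : ℝ) (v : {v : Fin (k + k) → ℝ // ∀ i, 1 ≤ |v i|}),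
      prob d β h (slab v.1 x) ≤ (∑ σ : Fin (k + k) → ℤˣ,
      (slab (fun i => ((halfSigns k i : ℤ) : ℝ)) 0).indicator (weight d β h) σ)
        / partitionFunction d β h (k + k) := by
    intro x v
    unfold prob
    refine div_le_div_of_nonneg_right ?_ hZ.le
    refine le_of_mul_le_mul_left ?_ hcpos
    rw [hc, ← integral_indicator_mixture hβ h hn, ← integral_indicator_mixture hβ h hn]
    refine integral_mono (integrable_indicator_mixture hβ h hn _)
      (integrable_indicator_mixture hβ h hn _) fun y => ?_
    refine mul_le_mul_of_nonneg_left ?_ (Real.exp_pos _).le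
    rw [sum_slab_halfSigns]
    exact sum_slab_exp_le k _ v.2 x
  have : Nonempty {v : Fin (k + k) → ℝ // ∀ i, 1 ≤ |v i|} := ⟨⟨fun _ => 1, by simp⟩⟩
  refine le_antisymm (ciSup_le fun x => ciSup_le fun v => hle x v) ?_
  have hv : ∀ i, 1 ≤ |((halfSigns k i : ℤ) : ℝ)| := by
    intro i
    rcases Int.units_eq_one_or (halfSigns k i) with h | h <;> simp [h]
  refine le_ciSup_of_le (f := fun x : ℝ => ⨆ v : {v : Fin (k + k) → ℝ // ∀ i, 1 ≤ |v i|},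
    prob d β h (slab v.1 x)) ⟨(∑ σ : Fin (k + k) → ℤˣ,
      (slab (fun i => ((halfSigns k i : ℤ) : ℝ)) 0).indicator (weight d β h) σ)
        / partitionFunction d β h (k + k), ?_⟩ 0
    (le_ciSup_of_le (f := fun v : {v : Fin (k + k) → ℝ // ∀ i, 1 ≤ |v i|} =>
      prob d β h (slab v.1 0)) ⟨(∑ σ : Fin (k + k) → ℤˣ,
      (slab (fun i => ((halfSigns k i : ℤ) : ℝ)) 0).indicator (weight d β h) σ)
        / partitionFunction d β h (k + k), ?_⟩ ⟨_, hv⟩ ?_)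
  · rintro _ ⟨x, rfl⟩
    exact ciSup_le fun v => hle x v
  · rintro _ ⟨v, rfl⟩
    exact hle 0 v
  · exact le_rfl

theorem tiltKernel_neg (θ u : ℝ) : tiltKernel (-θ) u = tiltKernel θ u := by simp [tiltKernel]

theorem balancedMass_neg (k : ℕ) (θ : ℝ) : balancedMass k (-θ) = balancedMass k θ := by
  simp [balancedMass, tiltKernel_neg]

theorem mixedBalanced_neg (κ h : ℝ) (k : ℕ) : mixedBalanced κ (-h) k = mixedBalanced κ h k := by
  rw [mixedBalanced, mixedBalanced, ← integral_neg_eq_self]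
  congr 1; ext x
  rw [neg_sq, show κ * -x + -h = -(κ * x + h) by ring, balancedMass_neg]

theorem mixedTotal_neg (κ h : ℝ) (k : ℕ) : mixedTotal κ (-h) k = mixedTotal κ h k := by
  rw [mixedTotal, mixedTotal, ← integral_neg_eq_self]
  congr 1; ext x
  rw [neg_sq, show κ * -x + -h = -(κ * x + h) by ring, Real.cosh_neg]

theorem Q_eq_div_abs {d : ℕ} {β : ℝ} (hβ : 0 ≤ β) (h : ℝ) {k : ℕ} (hk : 0 < k) :
    Q d β h (k + k) = mixedBalanced (coupling d β) |h| k / mixedTotal (coupling d β) |h| k := by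
  rw [Q_eq_div hβ h hk]
  rcases abs_choice h with e | e <;> rw [e]
  rw [mixedBalanced_neg, mixedTotal_neg]

end CurieWeiss

/-! ### Smooth dependence of Gaussian-type integrals on a parameter -/

namespace CurieWeiss
open MeasureTheory
open scoped ContDiff

/-- Symbols: functions of a small parameter `ε` and a point `v` of the plane generated by
constants, `ε`, the coordinates of `v`, and compactly supported smooth functions of the
anisotropically rescaled point `(ε v₁, ε ^ r v₂)`. The class is closed under differentiation in
`ε`, and its members grow at most polynomially in `v`. -/
inductive IsSymbol (r : ℕ) : (ℝ → ℝ × ℝ → ℝ) → Prop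
  | const (c : ℝ) : IsSymbol r fun _ _ => c
  | eps : IsSymbol r fun ε _ => ε
  | fst : IsSymbol r fun _ v => v.1
  | snd : IsSymbol r fun _ v => v.2
  | rescale (b : ℝ × ℝ → ℝ) (hb : ContDiff ℝ ∞ b) (hc : HasCompactSupport b) :
      IsSymbol r fun ε v => b (ε * v.1, ε ^ r * v.2)
  | add {f g : ℝ → ℝ × ℝ → ℝ} (hf : IsSymbol r f) (hg : IsSymbol r g) :
      IsSymbol r fun ε v => f ε v + g ε v
  | mul {f g : ℝ → ℝ × ℝ → ℝ} (hf : IsSymbol r f) (hg : IsSymbol r g) :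
      IsSymbol r fun ε v => f ε v * g ε v

namespace IsSymbol

variable {r : ℕ} {f q : ℝ → ℝ × ℝ → ℝ}

theorem pow (hf : IsSymbol r f) (n : ℕ) : IsSymbol r fun ε v => f ε v ^ n := by
  induction n with
  | zero => simpa using IsSymbol.const 1
  | succ n ih => simpa only [pow_succ] using ih.mul hf

theorem continuous (hf : IsSymbol r f) : Continuous fun p : ℝ × (ℝ × ℝ) => f p.1 p.2 := by
  induction hf with
  | const c => fun_prop
  | eps => fun_prop
  | fst => fun_prop
  | snd => fun_prop
  | rescale b hb hc =>
    have := hb.continuous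
    fun_prop
  | add _ _ h1 h2 => exact h1.add h2
  | mul _ _ h1 h2 => exact h1.mul h2

theorem exists_bound (hf : IsSymbol r f) :
    ∃ C : ℝ, ∃ N : ℕ, 0 ≤ C ∧ ∀ ε v, |ε| ≤ 1 → |f ε v| ≤ C * (1 + ‖v‖) ^ N := by
  have h1 : ∀ v : ℝ × ℝ, 1 ≤ 1 + ‖v‖ := fun v => by linarith [norm_nonneg v]
  induction hf with
  | const c => exact ⟨|c|, 0, abs_nonneg c, fun ε v _ => by simp⟩
  | eps => exact ⟨1, 0, zero_le_one, fun ε v h => by simpa using h⟩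
  | fst =>
    refine ⟨1, 1, zero_le_one, fun ε v _ => ?_⟩
    have := norm_fst_le v
    rw [Real.norm_eq_abs] at this
    linarith
  | snd =>
    refine ⟨1, 1, zero_le_one, fun ε v _ => ?_⟩
    have := norm_snd_le v
    rw [Real.norm_eq_abs] at this
    linarith
  | rescale b hb hc =>
    obtain ⟨C, hC⟩ := hc.exists_bound_of_continuous hb.continuous
    exact ⟨C, 0, (norm_nonneg _).trans (hC 0), fun ε v _ => by simpa using hC _⟩
  | @add f g _ _ hf hg =>
    obtain ⟨C, N, hC, hf⟩ := hf
    obtain ⟨C', N', hC', hg⟩ := hg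
    refine ⟨C + C', max N N', by positivity, fun ε v h => ?_⟩
    calc |f ε v + g ε v| ≤ |f ε v| + |g ε v| := abs_add_le _ _
      _ ≤ C * (1 + ‖v‖) ^ N + C' * (1 + ‖v‖) ^ N' := add_le_add (hf ε v h) (hg ε v h)
      _ ≤ C * (1 + ‖v‖) ^ max N N' + C' * (1 + ‖v‖) ^ max N N' := by
        gcongr
        · exact h1 v
        · exact le_max_left _ _
        · exact h1 v
        · exact le_max_right _ _
      _ = _ := by ring
  | @mul f g _ _ hf hg =>
    obtain ⟨C, N, hC, hf⟩ := hf
    obtain ⟨C', N', hC', hg⟩ := hg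
    refine ⟨C * C', N + N', by positivity, fun ε v h => ?_⟩
    rw [abs_mul]
    calc |f ε v| * |g ε v| ≤ (C * (1 + ‖v‖) ^ N) * (C' * (1 + ‖v‖) ^ N') :=
          mul_le_mul (hf ε v h) (hg ε v h) (abs_nonneg _) (by positivity)
      _ = _ := by ring

theorem exists_hasDerivAt (hf : IsSymbol r f) :
    ∃ f', IsSymbol r f' ∧ ∀ ε v, HasDerivAt (fun e => f e v) (f' ε v) ε := by
  induction hf with
  | const c => exact ⟨_, .const 0, fun ε v => hasDerivAt_const _ _⟩
  | eps => exact ⟨_, .const 1, fun ε v => hasDerivAt_id ε⟩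
  | fst => exact ⟨_, .const 0, fun ε v => hasDerivAt_const _ _⟩
  | snd => exact ⟨_, .const 0, fun ε v => hasDerivAt_const _ _⟩
  | rescale b hb hc =>
    have hd : ∀ w : ℝ × ℝ, ContDiff ℝ ∞ fun z => fderiv ℝ b z w := fun w =>
      (hb.fderiv_right (m := ∞) (by simp)).clm_apply contDiff_const
    refine ⟨_, (IsSymbol.fst.mul (.rescale _ (hd (1, 0)) (hc.fderiv_apply ℝ _))).add
      ((((IsSymbol.const (r : ℝ)).mul (IsSymbol.eps.pow (r - 1))).mul .snd).mul
        (.rescale _ (hd (0, 1)) (hc.fderiv_apply ℝ _))), fun ε v => ?_⟩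
    have h1 : HasDerivAt (fun e : ℝ => (e * v.1, e ^ r * v.2))
        (1 * v.1, (r * ε ^ (r - 1)) * v.2) ε :=
      ((hasDerivAt_id ε).mul_const v.1).prodMk ((hasDerivAt_pow r ε).mul_const v.2)
    have h2 := ((hb.differentiable (by simp)) (ε * v.1, ε ^ r * v.2)).hasFDerivAt.comp_hasDerivAt
      ε h1
    refine h2.congr_deriv ?_
    rw [show ((1 * v.1, (r * ε ^ (r - 1)) * v.2) : ℝ × ℝ)
      = v.1 • ((1, 0) : ℝ × ℝ) + ((r * ε ^ (r - 1)) * v.2) • ((0, 1) : ℝ × ℝ) by simp,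
      map_add, map_smul, map_smul]
    simp
  | add _ _ h1 h2 =>
    obtain ⟨f', hf', h1⟩ := h1
    obtain ⟨g', hg', h2⟩ := h2
    exact ⟨_, hf'.add hg', fun ε v => (h1 ε v).add (h2 ε v)⟩
  | mul hf hg h1 h2 =>
    obtain ⟨f', hf', h1⟩ := h1
    obtain ⟨g', hg', h2⟩ := h2
    exact ⟨_, (hf'.mul hg).add (hf.mul hg'), fun ε v => (h1 ε v).mul (h2 ε v)⟩

/-- A phase that grows at least quadratically, uniformly for `|ε| ≤ 1`. -/
def Coercive (q : ℝ → ℝ × ℝ → ℝ) : Prop :=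
  ∃ c : ℝ, 0 < c ∧ ∃ C : ℝ, ∀ ε v, |ε| ≤ 1 → c * (v.1 ^ 2 + v.2 ^ 2) - C ≤ q ε v

theorem integrable_one_add_abs_pow_mul_exp {c : ℝ} (hc : 0 < c) (N : ℕ) :
    Integrable fun x : ℝ => (1 + |x|) ^ N * Real.exp (-c * x ^ 2) := by
  have hc2 : 0 < c / 2 := by positivity
  have hint := (integrable_exp_neg_mul_sq hc2).const_mul (N.factorial * Real.exp (1 + 1 / (2 * c)))
  refine hint.mono' (Continuous.aestronglyMeasurable (by fun_prop))
    (Filter.Eventually.of_forall fun x => ?_)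
  rw [Real.norm_of_nonneg (by positivity)]
  have h1 : (1 + |x|) ^ N ≤ N.factorial * Real.exp (1 + |x|) := by
    have := Real.pow_div_factorial_le_exp (1 + |x|) (by positivity) N
    rwa [div_le_iff₀' (by positivity)] at this
  have h2 : |x| ≤ 1 / (2 * c) + c / 2 * x ^ 2 := by
    rw [← sq_abs x, ← sub_nonneg]
    have : 1 / (2 * c) + c / 2 * |x| ^ 2 - |x| = (c * |x| - 1) ^ 2 / (2 * c) := by
      field_simp; ring
    rw [this]; positivity
  calc (1 + |x|) ^ N * Real.exp (-c * x ^ 2)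
      ≤ (N.factorial * Real.exp (1 + |x|)) * Real.exp (-c * x ^ 2) := by gcongr
    _ ≤ (N.factorial * Real.exp (1 + (1 / (2 * c) + c / 2 * x ^ 2))) * Real.exp (-c * x ^ 2) := by
        gcongr
    _ = _ := by
        rw [mul_assoc, mul_assoc, ← Real.exp_add, ← Real.exp_add]
        congr 2; ring

theorem integrable_bound {c : ℝ} (hc : 0 < c) (N : ℕ) :
    Integrable fun v : ℝ × ℝ => (1 + ‖v‖) ^ N * Real.exp (-c * (v.1 ^ 2 + v.2 ^ 2)) := by
  have h := (integrable_one_add_abs_pow_mul_exp hc N).mul_prod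
    (integrable_one_add_abs_pow_mul_exp hc N)
  refine h.mono' (Continuous.aestronglyMeasurable (by fun_prop))
    (Filter.Eventually.of_forall fun v => ?_)
  rw [Real.norm_of_nonneg (by positivity)]
  have h1 : 1 + ‖v‖ ≤ (1 + |v.1|) * (1 + |v.2|) := by
    rw [Prod.norm_def, Real.norm_eq_abs, Real.norm_eq_abs]
    have := abs_nonneg v.1
    have := abs_nonneg v.2
    rcases max_choice |v.1| |v.2| with e | e <;> rw [e] <;>
      nlinarith [mul_nonneg (abs_nonneg v.1) (abs_nonneg v.2)]
  calc _ ≤ ((1 + |v.1|) * (1 + |v.2|)) ^ N * Real.exp (-c * (v.1 ^ 2 + v.2 ^ 2)) := by gcongr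
    _ = _ := by rw [mul_pow, mul_add, Real.exp_add]; ring

theorem exists_integrable_bound (hf : IsSymbol r f) (hq : Coercive q) :
    ∃ B : ℝ × ℝ → ℝ, Integrable B ∧ ∀ ε v, |ε| ≤ 1 → ‖f ε v * Real.exp (-q ε v)‖ ≤ B v := by
  obtain ⟨C, N, hC, hf⟩ := hf.exists_bound
  obtain ⟨c, hc, C', hq⟩ := hq
  refine ⟨_, (integrable_bound hc N).const_mul (C * Real.exp C'), fun ε v h => ?_⟩
  rw [norm_mul, Real.norm_eq_abs, Real.norm_of_nonneg (Real.exp_pos _).le]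
  calc _ ≤ (C * (1 + ‖v‖) ^ N) * Real.exp (C' + -c * (v.1 ^ 2 + v.2 ^ 2)) := by
        gcongr
        · exact hf ε v h
        · linarith [hq ε v h]
    _ = _ := by rw [Real.exp_add]; ring

theorem aestronglyMeasurable (hf : IsSymbol r f) (hq : IsSymbol r q) (ε : ℝ) :
    AEStronglyMeasurable (fun v => f ε v * Real.exp (-q ε v)) := by
  have h1 := hf.continuous
  have h2 := hq.continuous
  have h3 : Continuous fun v : ℝ × ℝ => f ε v := h1.comp (by fun_prop : Continuous fun v => (ε, v))
  have h4 : Continuous fun v : ℝ × ℝ => q ε v := h2.comp (by fun_prop : Continuous fun v => (ε, v))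
  exact (h3.mul (Real.continuous_exp.comp h4.neg)).aestronglyMeasurable

theorem integrable (hf : IsSymbol r f) (hq : IsSymbol r q) (hqc : Coercive q) {ε : ℝ}
    (hε : |ε| ≤ 1) : Integrable fun v => f ε v * Real.exp (-q ε v) := by
  obtain ⟨B, hB, hb⟩ := hf.exists_integrable_bound hqc
  exact hB.mono' (hf.aestronglyMeasurable hq ε) (Filter.Eventually.of_forall fun v => hb ε v hε)

theorem exists_hasDerivAt_integral (hf : IsSymbol r f) (hq : IsSymbol r q) (hqc : Coercive q) :
    ∃ g, IsSymbol r g ∧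
      (∀ ε v, HasDerivAt (fun e => f e v * Real.exp (-q e v)) (g ε v * Real.exp (-q ε v)) ε) ∧
      ∀ ε ∈ Set.Ioo (-1 : ℝ) 1, HasDerivAt (fun e => ∫ v, f e v * Real.exp (-q e v))
        (∫ v, g ε v * Real.exp (-q ε v)) ε := by
  obtain ⟨f', hf', hfd⟩ := hf.exists_hasDerivAt
  obtain ⟨q', hq', hqd⟩ := hq.exists_hasDerivAt
  have hg := hf'.add (((IsSymbol.const (-1)).mul hf).mul hq')
  have hd : ∀ ε v, HasDerivAt (fun e => f e v * Real.exp (-q e v))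
      ((f' ε v + -1 * f ε v * q' ε v) * Real.exp (-q ε v)) ε := by
    intro ε v
    refine ((hfd ε v).mul (hqd ε v).neg.exp).congr_deriv ?_
    rw [Pi.neg_apply]
    ring
  refine ⟨_, hg, hd, fun ε hε => ?_⟩
  obtain ⟨B, hB, hb⟩ := hg.exists_integrable_bound hqc
  have habs : ∀ e ∈ Set.Ioo (-1 : ℝ) 1, |e| ≤ 1 := fun e he => abs_le.2 ⟨he.1.le, he.2.le⟩
  exact (hasDerivAt_integral_of_dominated_loc_of_deriv_le (Ioo_mem_nhds hε.1 hε.2)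
    (Filter.Eventually.of_forall fun e => hf.aestronglyMeasurable hq e)
    (hf.integrable hq hqc (habs ε hε)) (hg.aestronglyMeasurable hq ε)
    (Filter.Eventually.of_forall fun v e he => hb e v (habs e he)) hB
    (Filter.Eventually.of_forall fun v e _ => hd e v)).2

theorem contDiffOn_integral (hf : IsSymbol r f) (hq : IsSymbol r q) (hqc : Coercive q) :
    ContDiffOn ℝ ∞ (fun e => ∫ v, f e v * Real.exp (-q e v)) (Set.Ioo (-1) 1) := by
  rw [contDiffOn_infty]
  intro n
  induction n generalizing f with
  | zero =>
    obtain ⟨g, -, -, hd⟩ := hf.exists_hasDerivAt_integral hq hqc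
    exact contDiffOn_zero.2 fun ε hε => (hd ε hε).continuousAt.continuousWithinAt
  | succ n ih =>
    obtain ⟨g, hg, -, hd⟩ := hf.exists_hasDerivAt_integral hq hqc
    have := ih hg
    rw [Nat.cast_succ, contDiffOn_succ_iff_deriv_of_isOpen isOpen_Ioo]
    refine ⟨fun ε hε => (hd ε hε).differentiableAt.differentiableWithinAt, by simp, ?_⟩
    exact this.congr fun ε hε => (hd ε hε).deriv

theorem exists_deriv_deriv_exp (hq : IsSymbol r q) (hqc : Coercive q) : ∃ g, IsSymbol r g ∧
    (∀ v, deriv (deriv fun e => Real.exp (-q e v)) 0 = g 0 v * Real.exp (-q 0 v)) ∧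
    deriv (deriv fun e => ∫ v, Real.exp (-q e v)) 0 = ∫ v, g 0 v * Real.exp (-q 0 v) := by
  obtain ⟨g, hg, hg1, hg2⟩ := (IsSymbol.const (r := r) 1).exists_hasDerivAt_integral hq hqc
  obtain ⟨k, hk, hk1, hk2⟩ := hg.exists_hasDerivAt_integral hq hqc
  simp only [one_mul] at hg1 hg2
  refine ⟨k, hk, fun v => ?_, ?_⟩
  · have e2 : deriv (fun e => Real.exp (-q e v)) = fun e => g e v * Real.exp (-q e v) := by
      ext ε; exact (hg1 ε v).deriv
    rw [e2, (hk1 0 v).deriv]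
  · have e1 : deriv (fun e => ∫ v, Real.exp (-q e v)) =ᶠ[nhds 0]
        fun e => ∫ v, g e v * Real.exp (-q e v) := by
      filter_upwards [Ioo_mem_nhds (by norm_num : (-1 : ℝ) < 0) one_pos] with ε hε
      exact (hg2 ε hε).deriv
    rw [e1.deriv_eq, (hk2 0 (by norm_num)).deriv]

theorem integrable_deriv_deriv_exp (hq : IsSymbol r q) (hqc : Coercive q) :
    Integrable fun v => deriv (deriv fun e => Real.exp (-q e v)) 0 := by
  obtain ⟨g, hg, hg1, -⟩ := hq.exists_deriv_deriv_exp hqc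
  simp only [hg1]
  exact hg.integrable hq hqc (by simp)

/-- The second derivative at `0` may be taken under the integral sign. -/
theorem deriv_deriv_integral_exp (hq : IsSymbol r q) (hqc : Coercive q) :
    deriv (deriv fun e => ∫ v, Real.exp (-q e v)) 0
      = ∫ v, deriv (deriv fun e => Real.exp (-q e v)) 0 := by
  obtain ⟨g, -, hg1, hg2⟩ := hq.exists_deriv_deriv_exp hqc
  rw [hg2]
  simp only [hg1]

end IsSymbol

end CurieWeiss

/-! ### Laplace's method in two variables of different scale -/

namespace CurieWeiss
open MeasureTheory
open scoped ContDiff Topology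

/-- Two densities bounded by `1` that agree on `U` and are at most `ρ` off `U` have integrals of
`n`-th powers that differ by `O(ρ ^ n)`. -/
theorem abs_integral_pow_sub_integral_pow_le {X : Type*} [MeasurableSpace X] {μ : Measure X}
    {e₁ e₂ : X → ℝ} {U : Set X} {ρ : ℝ} (hρ : 0 ≤ ρ) (h₁ : Integrable e₁ μ) (h₂ : Integrable e₂ μ)
    (h₁0 : ∀ x, 0 ≤ e₁ x) (h₂0 : ∀ x, 0 ≤ e₂ x) (h₁1 : ∀ x, e₁ x ≤ 1) (h₂1 : ∀ x, e₂ x ≤ 1)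
    (hU : ∀ x ∈ U, e₁ x = e₂ x) (h₁ρ : ∀ x ∉ U, e₁ x ≤ ρ) (h₂ρ : ∀ x ∉ U, e₂ x ≤ ρ) (n : ℕ) :
    |∫ x, e₁ x ^ (n + 1) ∂μ - ∫ x, e₂ x ^ (n + 1) ∂μ| ≤ ρ ^ n * (∫ x, e₁ x ∂μ + ∫ x, e₂ x ∂μ) := by
  have hpow : ∀ {e : X → ℝ}, Integrable e μ → (∀ x, 0 ≤ e x) → (∀ x, e x ≤ 1) →
      Integrable (fun x => e x ^ (n + 1)) μ := by
    intro e he h0 h1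
    refine he.mono' (he.aestronglyMeasurable.pow _) (Filter.Eventually.of_forall fun x => ?_)
    rw [Real.norm_of_nonneg (pow_nonneg (h0 x) _)]
    exact pow_le_of_le_one (h0 x) (h1 x) n.succ_ne_zero
  rw [← integral_sub (hpow h₁ h₁0 h₁1) (hpow h₂ h₂0 h₂1), ← integral_add h₁ h₂,
    ← integral_const_mul]
  refine (norm_integral_le_integral_norm _).trans (integral_mono_of_nonneg
    (Filter.Eventually.of_forall fun x => norm_nonneg (_ : ℝ)) ((h₁.add h₂).const_mul _)
    (Filter.Eventually.of_forall fun x => ?_))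
  simp only [Real.norm_eq_abs, Pi.add_apply]
  by_cases hx : x ∈ U
  · simp only [hU x hx, sub_self, abs_zero]
    have := h₂0 x
    positivity
  · have a1 : e₁ x ^ (n + 1) ≤ ρ ^ n * e₁ x := by
      rw [pow_succ]
      exact mul_le_mul_of_nonneg_right (pow_le_pow_left₀ (h₁0 x) (h₁ρ x hx) n) (h₁0 x)
    have a2 : e₂ x ^ (n + 1) ≤ ρ ^ n * e₂ x := by
      rw [pow_succ]
      exact mul_le_mul_of_nonneg_right (pow_le_pow_left₀ (h₂0 x) (h₂ρ x hx) n) (h₂0 x)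
    have b1 := pow_nonneg (h₁0 x) (n + 1)
    have b2 := pow_nonneg (h₂0 x) (n + 1)
    rw [abs_le, mul_add]
    constructor <;> linarith

/-- Smooth functions on the plane that are bounded below by a positive constant and are constant
outside a compact set. -/
def IsAmplitude (G : ℝ × ℝ → ℝ) : Prop :=
  (∃ c : ℝ, 0 < c ∧ ∀ z, c ≤ G z) ∧
    ∃ a : ℝ, ContDiff ℝ ∞ (fun z => G z - a) ∧ HasCompactSupport fun z => G z - a

/-- A positive analytic germ extends to an amplitude. -/
theorem exists_isAmplitude {G : ℝ × ℝ → ℝ} (hG : AnalyticAt ℝ G 0) (h0 : 0 < G 0) :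
    ∃ G', IsAmplitude G' ∧ G' =ᶠ[𝓝 0] G := by
  have h1 : ∀ᶠ z in 𝓝 0, AnalyticAt ℝ G z := hG.eventually_analyticAt
  have h2 : ∀ᶠ z in 𝓝 0, |G z - G 0| < G 0 / 2 := by
    have := Metric.continuousAt_iff'.1 hG.continuousAt (G 0 / 2) (by positivity)
    simpa [Real.dist_eq] using this
  obtain ⟨δ, hδ, hball⟩ := Metric.eventually_nhds_iff_ball.1 (h1.and h2)
  set χ : ContDiffBump (0 : ℝ × ℝ) := ⟨δ / 4, δ / 2, by positivity, by linarith⟩ with hχ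
  have hsupp : ∀ z, z ∉ Metric.ball (0 : ℝ × ℝ) δ → χ z = 0 := by
    intro z hz
    refine χ.zero_of_le_dist ?_
    have := not_lt.1 (fun h => hz (Metric.mem_ball.2 h))
    simp only [hχ]; linarith
  refine ⟨fun z => G 0 + χ z * (G z - G 0),
    ⟨⟨G 0 / 2, by positivity, fun z => ?_⟩, G 0, ?_, ?_⟩, ?_⟩
  · by_cases hz : z ∈ Metric.ball (0 : ℝ × ℝ) δ
    · have h := abs_lt.1 (hball z hz).2
      have h3 := χ.nonneg (x := z)
      have h4 := χ.le_one (x := z)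
      nlinarith
    · simp only [hsupp z hz]; linarith
  · simp only [add_sub_cancel_left]
    rw [contDiff_iff_contDiffAt]
    intro z
    by_cases hz : z ∈ Metric.ball (0 : ℝ × ℝ) δ
    · exact χ.contDiffAt.mul (((hball z hz).1.contDiffAt).sub contDiffAt_const)
    · refine (contDiffAt_const (c := (0 : ℝ))).congr_of_eventuallyEq ?_
      have : ∀ᶠ w in 𝓝 z, w ∉ Metric.closedBall (0 : ℝ × ℝ) (δ / 2) := by
        refine Metric.isClosed_closedBall.isOpen_compl.mem_nhds fun h => hz ?_
        exact Metric.closedBall_subset_ball (by linarith) h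
      filter_upwards [this] with w hw
      rw [χ.zero_of_le_dist, zero_mul]
      exact (not_le.1 fun h => hw (Metric.mem_closedBall.2 h)).le
  · simp only [add_sub_cancel_left]
    exact χ.hasCompactSupport.mul_right
  · filter_upwards [χ.eventuallyEq_one] with z hz
    rw [hz]; simp

/-- The rescaled phase `s^{2r} G(εs, ε^r t) + t² K(εs, ε^r t)`. -/
def laplacePhase (r : ℕ) (G K : ℝ × ℝ → ℝ) (ε : ℝ) (v : ℝ × ℝ) : ℝ :=
  v.1 ^ (2 * r) * G (ε * v.1, ε ^ r * v.2) + v.2 ^ 2 * K (ε * v.1, ε ^ r * v.2)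

/-- The rescaled Laplace integral as a function of `ε`. -/
noncomputable def laplaceIntegral (r : ℕ) (G K : ℝ × ℝ → ℝ) (ε : ℝ) : ℝ :=
  ∫ v, Real.exp (-laplacePhase r G K ε v)

section
variable {r : ℕ} {G K : ℝ × ℝ → ℝ}

theorem IsAmplitude.isSymbol (hG : IsAmplitude G) (r : ℕ) :
    IsSymbol r fun ε v => G (ε * v.1, ε ^ r * v.2) := by
  obtain ⟨-, a, h1, h2⟩ := hG
  simpa using (IsSymbol.rescale _ h1 h2).add (IsSymbol.const a)

theorem IsAmplitude.const_mul (hG : IsAmplitude G) {c : ℝ} (hc : 0 < c) :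
    IsAmplitude fun z => c * G z := by
  obtain ⟨⟨m, hm, hmG⟩, a, h1, h2⟩ := hG
  refine ⟨⟨c * m, by positivity, fun z => mul_le_mul_of_nonneg_left (hmG z) hc.le⟩, c * a, ?_, ?_⟩
  · simp_rw [← mul_sub]; exact contDiff_const.mul h1
  · simp_rw [← mul_sub]; exact h2.mul_left

theorem isSymbol_laplacePhase (hG : IsAmplitude G) (hK : IsAmplitude K) :
    IsSymbol r (laplacePhase r G K) :=
  ((IsSymbol.fst.pow _).mul (hG.isSymbol r)).add ((IsSymbol.snd.pow _).mul (hK.isSymbol r))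

theorem coercive_laplacePhase (hr : 1 ≤ r) (hG : IsAmplitude G) (hK : IsAmplitude K) :
    IsSymbol.Coercive (laplacePhase r G K) := by
  obtain ⟨⟨c, hc, hcG⟩, -⟩ := hG
  obtain ⟨⟨c', hc', hcK⟩, -⟩ := hK
  refine ⟨min c c', lt_min hc hc', c, fun ε v _ => ?_⟩
  have h1 : v.1 ^ 2 - 1 ≤ v.1 ^ (2 * r) := by
    rw [pow_mul]
    rcases le_or_gt (v.1 ^ 2) 1 with h | h
    · exact (sub_nonpos.2 h).trans (by positivity)
    · have := le_self_pow₀ h.le (show r ≠ 0 by omega)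
      linarith
  have h2 : v.1 ^ (2 * r) * c ≤ v.1 ^ (2 * r) * G (ε * v.1, ε ^ r * v.2) :=
    mul_le_mul_of_nonneg_left (hcG _) (by rw [pow_mul]; positivity)
  have h3 : v.2 ^ 2 * c' ≤ v.2 ^ 2 * K (ε * v.1, ε ^ r * v.2) :=
    mul_le_mul_of_nonneg_left (hcK _) (by positivity)
  have h4 : min c c' * v.1 ^ 2 ≤ c * v.1 ^ 2 :=
    mul_le_mul_of_nonneg_right (min_le_left _ _) (by positivity)
  have h5 : min c c' * v.2 ^ 2 ≤ c' * v.2 ^ 2 :=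
    mul_le_mul_of_nonneg_right (min_le_right _ _) (by positivity)
  have h6 := mul_le_mul_of_nonneg_left h1 hc.le
  unfold laplacePhase
  linarith

theorem integrable_exp_laplacePhase (hr : 1 ≤ r) (hG : IsAmplitude G) (hK : IsAmplitude K) {ε : ℝ}
    (hε : |ε| ≤ 1) : Integrable fun v => Real.exp (-laplacePhase r G K ε v) := by
  simpa using (IsSymbol.const (r := r) 1).integrable (isSymbol_laplacePhase hG hK)
    (coercive_laplacePhase hr hG hK) hε

theorem contDiffOn_laplaceIntegral (hr : 1 ≤ r) (hG : IsAmplitude G) (hK : IsAmplitude K) :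
    ContDiffOn ℝ ∞ (laplaceIntegral r G K) (Set.Ioo (-1) 1) := by
  change ContDiffOn ℝ ∞ (fun ε => ∫ v, Real.exp (-laplacePhase r G K ε v)) _
  simpa using (IsSymbol.const (r := r) 1).contDiffOn_integral
    (isSymbol_laplacePhase hG hK) (coercive_laplacePhase hr hG hK)

/-- The substitution `(s, t) ↦ (-s, (-1)^r t)` shows that only even powers of `ε` occur. -/
theorem laplaceIntegral_neg (r : ℕ) (G K : ℝ × ℝ → ℝ) (ε : ℝ) :
    laplaceIntegral r G K (-ε) = laplaceIntegral r G K ε := by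
  unfold laplaceIntegral
  rcases Nat.even_or_odd r with hr | hr
  · have hmp : MeasurePreserving (fun v : ℝ × ℝ => (-v.1, v.2)) :=
      (Measure.measurePreserving_neg (volume : Measure ℝ)).prod (MeasurePreserving.id volume)
    have hemb : MeasurableEmbedding (fun v : ℝ × ℝ => (-v.1, v.2)) :=
      ((MeasurableEquiv.neg ℝ).prodCongr (MeasurableEquiv.refl ℝ)).measurableEmbedding
    rw [← hmp.integral_comp hemb]
    congr 1; ext v
    simp only [laplacePhase, hr.neg_pow, neg_mul_neg]
    rw [pow_mul, neg_sq, ← pow_mul]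
  · rw [← integral_neg_eq_self]
    congr 1; ext v
    simp only [laplacePhase, hr.neg_pow, neg_mul_neg, Prod.fst_neg, Prod.snd_neg, neg_sq]
    rw [pow_mul, neg_sq, ← pow_mul]

theorem laplaceIntegral_zero (hr : 1 ≤ r) (G K : ℝ × ℝ → ℝ) :
    laplaceIntegral r G K 0
      = (∫ s : ℝ, Real.exp (-(G 0 * s ^ (2 * r)))) * Real.sqrt (Real.pi / K 0) := by
  rw [← integral_gaussian, ← integral_prod_mul]
  unfold laplaceIntegral
  congr 1; ext v
  rw [← Real.exp_add]
  congr 1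
  have : (0 : ℝ) ^ r = 0 := zero_pow (by omega)
  simp only [laplacePhase, this, zero_mul]
  rw [show ((0 : ℝ), (0 : ℝ)) = 0 from rfl]
  ring

theorem laplaceIntegral_zero_pos (hr : 1 ≤ r) (hG : IsAmplitude G) (hK : IsAmplitude K) :
    0 < laplaceIntegral r G K 0 := by
  have h := integrable_exp_laplacePhase hr hG hK (ε := 0) (by simp)
  exact integral_exp_pos h

/-- The unscaled model integrand. -/
noncomputable def modelDensity (r : ℕ) (G K : ℝ × ℝ → ℝ) (z : ℝ × ℝ) : ℝ :=
  Real.exp (-(z.1 ^ (2 * r) * G z + z.2 ^ 2 * K z))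

theorem laplacePhase_one (z : ℝ × ℝ) :
    laplacePhase r G K 1 z = z.1 ^ (2 * r) * G z + z.2 ^ 2 * K z := by
  simp [laplacePhase]

theorem integral_comp_rescale {g : ℝ × ℝ → ℝ} {a b : ℝ} (ha : 0 < a) (hb : 0 < b)
    (hg : Integrable g) (hg' : Integrable fun v : ℝ × ℝ => g (a * v.1, b * v.2)) :
    ∫ v : ℝ × ℝ, g (a * v.1, b * v.2) = (a * b)⁻¹ * ∫ z, g z := by
  rw [Measure.volume_eq_prod] at *
  rw [integral_prod _ hg, integral_prod _ hg']
  have h1 : ∀ x : ℝ, ∫ y : ℝ, g (a * x, b * y) = b⁻¹ * ∫ y, g (a * x, y) := by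
    intro x
    rw [Measure.integral_comp_mul_left (fun y => g (a * x, y)), abs_of_pos (inv_pos.2 hb),
      smul_eq_mul]
  simp only [h1]
  rw [integral_const_mul, Measure.integral_comp_mul_left (fun x => ∫ y, g (x, y)),
    abs_of_pos (inv_pos.2 ha), smul_eq_mul, mul_inv]
  ring

/-- Rescaling by `ε = n^{-1/(2r)}` turns the `n`-th power of the model integrand into the rescaled
Laplace integral. -/
theorem integral_modelDensity_pow (hr : 1 ≤ r) (hG : IsAmplitude G) (hK : IsAmplitude K) {n : ℕ}
    (hn : 0 < n) {ε : ℝ} (hε : 0 < ε) (hεn : ε ^ (2 * r) * n = 1) :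
    ∫ z, modelDensity r G K z ^ n = ε ^ (1 + r) * laplaceIntegral r G K ε := by
  have hn' : (1 : ℝ) ≤ n := by exact_mod_cast hn
  have hε1 : ε ≤ 1 := by
    by_contra hcon
    have := one_lt_pow₀ (not_le.1 hcon) (show 2 * r ≠ 0 by omega)
    nlinarith
  have hmod : ∀ z, modelDensity r G K z ^ n
      = Real.exp (-laplacePhase r (fun z => n * G z) (fun z => n * K z) 1 z) := by
    intro z
    rw [modelDensity, ← Real.exp_nat_mul, laplacePhase_one]
    congr 1; ring
  have hres : ∀ v : ℝ × ℝ, modelDensity r G K (ε * v.1, ε ^ r * v.2) ^ n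
      = Real.exp (-laplacePhase r G K ε v) := by
    intro v
    rw [modelDensity, ← Real.exp_nat_mul, laplacePhase]
    congr 1
    have h2 : (ε ^ r) ^ 2 * n = 1 := by rw [← pow_mul, mul_comm r, hεn]
    rw [mul_pow, mul_pow]
    linear_combination (-(v.1 ^ (2 * r) * G (ε * v.1, ε ^ r * v.2))) * hεn
      - (v.2 ^ 2 * K (ε * v.1, ε ^ r * v.2)) * h2
  have hpos : (0 : ℝ) < n := by linarith
  have i1 : Integrable fun z => modelDensity r G K z ^ n := by
    simp_rw [hmod]
    exact integrable_exp_laplacePhase hr (hG.const_mul hpos) (hK.const_mul hpos) (by simp)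
  have i2 : Integrable fun v : ℝ × ℝ => modelDensity r G K (ε * v.1, ε ^ r * v.2) ^ n := by
    simp_rw [hres]
    exact integrable_exp_laplacePhase hr hG hK (by rw [abs_of_pos hε]; exact hε1)
  have := integral_comp_rescale (g := fun z => modelDensity r G K z ^ n) hε (pow_pos hε r) i1 i2
  simp only [hres] at this
  rw [laplaceIntegral, this, pow_add, pow_one, ← mul_assoc,
    mul_inv_cancel₀ (by positivity), one_mul]

theorem modelDensity_nonneg (z : ℝ × ℝ) : 0 ≤ modelDensity r G K z := (Real.exp_pos _).le

theorem modelDensity_le_one (hG : IsAmplitude G) (hK : IsAmplitude K) (z : ℝ × ℝ) :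
    modelDensity r G K z ≤ 1 := by
  obtain ⟨⟨c, hc, hcG⟩, -⟩ := hG
  obtain ⟨⟨c', hc', hcK⟩, -⟩ := hK
  refine Real.exp_le_one_iff.2 (neg_nonpos.2 (add_nonneg (mul_nonneg ?_ (hc.le.trans (hcG z)))
    (mul_nonneg (sq_nonneg _) (hc'.le.trans (hcK z)))))
  rw [pow_mul]; positivity

theorem exists_modelDensity_le (r : ℕ) (hG : IsAmplitude G) (hK : IsAmplitude K)
    {U : Set (ℝ × ℝ)} (hU : U ∈ 𝓝 0) :
    ∃ ρ : ℝ, 0 ≤ ρ ∧ ρ < 1 ∧ ∀ z ∉ U, modelDensity r G K z ≤ ρ := by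
  obtain ⟨⟨c, hc, hcG⟩, -⟩ := hG
  obtain ⟨⟨c', hc', hcK⟩, -⟩ := hK
  obtain ⟨δ, hδ, hball⟩ := Metric.mem_nhds_iff.1 hU
  set m := min (δ ^ (2 * r) * c) (δ ^ 2 * c') with hm
  have hmpos : 0 < m := lt_min (by positivity) (by positivity)
  refine ⟨Real.exp (-m), (Real.exp_pos _).le, by simpa using hmpos, fun z hz => ?_⟩
  refine Real.exp_le_exp.2 (neg_le_neg ?_)
  have hz' : δ ≤ max |z.1| |z.2| := by
    by_contra hcon
    refine hz (hball ?_)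
    rw [mem_ball_zero_iff, Prod.norm_def]
    exact not_le.1 hcon
  have e1 : 0 ≤ z.1 ^ (2 * r) := by rw [pow_mul]; positivity
  have a1 : 0 ≤ z.1 ^ (2 * r) * G z := mul_nonneg e1 (hc.le.trans (hcG z))
  have a2 : 0 ≤ z.2 ^ 2 * K z := mul_nonneg (sq_nonneg _) (hc'.le.trans (hcK z))
  rcases le_max_iff.1 hz' with h | h
  · have : δ ^ (2 * r) * c ≤ z.1 ^ (2 * r) * G z := by
      have h2 : δ ^ (2 * r) ≤ z.1 ^ (2 * r) := by
        rw [← (even_two_mul r).pow_abs z.1]; gcongr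
      exact mul_le_mul h2 (hcG z) hc.le e1
    linarith [min_le_left (δ ^ (2 * r) * c) (δ ^ 2 * c')]
  · have : δ ^ 2 * c' ≤ z.2 ^ 2 * K z := by
      have h2 : δ ^ 2 ≤ z.2 ^ 2 := by
        rw [← sq_abs z.2]; gcongr
      exact mul_le_mul h2 (hcK z) hc'.le (sq_nonneg _)
    linarith [min_le_right (δ ^ (2 * r) * c) (δ ^ 2 * c')]

end

/-- Laplace's method: the integral of a high power of a density that peaks at `0` with the
local form `exp (-(x^{2r} G + u² K))` is, up to an exponentially small error, a smooth even
function of `ε = n^{-1/(2r)}`. -/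
theorem laplace_method {r : ℕ} (hr : 1 ≤ r) {G K : ℝ × ℝ → ℝ} (hG : AnalyticAt ℝ G 0)
    (hG0 : 0 < G 0) (hK : AnalyticAt ℝ K 0) (hK0 : 0 < K 0) {e : ℝ × ℝ → ℝ} (he : Integrable e)
    (he0 : ∀ z, 0 ≤ e z) (he1 : ∀ z, e z ≤ 1)
    (hloc : ∀ᶠ z in 𝓝 0, e z = Real.exp (-(z.1 ^ (2 * r) * G z + z.2 ^ 2 * K z)))
    (hfar : ∀ U ∈ 𝓝 (0 : ℝ × ℝ), ∃ ρ < 1, ∀ z ∉ U, e z ≤ ρ) :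
    ∃ F : ℝ → ℝ, ContDiffOn ℝ ∞ F (Set.Ioo (-1) 1) ∧ (∀ ε, F (-ε) = F ε) ∧ 0 < F 0 ∧
      F 0 = (∫ s : ℝ, Real.exp (-(G 0 * s ^ (2 * r)))) * Real.sqrt (Real.pi / K 0) ∧
      Integrable (fun v => deriv (deriv fun ε => Real.exp (-laplacePhase r G K ε v)) 0) ∧
      deriv (deriv F) 0 = ∫ v, deriv (deriv fun ε => Real.exp (-laplacePhase r G K ε v)) 0 ∧
      ∃ C ρ : ℝ, 0 < ρ ∧ ρ < 1 ∧ ∀ n : ℕ, 0 < n → ∀ ε : ℝ, 0 < ε → ε ^ (2 * r) * n = 1 →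
        |(∫ z, e z ^ n) - ε ^ (1 + r) * F ε| ≤ C * ρ ^ n := by
  obtain ⟨G', hG', hGG⟩ := exists_isAmplitude hG hG0
  obtain ⟨K', hK', hKK⟩ := exists_isAmplitude hK hK0
  have hdd : ∀ v, deriv (deriv fun ε => Real.exp (-laplacePhase r G' K' ε v)) 0
      = deriv (deriv fun ε => Real.exp (-laplacePhase r G K ε v)) 0 := by
    intro v
    refine Filter.EventuallyEq.deriv_eq (Filter.EventuallyEq.deriv ?_)
    have hcont : Filter.Tendsto (fun ε : ℝ => (ε * v.1, ε ^ r * v.2)) (𝓝 0) (𝓝 0) := by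
      have : Continuous fun ε : ℝ => (ε * v.1, ε ^ r * v.2) := by fun_prop
      have h := this.tendsto 0
      rwa [zero_mul, zero_pow (by omega), zero_mul] at h
    filter_upwards [hcont.eventually hGG, hcont.eventually hKK] with ε h1 h2
    rw [laplacePhase, laplacePhase, h1, h2]
  refine ⟨laplaceIntegral r G' K', contDiffOn_laplaceIntegral hr hG' hK',
    laplaceIntegral_neg r G' K', laplaceIntegral_zero_pos hr hG' hK', ?_, ?_, ?_, ?_⟩
  · rw [laplaceIntegral_zero hr, hGG.self_of_nhds, hKK.self_of_nhds]
  · simp only [← hdd]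
    exact IsSymbol.integrable_deriv_deriv_exp (isSymbol_laplacePhase hG' hK')
      (coercive_laplacePhase hr hG' hK')
  · simp only [← hdd]
    exact IsSymbol.deriv_deriv_integral_exp (isSymbol_laplacePhase hG' hK')
      (coercive_laplacePhase hr hG' hK')
  · have hU : {z | e z = modelDensity r G' K' z} ∈ 𝓝 (0 : ℝ × ℝ) := by
      filter_upwards [hloc, hGG, hKK] with z h1 h2 h3
      rw [h1, modelDensity, h2, h3]
    obtain ⟨ρ₁, hρ₁, h₁⟩ := hfar _ hU
    obtain ⟨ρ₂, hρ₂0, hρ₂, h₂⟩ := exists_modelDensity_le r hG' hK' hU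
    have hm : Integrable (modelDensity r G' K') := by
      have := integrable_exp_laplacePhase hr hG' hK' (ε := 1) (by simp)
      simp only [laplacePhase_one] at this
      exact this
    set ρ := max (max ρ₁ ρ₂) (1 / 2) with hρ
    have hρ0 : 0 < ρ := lt_max_of_lt_right (by norm_num)
    refine ⟨((∫ z, e z) + ∫ z, modelDensity r G' K' z) / ρ, ρ, hρ0,
      max_lt (max_lt hρ₁ hρ₂) (by norm_num), fun n hn ε hε hεn => ?_⟩
    rw [← integral_modelDensity_pow hr hG' hK' hn hε hεn]
    obtain ⟨m, rfl⟩ : ∃ m, n = m + 1 := ⟨n - 1, by omega⟩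
    have := abs_integral_pow_sub_integral_pow_le (U := {z | e z = modelDensity r G' K' z})
      hρ0.le he hm he0 modelDensity_nonneg he1 (modelDensity_le_one hG' hK')
      (fun x hx => hx) (fun x hx => (h₁ x hx).trans ((le_max_left _ _).trans (le_max_left _ _)))
      (fun x hx => (h₂ x hx).trans ((le_max_right _ _).trans (le_max_left _ _))) m
    refine this.trans (le_of_eq ?_)
    rw [pow_succ]
    field_simp

end CurieWeiss

/-! ### The phase of the Gaussian field -/

namespace CurieWeiss
open MeasureTheory
open scoped ContDiff Topology

theorem exists_analyticAt_eq_mul {f : ℝ → ℝ} (hf : AnalyticAt ℝ f 0) (h0 : f 0 = 0) :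
    ∃ m : ℝ → ℝ, AnalyticAt ℝ m 0 ∧ m 0 = deriv f 0 ∧ ∀ y, f y = y * m y := by
  refine ⟨dslope f 0, ?_, dslope_same f 0, fun y => ?_⟩
  · obtain ⟨p, hp⟩ := hf
    exact ⟨_, hp.has_fpower_series_dslope_fslope⟩
  · have := sub_smul_dslope f 0 y
    simp only [sub_zero, smul_eq_mul, h0] at this
    exact this.symm

/-- The field phase `x² / 2 - log cosh (κ x + h)`. -/
noncomputable def phase (κ h x : ℝ) : ℝ := x ^ 2 / 2 - Real.log (Real.cosh (κ * x + h))

theorem analyticAt_phase (κ h x : ℝ) : AnalyticAt ℝ (phase κ h) x := by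
  have h1 : AnalyticAt ℝ (fun x => Real.cosh (κ * x + h)) x :=
    AnalyticAt.fun_comp (g := Real.cosh) Real.analyticAt_cosh (by fun_prop)
  have h2 := h1.log (Real.cosh_pos _)
  have h3 : AnalyticAt ℝ (fun x : ℝ => x ^ 2 / 2) x := by fun_prop
  exact h3.sub h2

theorem continuous_phase (κ h : ℝ) : Continuous (phase κ h) :=
  continuous_iff_continuousAt.2 fun x => (analyticAt_phase κ h x).continuousAt

theorem hasDerivAt_phase (κ h x : ℝ) :
    HasDerivAt (phase κ h) (x - κ * Real.tanh (κ * x + h)) x := by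
  have h1 : HasDerivAt (fun x => κ * x + h) κ x := by
    simpa using ((hasDerivAt_id x).const_mul κ).add_const h
  have h2 := (h1.cosh).log (Real.cosh_pos _).ne'
  have h3 : HasDerivAt (fun x : ℝ => x ^ 2 / 2) x x := by
    have := (hasDerivAt_pow 2 x).div_const 2
    refine this.congr_deriv ?_
    norm_num
  refine (h3.sub h2).congr_deriv ?_
  rw [Real.tanh_eq_sinh_div_cosh]; ring

theorem exp_neg_phase (κ h x : ℝ) :
    Real.exp (-phase κ h x) = Real.exp (-(x ^ 2 / 2)) * Real.cosh (κ * x + h) := by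
  rw [phase, neg_sub, sub_eq_add_neg, Real.exp_add, Real.exp_log (Real.cosh_pos _), mul_comm]

theorem cosh_le_exp_abs (x : ℝ) : Real.cosh x ≤ Real.exp |x| := by
  rw [← Real.cosh_abs, Real.cosh_eq]
  have : Real.exp (-|x|) ≤ Real.exp |x| := Real.exp_le_exp.2 (by linarith [abs_nonneg x])
  linarith

theorem le_phase (κ h x : ℝ) : x ^ 2 / 4 - (κ ^ 2 + |h|) ≤ phase κ h x := by
  have h1 : Real.log (Real.cosh (κ * x + h)) ≤ |κ * x + h| := by
    rw [Real.log_le_iff_le_exp (Real.cosh_pos _)]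
    exact cosh_le_exp_abs _
  have h2 := abs_add_le (κ * x) h
  have h3 : |κ * x| ≤ κ ^ 2 + x ^ 2 / 4 := by
    rw [abs_le]
    constructor <;> nlinarith [sq_nonneg (κ - x / 2), sq_nonneg (κ + x / 2)]
  unfold phase
  linarith

/-- The point `a` is the unique minimizer of the phase on `I`, where `I` is the whole line or,
without external field, the half-line. -/
structure IsPeak (κ h : ℝ) (I : Set ℝ) (a : ℝ) : Prop where
  domain : I = Set.univ ∨ (I = Set.Ici 0 ∧ h = 0)
  mem_nhds : I ∈ 𝓝 a
  lt : ∀ x ∈ I, x ≠ a → phase κ h a < phase κ h x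

/-- The normalized one-dimensional density, centred at its peak. -/
noncomputable def profile (κ h : ℝ) (I : Set ℝ) (a y : ℝ) : ℝ :=
  I.indicator (fun x => Real.exp (-(phase κ h x - phase κ h a))) (a + y)

section
variable {κ h a : ℝ} {I : Set ℝ}

theorem IsPeak.isClosed (hI : IsPeak κ h I a) : IsClosed I := by
  rcases hI.domain with h | h
  · rw [h]; exact isClosed_univ
  · rw [h.1]; exact isClosed_Ici

theorem IsPeak.le (hI : IsPeak κ h I a) {x : ℝ} (hx : x ∈ I) : phase κ h a ≤ phase κ h x := by
  by_cases hxa : x = a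
  · rw [hxa]
  · exact (hI.lt x hx hxa).le

theorem profile_nonneg (y : ℝ) : 0 ≤ profile κ h I a y :=
  Set.indicator_nonneg (fun _ _ => (Real.exp_pos _).le) _

theorem IsPeak.profile_le_one (hI : IsPeak κ h I a) (y : ℝ) : profile κ h I a y ≤ 1 := by
  refine Set.indicator_apply_le' (fun hx => ?_) (fun _ => zero_le_one)
  exact Real.exp_le_one_iff.2 (by linarith [hI.le hx])

theorem IsPeak.measurable_profile (hI : IsPeak κ h I a) : Measurable (profile κ h I a) := by
  have h1 := continuous_phase κ h
  have h2 : Measurable fun x => Real.exp (-(phase κ h x - phase κ h a)) :=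
    Continuous.measurable (by fun_prop)
  exact (h2.indicator hI.isClosed.measurableSet).comp (measurable_const_add a)

theorem IsPeak.integrable_profile (hI : IsPeak κ h I a) : Integrable (profile κ h I a) := by
  have h1 : Integrable fun x => Real.exp (-(phase κ h x - phase κ h a)) := by
    refine ((integrable_exp_neg_mul_sq (b := 1 / 4) (by norm_num)).const_mul
      (Real.exp (κ ^ 2 + |h| + phase κ h a))).mono' ?_ (Filter.Eventually.of_forall fun x => ?_)
    · have := continuous_phase κ h
      exact Continuous.aestronglyMeasurable (by fun_prop)
    · rw [Real.norm_of_nonneg (Real.exp_pos _).le, ← Real.exp_add]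
      exact Real.exp_le_exp.2 (by linarith [le_phase κ h x])
  exact (h1.indicator hI.isClosed.measurableSet).comp_add_left a

theorem IsPeak.exists_profile_le (hI : IsPeak κ h I a) {δ : ℝ} (hδ : 0 < δ) :
    ∃ ρ : ℝ, 0 ≤ ρ ∧ ρ < 1 ∧ ∀ y, δ ≤ |y| → profile κ h I a y ≤ ρ := by
  set R : ℝ := 1 + 4 * (1 + |phase κ h a| + κ ^ 2 + |h|) with hR
  have hκ := sq_nonneg κ
  have hh := abs_nonneg h
  have hpa := abs_nonneg (phase κ h a)
  have hR1 : 1 ≤ R := by rw [hR]; linarith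
  have hfar : ∀ x, R ≤ |x| → phase κ h a + 1 ≤ phase κ h x := by
    intro x hx
    have h1 := le_phase κ h x
    have h2 : R ≤ x ^ 2 := by
      rw [← sq_abs]; nlinarith
    have := le_abs_self (phase κ h a)
    rw [hR] at h2
    linarith
  set S : Set ℝ := (I ∩ {x | δ ≤ |x - a|}) ∩ Set.Icc (-R) R with hS
  have hScomp : IsCompact S := by
    refine isCompact_Icc.inter_left (hI.isClosed.inter ?_)
    exact isClosed_le continuous_const (by fun_prop)
  have hbound : ∃ m : ℝ, 0 < m ∧ ∀ x ∈ S, phase κ h a + m ≤ phase κ h x := by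
    rcases S.eq_empty_or_nonempty with he | hne
    · exact ⟨1, one_pos, fun x hx => by rw [he] at hx; exact hx.elim⟩
    · obtain ⟨x₀, hx₀, hmin⟩ := hScomp.exists_isMinOn hne (continuous_phase κ h).continuousOn
      have hne : x₀ ≠ a := by
        rintro rfl
        have : δ ≤ |x₀ - x₀| := hx₀.1.2
        rw [sub_self, abs_zero] at this
        linarith
      refine ⟨phase κ h x₀ - phase κ h a, sub_pos.2 (hI.lt x₀ hx₀.1.1 hne), fun x hx => ?_⟩
      have : phase κ h x₀ ≤ phase κ h x := hmin hx
      linarith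
  obtain ⟨m, hm, hmS⟩ := hbound
  have hmin : 0 < min m 1 := lt_min hm one_pos
  refine ⟨Real.exp (-(min m 1)), (Real.exp_pos _).le, by simpa using hmin, fun y hy => ?_⟩
  refine Set.indicator_apply_le' (fun hx => ?_) (fun _ => (Real.exp_pos _).le)
  refine Real.exp_le_exp.2 (neg_le_neg ?_)
  rcases le_or_gt R |a + y| with h1 | h1
  · linarith [hfar _ h1, min_le_right m 1]
  · have : a + y ∈ S := ⟨⟨hx, by simpa using hy⟩, abs_le.1 h1.le⟩
    linarith [hmS _ this, min_le_left m 1]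

/-- The planar density behind the partition function. -/
noncomputable def totalDensity (κ h : ℝ) (I : Set ℝ) (a : ℝ) (z : ℝ × ℝ) : ℝ :=
  profile κ h I a z.1 * Real.exp (-(z.2 ^ 2 / 2))

/-- The factor by which the Fourier variable `u` damps the balanced density at tilt `θ`. -/
noncomputable def damping (θ u : ℝ) : ℝ :=
  (Set.Icc (-(Real.pi / 2)) (Real.pi / 2)).indicator
    (fun u => Real.sqrt (1 - Real.sin u ^ 2 / Real.cosh θ ^ 2)) u

/-- The planar density behind the weight of the balanced configurations. -/
noncomputable def balancedDensity (κ h : ℝ) (I : Set ℝ) (a : ℝ) (z : ℝ × ℝ) : ℝ :=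
  profile κ h I a z.1 * damping (κ * (a + z.1) + h) z.2

theorem damping_nonneg (θ u : ℝ) : 0 ≤ damping θ u :=
  Set.indicator_nonneg (fun _ _ => Real.sqrt_nonneg _) _

theorem damping_le_one (θ u : ℝ) : damping θ u ≤ 1 := by
  refine Set.indicator_apply_le' (fun _ => ?_) (fun _ => zero_le_one)
  have : 0 ≤ Real.sin u ^ 2 / Real.cosh θ ^ 2 := by positivity
  exact Real.sqrt_le_iff.2 ⟨zero_le_one, by linarith⟩

theorem measurable_damping : Measurable fun p : ℝ × ℝ => damping p.1 p.2 := by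
  have h1 : Measurable fun p : ℝ × ℝ => Real.sqrt (1 - Real.sin p.2 ^ 2 / Real.cosh p.1 ^ 2) := by
    have := Real.continuous_cosh.measurable
    fun_prop
  exact h1.indicator (measurable_snd measurableSet_Icc)

theorem IsPeak.integrable_totalDensity (hI : IsPeak κ h I a) :
    Integrable (totalDensity κ h I a) := by
  have h1 : Integrable fun u : ℝ => Real.exp (-(u ^ 2 / 2)) := by
    refine (integrable_exp_neg_mul_sq (b := 1 / 2) (by norm_num)).congr
      (Filter.Eventually.of_forall fun u => ?_)
    simp only; congr 1; ring
  exact hI.integrable_profile.mul_prod h1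

theorem IsPeak.measurable_balancedDensity (hI : IsPeak κ h I a) :
    Measurable (balancedDensity κ h I a) := by
  have h1 : Measurable fun z : ℝ × ℝ => (κ * (a + z.1) + h, z.2) := by fun_prop
  have h2 := measurable_damping.comp h1
  simp only [Function.comp_def] at h2
  have h3 : Measurable fun z : ℝ × ℝ => profile κ h I a z.1 :=
    hI.measurable_profile.comp measurable_fst
  exact h3.mul h2

theorem damping_le_indicator (θ u : ℝ) : damping θ u
    ≤ (Set.Icc (-(Real.pi / 2)) (Real.pi / 2)).indicator (fun _ => (1 : ℝ)) u := by
  by_cases hu : u ∈ Set.Icc (-(Real.pi / 2)) (Real.pi / 2)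
  · rw [Set.indicator_of_mem hu]; exact damping_le_one _ _
  · rw [Set.indicator_of_notMem hu, damping, Set.indicator_of_notMem hu]

theorem IsPeak.integrable_balancedDensity (hI : IsPeak κ h I a) :
    Integrable (balancedDensity κ h I a) := by
  have h1 : Integrable ((Set.Icc (-(Real.pi / 2)) (Real.pi / 2)).indicator fun _ => (1 : ℝ)) :=
    (integrable_indicator_iff measurableSet_Icc).2
      (integrableOn_const (by rw [Real.volume_Icc]; exact ENNReal.ofReal_ne_top))
  refine (hI.integrable_profile.mul_prod h1).mono'
    hI.measurable_balancedDensity.aestronglyMeasurable (Filter.Eventually.of_forall fun z => ?_)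
  rw [balancedDensity, Real.norm_of_nonneg (mul_nonneg (profile_nonneg _) (damping_nonneg _ _))]
  exact mul_le_mul_of_nonneg_left (damping_le_indicator _ _) (profile_nonneg _)

theorem IsPeak.exists_totalDensity_le (hI : IsPeak κ h I a) {U : Set (ℝ × ℝ)} (hU : U ∈ 𝓝 0) :
    ∃ ρ < 1, ∀ z ∉ U, totalDensity κ h I a z ≤ ρ := by
  obtain ⟨δ, hδ, hball⟩ := Metric.mem_nhds_iff.1 hU
  obtain ⟨ρ, hρ0, hρ, h1⟩ := hI.exists_profile_le hδ
  refine ⟨max ρ (Real.exp (-(δ ^ 2 / 2))), max_lt hρ (by simpa using by positivity), fun z hz => ?_⟩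
  have hz' : δ ≤ max |z.1| |z.2| := by
    by_contra hcon
    refine hz (hball ?_)
    rw [mem_ball_zero_iff, Prod.norm_def]
    exact not_le.1 hcon
  rcases le_max_iff.1 hz' with h | h
  · refine le_max_of_le_left ((mul_le_of_le_one_right (profile_nonneg _) ?_).trans (h1 _ h))
    exact Real.exp_le_one_iff.2 (by have := sq_nonneg z.2; linarith)
  · refine le_max_of_le_right ((mul_le_of_le_one_left (Real.exp_pos _).le
      (hI.profile_le_one _)).trans (Real.exp_le_exp.2 ?_))
    have : δ ^ 2 ≤ z.2 ^ 2 := by rw [← sq_abs z.2]; gcongr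
    linarith

theorem IsPeak.exists_balancedDensity_le (hI : IsPeak κ h I a) {U : Set (ℝ × ℝ)} (hU : U ∈ 𝓝 0) :
    ∃ ρ < 1, ∀ z ∉ U, balancedDensity κ h I a z ≤ ρ := by
  obtain ⟨δ', hδ', hball⟩ := Metric.mem_nhds_iff.1 hU
  set δ := min δ' 1 with hδdef
  have hδ : 0 < δ := lt_min hδ' one_pos
  obtain ⟨ρ, hρ0, hρ, h1⟩ := hI.exists_profile_le hδ
  set T := |κ| * (|a| + 1) + |h| with hT
  have hpi := Real.pi_gt_three
  have hδ1 : δ ≤ 1 := min_le_right _ _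
  have hsin : 0 < Real.sin δ := Real.sin_pos_of_pos_of_lt_pi hδ (by linarith)
  have hρ2 : Real.sqrt (1 - Real.sin δ ^ 2 / Real.cosh T ^ 2) < 1 := by
    rw [Real.sqrt_lt' one_pos]
    have := Real.cosh_pos T
    have : 0 < Real.sin δ ^ 2 / Real.cosh T ^ 2 := by positivity
    linarith
  refine ⟨max ρ (Real.sqrt (1 - Real.sin δ ^ 2 / Real.cosh T ^ 2)), max_lt hρ hρ2, fun z hz => ?_⟩
  by_cases hz1 : δ ≤ |z.1|
  · exact le_max_of_le_left ((mul_le_of_le_one_right (profile_nonneg _)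
      (damping_le_one _ _)).trans (h1 _ hz1))
  · have hz2 : δ ≤ |z.2| := by
      by_contra hcon
      refine hz (hball ?_)
      rw [mem_ball_zero_iff, Prod.norm_def]
      exact (max_lt (not_le.1 hz1) (not_le.1 hcon)).trans_le (min_le_left _ _)
    refine le_max_of_le_right ((mul_le_of_le_one_left (damping_nonneg _ _)
      (hI.profile_le_one _)).trans ?_)
    refine Set.indicator_apply_le' (fun hu => ?_) (fun _ => Real.sqrt_nonneg _)
    refine Real.sqrt_le_sqrt (sub_le_sub_left ?_ _)
    have hs : Real.sin δ ^ 2 ≤ Real.sin z.2 ^ 2 := by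
      have e : Real.sin z.2 ^ 2 = Real.sin |z.2| ^ 2 := by
        rcases abs_choice z.2 with e | e <;> rw [e]
        rw [Real.sin_neg, neg_sq]
      rw [e]
      have : Real.sin δ ≤ Real.sin |z.2| :=
        Real.sin_le_sin_of_le_of_le_pi_div_two (by linarith) (abs_le.2 hu) hz2
      gcongr
    have hc : Real.cosh (κ * (a + z.1) + h) ≤ Real.cosh T := by
      rw [Real.cosh_le_cosh]
      refine le_trans ?_ (le_abs_self T)
      calc |κ * (a + z.1) + h| ≤ |κ * (a + z.1)| + |h| := abs_add_le _ _
        _ = |κ| * |a + z.1| + |h| := by rw [abs_mul]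
        _ ≤ |κ| * (|a| + 1) + |h| := by
          have := abs_add_le a z.1
          gcongr
          linarith [not_le.1 hz1]
    have := Real.cosh_pos (κ * (a + z.1) + h)
    gcongr

/-- Near the peak the damping is Gaussian in `u`: `K(x, u) = -log (1 - sin² u / cosh² θ) / (2 u²)`
with `θ = κ (a + x) + h`, and this extends analytically to `u = 0`. -/
theorem damping_eventually (κ h a : ℝ) :
    ∃ K : ℝ × ℝ → ℝ, AnalyticAt ℝ K 0 ∧
      (∀ x, K (x, 0) = 1 / (2 * Real.cosh (κ * (a + x) + h) ^ 2)) ∧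
      (∀ x u, K (x, -u) = K (x, u)) ∧
      ∀ᶠ z in 𝓝 (0 : ℝ × ℝ), damping (κ * (a + z.1) + h) z.2 = Real.exp (-(z.2 ^ 2 * K z)) := by
  have hlog : AnalyticAt ℝ (fun y : ℝ => -(1 / 2) * Real.log (1 - y)) 0 := by
    have h1 : AnalyticAt ℝ (fun y : ℝ => 1 - y) 0 := by fun_prop
    exact analyticAt_const.mul (h1.log (by norm_num))
  obtain ⟨m, hm, hm0, hlm⟩ := exists_analyticAt_eq_mul hlog (by simp)
  have hm0' : m 0 = 1 / 2 := by
    rw [hm0]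
    have h1 : HasDerivAt (fun y : ℝ => 1 - y) (-1) 0 := by
      simpa using (hasDerivAt_id (0 : ℝ)).const_sub 1
    have h2 := (h1.log (by norm_num)).const_mul (-(1 / 2))
    rw [h2.deriv]; norm_num
  obtain ⟨σ, hσ, hσ0, hsin⟩ := exists_analyticAt_eq_mul (Real.analyticAt_sin (x := 0)) Real.sin_zero
  have hσ0' : σ 0 = 1 := by rw [hσ0, Real.deriv_sin, Real.cos_zero]
  have hσneg : ∀ u, σ (-u) = σ u := by
    intro u
    rcases eq_or_ne u 0 with rfl | hu
    · rw [neg_zero]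
    · have h1 := hsin u
      have h2 := hsin (-u)
      rw [Real.sin_neg, h1] at h2
      exact mul_left_cancel₀ hu (by linarith)
  set l : ℝ → ℝ := fun x => (Real.cosh (κ * (a + x) + h) ^ 2)⁻¹ with hl
  have hla : AnalyticAt ℝ l 0 := by
    have h1 : AnalyticAt ℝ (fun x => Real.cosh (κ * (a + x) + h)) 0 :=
      AnalyticAt.fun_comp (g := Real.cosh) Real.analyticAt_cosh (by fun_prop)
    exact (h1.pow 2).inv (pow_ne_zero 2 (Real.cosh_pos _).ne')
  have hl2 : AnalyticAt ℝ (fun z : ℝ × ℝ => l z.1) 0 :=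
    AnalyticAt.fun_comp (g := l) hla analyticAt_fst
  have hσ2 : AnalyticAt ℝ (fun z : ℝ × ℝ => σ z.2) 0 :=
    AnalyticAt.fun_comp (g := σ) hσ analyticAt_snd
  have hy : AnalyticAt ℝ (fun z : ℝ × ℝ => z.2 ^ 2 * (σ z.2 ^ 2 * l z.1)) 0 :=
    (analyticAt_snd.pow 2).mul ((hσ2.pow 2).mul hl2)
  refine ⟨fun z => (σ z.2 ^ 2 * l z.1) * m (z.2 ^ 2 * (σ z.2 ^ 2 * l z.1)), ?_, ?_, ?_, ?_⟩
  · refine ((hσ2.pow 2).mul hl2).mul (AnalyticAt.fun_comp (g := m) ?_ hy)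
    simpa using hm
  · intro x
    simp only [hσ0', ne_eq, OfNat.ofNat_ne_zero, not_false_eq_true, zero_pow, zero_mul, hm0', hl]
    field_simp
  · intro x u
    simp only [hσneg, neg_sq]
  · have e1 : ∀ᶠ z in 𝓝 (0 : ℝ × ℝ), z.2 ^ 2 * (σ z.2 ^ 2 * l z.1) < 1 :=
      hy.continuousAt.eventually_lt continuousAt_const (by simp)
    have e2 : ∀ᶠ z in 𝓝 (0 : ℝ × ℝ), z.2 ∈ Set.Icc (-(Real.pi / 2)) (Real.pi / 2) := by
      have hpi := Real.pi_pos
      have : Set.Icc (-(Real.pi / 2)) (Real.pi / 2) ∈ 𝓝 ((0 : ℝ × ℝ).2) :=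
        Icc_mem_nhds (by simp; linarith) (by simp; linarith)
      exact continuous_snd.continuousAt.eventually_mem this
    filter_upwards [e1, e2] with z h1 h2
    have hyz : Real.sin z.2 ^ 2 / Real.cosh (κ * (a + z.1) + h) ^ 2
        = z.2 ^ 2 * (σ z.2 ^ 2 * l z.1) := by
      rw [hsin z.2, hl]; ring
    rw [damping, Set.indicator_of_mem h2, hyz, Real.sqrt_eq_rpow,
      Real.rpow_def_of_pos (by linarith)]
    congr 1
    have := hlm (z.2 ^ 2 * (σ z.2 ^ 2 * l z.1))
    linear_combination -this

end

end CurieWeiss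

/-! ### The concentration probability as a ratio of planar integrals -/

namespace CurieWeiss
open MeasureTheory
open scoped ContDiff Topology

section
variable {κ h a : ℝ} {I : Set ℝ}

/-- An integrand that is even in the absence of a field may be restricted to `I`, at the cost of a
constant factor. -/
theorem IsPeak.exists_integral_eq (hI : IsPeak κ h I a) :
    ∃ c : ℝ, c ≠ 0 ∧ ∀ f : ℝ → ℝ, (h = 0 → ∀ x, f (-x) = f x) →
      ∫ x, f x = c * ∫ x, I.indicator f x := by
  rcases hI.domain with rfl | ⟨rfl, h0⟩
  · exact ⟨1, one_ne_zero, fun f _ => by simp⟩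
  · refine ⟨2, two_ne_zero, fun f hf => ?_⟩
    rw [integral_indicator measurableSet_Ici, integral_Ici_eq_integral_Ioi, ← integral_comp_abs]
    congr 1; ext x
    rcases abs_choice x with e | e <;> rw [e]
    rw [hf h0]

theorem integral_damping_pow (k : ℕ) (hk : 0 < k) (θ : ℝ) :
    ∫ u, damping θ u ^ (k + k) = Real.pi * balancedMass k θ / (2 * Real.cosh θ) ^ (k + k) := by
  have hpi := Real.pi_pos
  have hc := Real.cosh_pos θ
  have h1 : ∀ u, damping θ u ^ (k + k) = (Set.Icc (-(Real.pi / 2)) (Real.pi / 2)).indicator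
      (fun u => tiltKernel θ u ^ k / (2 * Real.cosh θ) ^ (k + k)) u := by
    intro u
    by_cases hu : u ∈ Set.Icc (-(Real.pi / 2)) (Real.pi / 2)
    · have hs : 0 ≤ 1 - Real.sin u ^ 2 / Real.cosh θ ^ 2 := by
        rw [sub_nonneg, div_le_one (by positivity)]
        have := tiltKernel_nonneg θ u
        unfold tiltKernel at this
        linarith
      have hb : 1 - Real.sin u ^ 2 / Real.cosh θ ^ 2
          = tiltKernel θ u / ((2 * Real.cosh θ) * (2 * Real.cosh θ)) := by
        unfold tiltKernel
        field_simp
        ring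
      rw [damping, Set.indicator_of_mem hu, Set.indicator_of_mem hu, pow_add, ← mul_pow,
        Real.mul_self_sqrt hs, hb, div_pow, mul_pow, ← pow_add]
    · rw [damping, Set.indicator_of_notMem hu, Set.indicator_of_notMem hu, zero_pow (by omega)]
  simp only [h1]
  rw [integral_indicator measurableSet_Icc, integral_Icc_eq_integral_Ioc,
    ← intervalIntegral.integral_of_le (by linarith), intervalIntegral.integral_div, balancedMass]
  field_simp

/-- The common factor relating Gaussian mixtures to integrals of powers of the profile. -/
theorem integral_mixture_eq (k : ℕ) (hk : 0 < k) (f : ℝ → ℝ) :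
    ∫ x, I.indicator (fun x => Real.exp (-(((k + k : ℕ) : ℝ) * x ^ 2 / 2)) *
        ((2 * Real.cosh (κ * x + h)) ^ (k + k) * f x)) x
      = (2 * Real.exp (-phase κ h a)) ^ (k + k) *
        ∫ y, profile κ h I a y ^ (k + k) * f (a + y) := by
  rw [← integral_const_mul, ← integral_add_left_eq_self (μ := volume)
    (fun x => I.indicator (fun x => Real.exp (-(((k + k : ℕ) : ℝ) * x ^ 2 / 2)) *
        ((2 * Real.cosh (κ * x + h)) ^ (k + k) * f x)) x) a]
  congr 1; ext y
  rw [profile]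
  by_cases hx : a + y ∈ I
  · rw [Set.indicator_of_mem hx, Set.indicator_of_mem hx]
    have e1 : Real.exp (-(((k + k : ℕ) : ℝ) * (a + y) ^ 2 / 2))
        = Real.exp (-((a + y) ^ 2 / 2)) ^ (k + k) := by
      rw [← Real.exp_nat_mul]; congr 1; ring
    have e2 : Real.exp (-(phase κ h (a + y) - phase κ h a)) * Real.exp (-phase κ h a)
        = Real.exp (-((a + y) ^ 2 / 2)) * Real.cosh (κ * (a + y) + h) := by
      rw [← exp_neg_phase, ← Real.exp_add]; congr 1; ring
    rw [e1, ← mul_assoc, ← mul_assoc, ← mul_pow, ← mul_pow]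
    congr 2
    linear_combination (-2) * e2
  · rw [Set.indicator_of_notMem hx, Set.indicator_of_notMem hx, zero_pow (by omega)]
    simp

theorem IsPeak.totalDensity_le_one (hI : IsPeak κ h I a) (z : ℝ × ℝ) :
    totalDensity κ h I a z ≤ 1 :=
  mul_le_one₀ (hI.profile_le_one _) (Real.exp_pos _).le
    (Real.exp_le_one_iff.2 (by have := sq_nonneg z.2; linarith))

theorem IsPeak.balancedDensity_le_one (hI : IsPeak κ h I a) (z : ℝ × ℝ) :
    balancedDensity κ h I a z ≤ 1 :=
  mul_le_one₀ (hI.profile_le_one _) (damping_nonneg _ _) (damping_le_one _ _)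

theorem totalDensity_nonneg (z : ℝ × ℝ) : 0 ≤ totalDensity κ h I a z :=
  mul_nonneg (profile_nonneg _) (Real.exp_pos _).le

theorem balancedDensity_nonneg (z : ℝ × ℝ) : 0 ≤ balancedDensity κ h I a z :=
  mul_nonneg (profile_nonneg _) (damping_nonneg _ _)

theorem integral_totalDensity_pow (k : ℕ) :
    ∫ z, totalDensity κ h I a z ^ (k + k)
      = (∫ y, profile κ h I a y ^ (k + k)) * Real.sqrt (2 * Real.pi / ((k + k : ℕ) : ℝ)) := by
  have h1 : Real.sqrt (2 * Real.pi / ((k + k : ℕ) : ℝ))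
      = ∫ u : ℝ, Real.exp (-(u ^ 2 / 2)) ^ (k + k) := by
    have := integral_gaussian (((k + k : ℕ) : ℝ) / 2)
    rw [show Real.pi / (((k + k : ℕ) : ℝ) / 2) = 2 * Real.pi / ((k + k : ℕ) : ℝ) by
      rw [div_div_eq_mul_div, mul_comm]] at this
    rw [← this]
    congr 1; ext u
    rw [← Real.exp_nat_mul]; congr 1; ring
  rw [h1, ← integral_prod_mul]
  congr 1; ext z
  rw [totalDensity, mul_pow]

theorem IsPeak.integral_balancedDensity_pow (hI : IsPeak κ h I a) (k : ℕ) (hk : 0 < k) :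
    ∫ z, balancedDensity κ h I a z ^ (k + k)
      = ∫ y, profile κ h I a y ^ (k + k) * ∫ u, damping (κ * (a + y) + h) u ^ (k + k) := by
  have hint : Integrable (fun z => balancedDensity κ h I a z ^ (k + k)) := by
    refine hI.integrable_balancedDensity.mono'
      (hI.integrable_balancedDensity.aestronglyMeasurable.pow _)
      (Filter.Eventually.of_forall fun z => ?_)
    rw [Real.norm_of_nonneg (pow_nonneg (balancedDensity_nonneg z) _)]
    exact pow_le_of_le_one (balancedDensity_nonneg z) (hI.balancedDensity_le_one z) (by omega)
  rw [Measure.volume_eq_prod] at *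
  rw [integral_prod _ hint]
  congr 1; ext y
  rw [← integral_const_mul]
  congr 1; ext u
  rw [balancedDensity, mul_pow]

/-- The concentration probability as a ratio of integrals of `n`-th powers of planar densities. -/
theorem IsPeak.sqrt_mul_div_eq (hI : IsPeak κ h I a) (k : ℕ) (hk : 0 < k) :
    Real.sqrt ((k + k : ℕ) : ℝ) * (mixedBalanced κ h k / mixedTotal κ h k)
      = Real.sqrt (2 / Real.pi) * ((∫ z, balancedDensity κ h I a z ^ (k + k)) /
        ∫ z, totalDensity κ h I a z ^ (k + k)) := by
  obtain ⟨c, hc, hcI⟩ := hI.exists_integral_eq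
  have hn : (0 : ℝ) < ((k + k : ℕ) : ℝ) := by exact_mod_cast (by omega : 0 < k + k)
  have hpi := Real.pi_pos
  set P := (2 * Real.exp (-phase κ h a)) ^ (k + k) with hP
  have hPpos : 0 < P := by positivity
  have hT : mixedTotal κ h k = c * (P * ∫ y, profile κ h I a y ^ (k + k)) := by
    have h1 := integral_mixture_eq (κ := κ) (h := h) (a := a) (I := I) k hk (fun _ => 1)
    simp only [mul_one] at h1
    rw [← h1, mixedTotal]
    refine hcI _ fun h0 x => ?_
    rw [h0, neg_sq, mul_neg, add_zero, add_zero, Real.cosh_neg]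
  have hB : mixedBalanced κ h k
      = c * (P * ((∫ z, balancedDensity κ h I a z ^ (k + k)) / Real.pi)) := by
    have h1 := integral_mixture_eq (κ := κ) (h := h) (a := a) (I := I) k hk
      (fun x => (∫ u, damping (κ * x + h) u ^ (k + k)) / Real.pi)
    have h2 : ∀ x, (2 * Real.cosh (κ * x + h)) ^ (k + k) *
        ((∫ u, damping (κ * x + h) u ^ (k + k)) / Real.pi) = balancedMass k (κ * x + h) := by
      intro x
      have := Real.cosh_pos (κ * x + h)
      rw [integral_damping_pow k hk]
      field_simp
    simp only [h2] at h1
    rw [hI.integral_balancedDensity_pow k hk, ← integral_div]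
    simp only [mul_div_assoc]
    rw [← h1, mixedBalanced]
    refine hcI _ fun h0 x => ?_
    rw [h0, neg_sq, mul_neg, add_zero, add_zero, balancedMass_neg]
  rw [hT, hB, integral_totalDensity_pow, mul_div_mul_left _ _ hc, mul_div_mul_left _ _ hPpos.ne',
    Real.sqrt_div (by positivity), Real.sqrt_div (by positivity), Real.sqrt_mul (by positivity)]
  have h1 := Real.sq_sqrt hpi.le
  have h2 : 0 < Real.sqrt Real.pi := Real.sqrt_pos.2 hpi
  have h3 : 0 < Real.sqrt 2 := by positivity
  have h4 : 0 < Real.sqrt ((k + k : ℕ) : ℝ) := Real.sqrt_pos.2 hn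
  nth_rewrite 1 [← h1]
  field_simp

end

end CurieWeiss

/-! ### Smooth functions of the scale -/

namespace CurieWeiss
open MeasureTheory Filter
open scoped ContDiff Topology

/-- The scale `ε = n^{-1/(2r)}`. -/
noncomputable def scale (r n : ℕ) : ℝ := (n : ℝ) ^ (-(1 / (2 * r : ℝ)))

theorem scale_pos (r : ℕ) {n : ℕ} (hn : 0 < n) : 0 < scale r n :=
  Real.rpow_pos_of_pos (by exact_mod_cast hn) _

theorem scale_pow_mul {r n : ℕ} (hr : 1 ≤ r) (hn : 0 < n) : scale r n ^ (2 * r) * n = 1 := by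
  have hn' : (0 : ℝ) < n := by exact_mod_cast hn
  have hr' : (r : ℝ) ≠ 0 := by positivity
  rw [scale, ← Real.rpow_natCast, ← Real.rpow_mul hn'.le,
    show -(1 / (2 * r : ℝ)) * ((2 * r : ℕ) : ℝ) = -1 by push_cast; field_simp,
    Real.rpow_neg_one, inv_mul_cancel₀ hn'.ne']

theorem tendsto_scale {r : ℕ} (hr : 1 ≤ r) : Tendsto (scale r) atTop (𝓝 0) :=
  (tendsto_rpow_neg_atTop (y := 1 / (2 * r : ℝ)) (by positivity)).comp tendsto_natCast_atTop_atTop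

theorem inv_scale_pow_le {r n : ℕ} (hr : 1 ≤ r) (hn : 0 < n) :
    (scale r n ^ (1 + r))⁻¹ ≤ (n : ℝ) ^ (1 + r) := by
  have hn' : (1 : ℝ) ≤ n := by exact_mod_cast hn
  have hpos := scale_pos r hn
  rw [← inv_pow]
  refine pow_le_pow_left₀ (by positivity) ?_ _
  rw [scale, ← Real.rpow_neg (by linarith), neg_neg]
  conv_rhs => rw [← Real.rpow_one (n : ℝ)]
  refine Real.rpow_le_rpow_of_exponent_le hn' ?_
  have : (1 : ℝ) ≤ r := by exact_mod_cast hr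
  rw [div_le_one (by positivity)]
  linarith

theorem isBigO_pow_mul_pow {ρ : ℝ} (hρ0 : 0 < ρ) (hρ : ρ < 1) (j M : ℕ) :
    (fun n : ℕ => (n : ℝ) ^ j * ρ ^ n) =O[atTop] fun n : ℕ => ((n : ℝ) ^ M)⁻¹ := by
  have h := (tendsto_pow_const_mul_const_pow_of_lt_one (j + M) hρ0.le hρ).isBigO_one ℝ
  have h2 := h.mul (Asymptotics.isBigO_refl (fun n : ℕ => ((n : ℝ) ^ M)⁻¹) atTop)
  refine (EventuallyEq.trans_isBigO ?_ h2).trans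
    (Asymptotics.isBigO_of_le _ fun n => by simp)
  filter_upwards [eventually_gt_atTop 0] with n hn
  have : (n : ℝ) ≠ 0 := by positivity
  rw [pow_add]
  field_simp

section
variable {κ h a : ℝ} {I : Set ℝ}

/-- Laplace's method applied to numerator and denominator: around the peak the concentration
probability is a quotient of two smooth even functions of `ε = n^{-1/(2r)}`, up to an error
smaller than any power of `n`. The two functions `F_N`, `F_D` share the factor `x^{2r} g`, and
differ in the coefficient of `u²` in the exponent. -/
theorem IsPeak.exists_quotient (hI : IsPeak κ h I a) {r : ℕ} (hr : 1 ≤ r) {g : ℝ → ℝ}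
    (hg : AnalyticAt ℝ g 0) (hg0 : 0 < g 0)
    (hphase : ∀ᶠ y in 𝓝 0, phase κ h (a + y) - phase κ h a = y ^ (2 * r) * g y)
    {K : ℝ × ℝ → ℝ} (hK : AnalyticAt ℝ K 0) (hK0 : 0 < K 0)
    (hdamp : ∀ᶠ z in 𝓝 (0 : ℝ × ℝ),
      damping (κ * (a + z.1) + h) z.2 = Real.exp (-(z.2 ^ 2 * K z))) :
    ∃ FN FD : ℝ → ℝ, ContDiffOn ℝ ∞ FN (Set.Ioo (-1) 1) ∧ ContDiffOn ℝ ∞ FD (Set.Ioo (-1) 1) ∧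
      (∀ ε, FN (-ε) = FN ε) ∧ (∀ ε, FD (-ε) = FD ε) ∧ 0 < FD 0 ∧
      FN 0 = (∫ s : ℝ, Real.exp (-(g 0 * s ^ (2 * r)))) * Real.sqrt (Real.pi / K 0) ∧
      FD 0 = (∫ s : ℝ, Real.exp (-(g 0 * s ^ (2 * r)))) * Real.sqrt (Real.pi / (1 / 2)) ∧
      Integrable (fun v => deriv (deriv fun ε =>
        Real.exp (-laplacePhase r (fun z => g z.1) K ε v)) 0) ∧
      Integrable (fun v => deriv (deriv fun ε =>
        Real.exp (-laplacePhase r (fun z => g z.1) (fun _ => 1 / 2) ε v)) 0) ∧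
      deriv (deriv FN) 0 = ∫ v, deriv (deriv fun ε =>
        Real.exp (-laplacePhase r (fun z => g z.1) K ε v)) 0 ∧
      deriv (deriv FD) 0 = ∫ v, deriv (deriv fun ε =>
        Real.exp (-laplacePhase r (fun z => g z.1) (fun _ => 1 / 2) ε v)) 0 ∧
      ∀ M : ℕ, (fun k : ℕ => Real.sqrt ((k + k : ℕ) : ℝ) * (mixedBalanced κ h k / mixedTotal κ h k)
        - Real.sqrt (2 / Real.pi) * (FN (scale r (k + k)) / FD (scale r (k + k))))
          =O[atTop] fun k : ℕ => (((k + k : ℕ) : ℝ) ^ M)⁻¹ := by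
  have hG : AnalyticAt ℝ (fun z : ℝ × ℝ => g z.1) 0 :=
    AnalyticAt.fun_comp (g := g) hg analyticAt_fst
  have hprof : ∀ᶠ z in 𝓝 (0 : ℝ × ℝ),
      profile κ h I a z.1 = Real.exp (-(z.1 ^ (2 * r) * g z.1)) := by
    have h1 : ∀ᶠ y in 𝓝 (0 : ℝ), a + y ∈ I := by
      have : Tendsto (fun y => a + y) (𝓝 0) (𝓝 a) := by
        simpa using (continuous_const_add a).tendsto 0
      exact this hI.mem_nhds
    have h2 : Tendsto (fun z : ℝ × ℝ => z.1) (𝓝 0) (𝓝 0) := continuous_fst.tendsto 0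
    filter_upwards [h2.eventually h1, h2.eventually hphase] with z m1 m2
    rw [profile, Set.indicator_of_mem m1, m2]
  obtain ⟨FN, cN, eN, -, vN, iN, dN, CN, ρN, ρN0, ρN1, bN⟩ := laplace_method hr hG hg0 hK hK0
    hI.integrable_balancedDensity balancedDensity_nonneg hI.balancedDensity_le_one
    (by
      filter_upwards [hprof, hdamp] with z h1 h2
      rw [balancedDensity, h1, h2, ← Real.exp_add]
      congr 1; ring)
    (fun U hU => hI.exists_balancedDensity_le hU)
  obtain ⟨FD, cD, eD, pD, vD, iD, dD, CD, ρD, ρD0, ρD1, bD⟩ := laplace_method hr hG hg0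
    (K := fun _ => 1 / 2) analyticAt_const (by norm_num)
    hI.integrable_totalDensity totalDensity_nonneg hI.totalDensity_le_one
    (by
      filter_upwards [hprof] with z h1
      rw [totalDensity, h1, ← Real.exp_add]
      congr 1; ring)
    (fun U hU => hI.exists_totalDensity_le hU)
  refine ⟨FN, FD, cN, cD, eN, eD, pD, vN, vD, iN, iD, dN, dD, fun M => ?_⟩
  have hdouble : Tendsto (fun k : ℕ => k + k) atTop atTop :=
    tendsto_atTop_mono (fun k => Nat.le_add_left k k) tendsto_id
  -- the rescaled integrals differ from `FN` and `FD` by less than any power of `n`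
  have hclose : ∀ {F : ℝ → ℝ} {J : ℕ → ℝ} {C ρ : ℝ}, 0 < ρ → ρ < 1 →
      (∀ n : ℕ, 0 < n → ∀ ε : ℝ, 0 < ε → ε ^ (2 * r) * n = 1 →
        |J n - ε ^ (1 + r) * F ε| ≤ C * ρ ^ n) → ∀ M : ℕ,
      (fun n : ℕ => (scale r n ^ (1 + r))⁻¹ * J n - F (scale r n))
        =O[atTop] fun n : ℕ => ((n : ℝ) ^ M)⁻¹ := by
    intro F J C ρ h0 h1 hb M
    refine (Asymptotics.IsBigO.of_bound C ?_).trans (isBigO_pow_mul_pow h0 h1 (1 + r) M)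
    filter_upwards [eventually_gt_atTop 0] with n hn
    have hs := scale_pos r hn
    have hsp : 0 < scale r n ^ (1 + r) := pow_pos hs _
    have h2 := hb n hn _ hs (scale_pow_mul hr hn)
    have h3 : (scale r n ^ (1 + r))⁻¹ * J n - F (scale r n)
        = (scale r n ^ (1 + r))⁻¹ * (J n - scale r n ^ (1 + r) * F (scale r n)) := by
      field_simp
    have hC : 0 ≤ C * ρ ^ n := (abs_nonneg _).trans h2
    rw [h3, norm_mul, Real.norm_of_nonneg (inv_pos.2 hsp).le, Real.norm_eq_abs,
      Real.norm_of_nonneg (by positivity)]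
    calc _ ≤ (n : ℝ) ^ (1 + r) * (C * ρ ^ n) :=
          mul_le_mul (inv_scale_pow_le hr hn) h2 (abs_nonneg _) (by positivity)
      _ = _ := by ring
  set A : ℕ → ℝ := fun n => (scale r n ^ (1 + r))⁻¹ * ∫ z, balancedDensity κ h I a z ^ n with hA
  set B : ℕ → ℝ := fun n => (scale r n ^ (1 + r))⁻¹ * ∫ z, totalDensity κ h I a z ^ n with hB
  have hcA : ∀ M : ℕ, (fun n => A n - FN (scale r n)) =O[atTop] fun n : ℕ => ((n : ℝ) ^ M)⁻¹ :=
    hclose ρN0 ρN1 bN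
  have hcB : ∀ M : ℕ, (fun n => B n - FD (scale r n)) =O[atTop] fun n : ℕ => ((n : ℝ) ^ M)⁻¹ :=
    hclose ρD0 ρD1 bD
  have h01 : Set.Ioo (-1 : ℝ) 1 ∈ 𝓝 (0 : ℝ) := Ioo_mem_nhds (by norm_num) one_pos
  have tN : Tendsto (fun n => FN (scale r n)) atTop (𝓝 (FN 0)) :=
    (cN.continuousOn.continuousAt h01).tendsto.comp (tendsto_scale hr)
  have tD : Tendsto (fun n => FD (scale r n)) atTop (𝓝 (FD 0)) :=
    (cD.continuousOn.continuousAt h01).tendsto.comp (tendsto_scale hr)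
  have tB : Tendsto B atTop (𝓝 (FD 0)) := by
    have h1 : Tendsto (fun n => B n - FD (scale r n)) atTop (𝓝 0) := by
      refine (hcB 1).trans_tendsto ?_
      simpa using tendsto_inv_atTop_nhds_zero_nat (𝕜 := ℝ)
    simpa using h1.add tD
  have hdiff : (fun n => A n / B n - FN (scale r n) / FD (scale r n))
      =O[atTop] fun n : ℕ => ((n : ℝ) ^ M)⁻¹ := by
    have b1 : (fun n => (B n)⁻¹) =O[atTop] fun _ => (1 : ℝ) := (tB.inv₀ pD.ne').isBigO_one ℝ
    have b2 : (fun n => FN (scale r n) * ((B n)⁻¹ * (FD (scale r n))⁻¹)) =O[atTop]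
        fun _ => (1 : ℝ) :=
      (tN.mul ((tB.inv₀ pD.ne').mul (tD.inv₀ pD.ne'))).isBigO_one ℝ
    have b3 := ((hcA M).mul b1).sub ((hcB M).mul b2)
    simp only [mul_one] at b3
    refine EventuallyEq.trans_isBigO ?_ b3
    filter_upwards [tB.eventually_ne pD.ne', tD.eventually_ne pD.ne'] with n h1 h2
    field_simp
    ring
  have hfin := (hdiff.const_mul_left (Real.sqrt (2 / Real.pi))).comp_tendsto hdouble
  refine EventuallyEq.trans_isBigO ?_ hfin
  filter_upwards [eventually_gt_atTop 0] with k hk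
  have hsp : (scale r (k + k) ^ (1 + r))⁻¹ ≠ 0 :=
    inv_ne_zero (pow_pos (scale_pos r (by omega)) _).ne'
  rw [hI.sqrt_mul_div_eq k hk, Function.comp_apply, hA, hB]
  simp only
  rw [mul_div_mul_left _ _ hsp, mul_sub]

end

end CurieWeiss

/-! ### Peaks of the phase -/

namespace CurieWeiss
open MeasureTheory Filter
open scoped ContDiff Topology

theorem analyticAt_tanh (x : ℝ) : AnalyticAt ℝ Real.tanh x := by
  have h : Real.tanh = fun x => Real.sinh x / Real.cosh x := by
    ext x; exact Real.tanh_eq_sinh_div_cosh x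
  rw [h]
  exact Real.analyticAt_sinh.div Real.analyticAt_cosh (Real.cosh_pos x).ne'

theorem hasDerivAt_tanh (x : ℝ) : HasDerivAt Real.tanh (1 / Real.cosh x ^ 2) x := by
  have h : Real.tanh = fun x => Real.sinh x / Real.cosh x := by
    ext x; exact Real.tanh_eq_sinh_div_cosh x
  rw [h]
  refine ((Real.hasDerivAt_sinh x).div (Real.hasDerivAt_cosh x) (Real.cosh_pos x).ne').congr_deriv
    ?_
  congr 1
  have := Real.cosh_sq x
  linarith

theorem tanh_pos {x : ℝ} (hx : 0 < x) : 0 < Real.tanh x := by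
  rw [Real.tanh_eq_sinh_div_cosh]
  exact div_pos (Real.sinh_pos_iff.2 hx) (Real.cosh_pos x)

theorem tanh_nonneg {x : ℝ} (hx : 0 ≤ x) : 0 ≤ Real.tanh x := by
  rw [Real.tanh_eq_sinh_div_cosh]
  exact div_nonneg (Real.sinh_nonneg_iff.2 hx) (Real.cosh_pos x).le

/-- Integrating a factorization: if `f' = y ^ m g` near a zero of `f`, with `g 0 ≠ 0`, then
`f = y ^ (m + 1) G` with `G 0 = g 0 / (m + 1)`. -/
theorem exists_pow_succ_factor {f g : ℝ → ℝ} {m : ℕ} (hf : AnalyticAt ℝ f 0) (hf0 : f 0 = 0)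
    (hg : AnalyticAt ℝ g 0) (hg0 : g 0 ≠ 0) (hfg : ∀ᶠ y in 𝓝 0, deriv f y = y ^ m * g y) :
    ∃ G : ℝ → ℝ, AnalyticAt ℝ G 0 ∧ G 0 = g 0 / (m + 1) ∧
      ∀ᶠ y in 𝓝 0, f y = y ^ (m + 1) * G y := by
  have h1 : analyticOrderAt (deriv f) 0 = m :=
    hf.deriv.analyticOrderAt_eq_natCast.2 ⟨g, hg, hg0, by simpa using hfg⟩
  have h2 : analyticOrderAt f 0 = ((m + 1 : ℕ) : ℕ∞) := by
    have := hf.analyticOrderAt_deriv_add_one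
    simp only [hf0, sub_zero] at this
    rw [← this, h1]; rfl
  obtain ⟨G, hG, -, hfG⟩ := hf.analyticOrderAt_eq_natCast.1 h2
  simp only [sub_zero, smul_eq_mul] at hfG
  refine ⟨G, hG, ?_, hfG⟩
  have h3 : ∀ᶠ y in 𝓝 0, y ^ m * g y = (m + 1) * y ^ m * G y + y ^ (m + 1) * deriv G y := by
    filter_upwards [hfG.eventually_nhds, hfg, hG.eventually_analyticAt] with y h4 h5 h6
    have h7 : f =ᶠ[𝓝 y] fun y => y ^ (m + 1) * G y := h4
    rw [← h5, h7.deriv_eq]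
    have := (hasDerivAt_pow (m + 1) y).mul h6.differentiableAt.hasDerivAt
    have e := this.deriv
    simp only [Nat.add_sub_cancel, Nat.cast_add, Nat.cast_one] at e
    exact e
  have h4 : (fun y => g y) =ᶠ[𝓝[≠] 0] fun y => (m + 1) * G y + y * deriv G y := by
    filter_upwards [nhdsWithin_le_nhds h3, self_mem_nhdsWithin] with y h5 hy
    refine mul_left_cancel₀ (pow_ne_zero m hy) ?_
    rw [h5]; ring
  have t1 : Tendsto g (𝓝[≠] 0) (𝓝 (g 0)) := hg.continuousAt.tendsto.mono_left nhdsWithin_le_nhds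
  have t2 : Tendsto (fun y => (m + 1) * G y + y * deriv G y) (𝓝[≠] 0)
      (𝓝 ((m + 1) * G 0 + 0 * deriv G 0)) :=
    Tendsto.mono_left ((hG.continuousAt.tendsto.const_mul _).add
      (continuousAt_id.tendsto.mul hG.deriv.continuousAt.tendsto)) nhdsWithin_le_nhds
  have := tendsto_nhds_unique (t2.congr' h4.symm) t1
  rw [zero_mul, add_zero] at this
  rw [← this]
  field_simp

/-- The derivative of the phase. -/
noncomputable def phaseDeriv (κ h x : ℝ) : ℝ := x - κ * Real.tanh (κ * x + h)

theorem hasDerivAt_phaseDeriv (κ h x : ℝ) :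
    HasDerivAt (phaseDeriv κ h) (1 - κ ^ 2 / Real.cosh (κ * x + h) ^ 2) x := by
  have h1 : HasDerivAt (fun x => κ * x + h) κ x := by
    simpa using ((hasDerivAt_id x).const_mul κ).add_const h
  have h2 := ((hasDerivAt_tanh (κ * x + h)).comp x h1).const_mul κ
  refine ((hasDerivAt_id x).sub h2).congr_deriv ?_
  ring

theorem analyticAt_phaseDeriv (κ h x : ℝ) : AnalyticAt ℝ (phaseDeriv κ h) x := by
  have h1 : AnalyticAt ℝ (fun x => Real.tanh (κ * x + h)) x :=
    AnalyticAt.fun_comp (g := Real.tanh) (analyticAt_tanh _) (by fun_prop)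
  exact analyticAt_id.sub (analyticAt_const.mul h1)

/-- From a factorization of the second derivative of the phase at a critical point to one of the
phase itself. -/
theorem exists_phase_factor {κ h a : ℝ} (ha : phaseDeriv κ h a = 0) {g : ℝ → ℝ} {m : ℕ}
    (hg : AnalyticAt ℝ g 0) (hg0 : g 0 ≠ 0)
    (hfg : ∀ᶠ y in 𝓝 0, 1 - κ ^ 2 / Real.cosh (κ * (a + y) + h) ^ 2 = y ^ m * g y) :
    ∃ G : ℝ → ℝ, AnalyticAt ℝ G 0 ∧ G 0 = g 0 / ((m + 1) * (m + 2)) ∧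
      ∀ᶠ y in 𝓝 0, phase κ h (a + y) - phase κ h a = y ^ (m + 2) * G y := by
  have hadd : ∀ y : ℝ, HasDerivAt (fun y => a + y) 1 y := fun y => (hasDerivAt_id y).const_add a
  have d1 : ∀ y, HasDerivAt (fun y => phaseDeriv κ h (a + y))
      (1 - κ ^ 2 / Real.cosh (κ * (a + y) + h) ^ 2) y := by
    intro y
    have := (hasDerivAt_phaseDeriv κ h (a + y)).comp y (hadd y)
    rw [mul_one] at this
    exact this
  have d2 : ∀ y, HasDerivAt (fun y => phase κ h (a + y) - phase κ h a)
      (phaseDeriv κ h (a + y)) y := by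
    intro y
    have := ((hasDerivAt_phase κ h (a + y)).comp y (hadd y)).sub_const (phase κ h a)
    rw [mul_one] at this
    exact this
  obtain ⟨G₁, hG₁, hG₁0, h1⟩ := exists_pow_succ_factor
    (f := fun y => phaseDeriv κ h (a + y)) (m := m)
    (AnalyticAt.fun_comp (g := phaseDeriv κ h) (analyticAt_phaseDeriv _ _ _) (by fun_prop))
    (by simpa using ha) hg hg0 (by
      filter_upwards [hfg] with y hy
      rw [(d1 y).deriv, hy])
  have hm : (0 : ℝ) < m + 1 := by positivity
  obtain ⟨G, hG, hG0, h2⟩ := exists_pow_succ_factor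
    (f := fun y => phase κ h (a + y) - phase κ h a) (m := m + 1)
    ((AnalyticAt.fun_comp (g := phase κ h) (analyticAt_phase _ _ _) (by fun_prop)).sub
      analyticAt_const)
    (by simp) hG₁ (by rw [hG₁0]; exact div_ne_zero hg0 hm.ne') (by
      filter_upwards [h1] with y hy
      rw [(d2 y).deriv, hy])
  refine ⟨G, hG, ?_, h2⟩
  rw [hG0, hG₁0, div_div]
  push_cast
  congr 2; ring

/-- At a nondegenerate critical point the phase is quadratic to leading order. -/
theorem exists_phase_factor_of_pos {κ h a : ℝ} (ha : phaseDeriv κ h a = 0)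
    (hc : 0 < 1 - κ ^ 2 / Real.cosh (κ * a + h) ^ 2) :
    ∃ G : ℝ → ℝ, AnalyticAt ℝ G 0 ∧ 0 < G 0 ∧
      ∀ᶠ y in 𝓝 0, phase κ h (a + y) - phase κ h a = y ^ (2 * 1) * G y := by
  have hg : AnalyticAt ℝ (fun y => 1 - κ ^ 2 / Real.cosh (κ * (a + y) + h) ^ 2) 0 := by
    have h1 : AnalyticAt ℝ (fun y => Real.cosh (κ * (a + y) + h)) 0 :=
      AnalyticAt.fun_comp (g := Real.cosh) Real.analyticAt_cosh (by fun_prop)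
    exact analyticAt_const.sub (analyticAt_const.div (h1.pow 2)
      (pow_ne_zero 2 (Real.cosh_pos _).ne'))
  obtain ⟨G, h1, h2, h3⟩ := exists_phase_factor (m := 0) ha hg (by simpa using hc.ne')
    (Eventually.of_forall fun y => by simp)
  refine ⟨G, h1, ?_, h3⟩
  rw [h2]
  simp only [add_zero, Nat.cast_zero, zero_add]
  positivity

/-- At the critical temperature the phase `x² / 2 - log cosh x` is `x⁴ / 12` to leading order. -/
theorem exists_phase_factor_critical :
    ∃ G : ℝ → ℝ, AnalyticAt ℝ G 0 ∧ G 0 = 1 / 12 ∧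
      ∀ᶠ y in 𝓝 0, phase 1 0 (0 + y) - phase 1 0 0 = y ^ (2 * 2) * G y := by
  obtain ⟨T, hT, hT0, hTt⟩ := exists_analyticAt_eq_mul (analyticAt_tanh 0) Real.tanh_zero
  have hT1 : T 0 = 1 := by rw [hT0, (hasDerivAt_tanh 0).deriv]; simp
  obtain ⟨G, h1, h2, h3⟩ := exists_phase_factor (κ := 1) (h := 0) (a := 0) (m := 2)
    (g := fun y => T y ^ 2) (by simp [phaseDeriv]) (hT.pow 2) (by simp [hT1])
    (Eventually.of_forall fun y => by
      rw [← mul_pow, ← hTt y, Real.tanh_eq_sinh_div_cosh, div_pow]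
      have := Real.cosh_sq y
      have := Real.cosh_pos y
      simp only [zero_add, one_mul, add_zero]
      field_simp
      linarith)
  refine ⟨G, h1, ?_, h3⟩
  rw [h2, hT1]; norm_num

theorem log_cosh_le (x : ℝ) : Real.log (Real.cosh x) ≤ x ^ 2 / 2 := by
  rw [Real.log_le_iff_le_exp (Real.cosh_pos x)]
  exact Real.cosh_le_exp_half_sq x

theorem isPeak_zero_of_lt_one {κ : ℝ} (hκ : 0 ≤ κ) (hκ1 : κ < 1) : IsPeak κ 0 Set.univ 0 := by
  refine ⟨Or.inl rfl, univ_mem, fun x _ hx => ?_⟩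
  have h1 := log_cosh_le (κ * x)
  have h2 : 0 < x ^ 2 := by positivity
  simp only [phase, add_zero, mul_zero, Real.cosh_zero, Real.log_one]
  have h3 : κ ^ 2 < 1 := by nlinarith
  nlinarith

theorem tanh_lt_self {x : ℝ} (hx : 0 < x) : Real.tanh x < x := by
  have h1 : StrictMonoOn (fun x => x - Real.tanh x) (Set.Ici 0) := by
    refine strictMonoOn_of_deriv_pos (convex_Ici 0) ?_ fun y hy => ?_
    · exact (continuous_iff_continuousAt.2 fun x =>
        (analyticAt_id.sub (analyticAt_tanh x)).continuousAt).continuousOn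
    · rw [interior_Ici] at hy
      have hd : HasDerivAt (fun x => x - Real.tanh x) (1 - 1 / Real.cosh y ^ 2) y :=
        (hasDerivAt_id' y).sub (hasDerivAt_tanh y)
      rw [hd.deriv, sub_pos]
      have : 1 < Real.cosh y := Real.one_lt_cosh.2 (ne_of_gt hy)
      rw [div_lt_one (by positivity)]
      nlinarith
  have := h1 Set.self_mem_Ici hx.le hx
  simp only [Real.tanh_zero, sub_zero] at this
  linarith

theorem isPeak_critical : IsPeak 1 0 Set.univ 0 := by
  have hpos : ∀ x : ℝ, 0 < x → phase 1 0 0 < phase 1 0 x := by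
    intro x hx
    have h1 : StrictMonoOn (phase 1 0) (Set.Ici 0) := by
      refine strictMonoOn_of_deriv_pos (convex_Ici 0) (continuous_phase 1 0).continuousOn
        fun y hy => ?_
      rw [interior_Ici] at hy
      rw [(hasDerivAt_phase 1 0 y).deriv, one_mul, one_mul, add_zero, sub_pos]
      exact tanh_lt_self hy
    exact h1 Set.self_mem_Ici hx.le hx
  refine ⟨Or.inl rfl, univ_mem, fun x _ hx => ?_⟩
  rcases lt_or_gt_of_ne hx with h | h
  · have := hpos (-x) (by linarith)
    rwa [phase, phase, neg_sq, mul_neg, add_zero, add_zero, Real.cosh_neg, ← add_zero (1 * x),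
      ← add_zero (1 * (0 : ℝ)), ← phase, ← phase] at this
  · exact hpos x h

theorem strictConvexOn_phaseDeriv {κ h : ℝ} (hκ : 0 < κ) (hh : 0 ≤ h) :
    StrictConvexOn ℝ (Set.Ici 0) (phaseDeriv κ h) := by
  refine StrictMonoOn.strictConvexOn_of_deriv (convex_Ici 0)
    (continuous_iff_continuousAt.2
      fun x => (analyticAt_phaseDeriv κ h x).continuousAt).continuousOn ?_
  rw [interior_Ici]
  intro x hx y hy hxy
  simp only [(hasDerivAt_phaseDeriv κ h _).deriv]
  have hx' : 0 < x := hx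
  have hy' : 0 < y := hy
  have h1 : Real.cosh (κ * x + h) < Real.cosh (κ * y + h) := by
    rw [Real.cosh_lt_cosh, abs_of_nonneg (by positivity), abs_of_nonneg (by positivity)]
    gcongr
  have := Real.cosh_pos (κ * x + h)
  gcongr

/-- A nontrivial zero of the derivative of the phase on the positive half-line. -/
theorem exists_phaseDeriv_eq_zero {κ h : ℝ} (hκ : 0 < κ) (hh : 0 ≤ h) (hκh : h = 0 → 1 < κ) :
    ∃ a, 0 < a ∧ phaseDeriv κ h a = 0 := by
  have hcont : Continuous (phaseDeriv κ h) :=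
    continuous_iff_continuousAt.2 fun x => (analyticAt_phaseDeriv κ h x).continuousAt
  have hend : 0 < phaseDeriv κ h κ := by
    have := Real.tanh_lt_one (κ * κ + h)
    unfold phaseDeriv
    nlinarith
  have hneg : ∃ x, 0 ≤ x ∧ x < κ ∧ phaseDeriv κ h x < 0 := by
    rcases hh.eq_or_lt with h0 | hpos
    · have hκ1 := hκh h0.symm
      have hd := hasDerivAt_phaseDeriv κ h 0
      rw [hasDerivAt_iff_tendsto_slope] at hd
      have hlt : 1 - κ ^ 2 / Real.cosh (κ * 0 + h) ^ 2 < 0 := by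
        rw [← h0, mul_zero, add_zero, Real.cosh_zero, one_pow, div_one]
        nlinarith
      have h1 := (hd.eventually_lt_const hlt).filter_mono
        (nhdsWithin_mono 0 (fun x (hx : 0 < x) => ne_of_gt hx) : 𝓝[>] (0 : ℝ) ≤ 𝓝[≠] 0)
      have h2 : ∀ᶠ x in 𝓝[>] (0 : ℝ), x ∈ Set.Ioo 0 κ := Ioo_mem_nhdsGT hκ
      obtain ⟨x, hx1, hx2⟩ := (h1.and h2).exists
      refine ⟨x, hx2.1.le, hx2.2, ?_⟩
      have hz : phaseDeriv κ h 0 = 0 := by simp [phaseDeriv, ← h0]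
      rw [slope_def_field, hz, sub_zero, sub_zero] at hx1
      by_contra hcon
      exact absurd hx1 (not_lt.2 (div_nonneg (not_lt.1 hcon) hx2.1.le))
    · refine ⟨0, le_rfl, hκ, ?_⟩
      have := tanh_pos hpos
      simp only [phaseDeriv, mul_zero, zero_add]
      nlinarith
  obtain ⟨x, hx0, hxκ, hx⟩ := hneg
  obtain ⟨a, ha, ha0⟩ := intermediate_value_Ioo hxκ.le hcont.continuousOn ⟨hx, hend⟩
  exact ⟨a, hx0.trans_lt ha.1, ha0⟩

/-- Below the critical temperature, or in a field, the phase has a unique nondegenerate minimizer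
on the half-line (without field) or the line (with field), and the magnetization `tanh (κ a + h)`
there is the largest solution of the mean-field equation. -/
theorem exists_isPeak {κ h : ℝ} (hκ : 0 ≤ κ) (hh : 0 ≤ h) (hκh : h = 0 → 1 < κ) :
    ∃ (a : ℝ) (I : Set ℝ), IsPeak κ h I a ∧ phaseDeriv κ h a = 0 ∧
      0 < 1 - κ ^ 2 / Real.cosh (κ * a + h) ^ 2 ∧
      ∀ z, Real.tanh (κ ^ 2 * z + h) = z → z ≤ Real.tanh (κ * a + h) := by
  rcases hκ.eq_or_lt with rfl | hκ
  · refine ⟨0, Set.univ, ⟨Or.inl rfl, univ_mem, fun x _ hx => ?_⟩,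
      by simp [phaseDeriv], by simp, ?_⟩
    · have : 0 < x ^ 2 := by positivity
      simp only [phase, zero_mul]
      linarith
    · intro z hz
      simp only [ne_eq, OfNat.ofNat_ne_zero, not_false_eq_true, zero_pow, zero_mul] at hz ⊢
      exact hz.ge
  obtain ⟨a, ha, ha0⟩ := exists_phaseDeriv_eq_zero hκ hh hκh
  have hconv := strictConvexOn_phaseDeriv hκ hh
  have h00 : phaseDeriv κ h 0 ≤ 0 := by
    have := tanh_nonneg hh
    simp only [phaseDeriv, mul_zero, zero_add]
    nlinarith
  -- strict convexity and the nonpositive value at `0` fix the sign on either side of `a`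
  have hbelow : ∀ x, 0 < x → x < a → phaseDeriv κ h x < 0 := by
    intro x hx hxa
    have h1 := hconv.lt_on_openSegment (x := 0) (y := a) (z := x) Set.self_mem_Ici ha.le ha.ne
      (by rw [openSegment_eq_Ioo ha]; exact ⟨hx, hxa⟩)
    rwa [ha0, max_eq_right h00] at h1
  have habove : ∀ x, a < x → 0 < phaseDeriv κ h x := by
    intro x hx
    by_contra hcon
    have h1 := hconv.lt_on_openSegment (x := 0) (y := x) (z := a) Set.self_mem_Ici
      (ha.trans hx).le (ha.trans hx).ne (by rw [openSegment_eq_Ioo (ha.trans hx)]; exact ⟨ha, hx⟩)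
    rw [ha0] at h1
    exact absurd h1 (not_lt.2 (max_le h00 (not_lt.1 hcon)))
  have hmin : ∀ x, 0 ≤ x → x ≠ a → phase κ h a < phase κ h x := by
    intro x hx hxa
    rcases lt_or_gt_of_ne hxa with h1 | h1
    · have : StrictAntiOn (phase κ h) (Set.Icc 0 a) := by
        refine strictAntiOn_of_deriv_neg (convex_Icc 0 a) (continuous_phase κ h).continuousOn
          fun y hy => ?_
        rw [interior_Icc] at hy
        rw [(hasDerivAt_phase κ h y).deriv]
        exact hbelow y hy.1 hy.2
      exact this ⟨hx, h1.le⟩ ⟨ha.le, le_rfl⟩ h1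
    · have : StrictMonoOn (phase κ h) (Set.Ici a) := by
        refine strictMonoOn_of_deriv_pos (convex_Ici a) (continuous_phase κ h).continuousOn
          fun y hy => ?_
        rw [interior_Ici] at hy
        rw [(hasDerivAt_phase κ h y).deriv]
        exact habove y hy
      exact this Set.self_mem_Ici h1.le h1
  have hpeak : ∃ I, IsPeak κ h I a := by
    rcases hh.eq_or_lt with h0 | hpos
    · exact ⟨Set.Ici 0, Or.inr ⟨rfl, h0.symm⟩, Ici_mem_nhds ha, fun x hx hxa => hmin x hx hxa⟩
    · refine ⟨Set.univ, Or.inl rfl, univ_mem, fun x _ hxa => ?_⟩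
      rcases le_or_gt 0 x with hx | hx
      · exact hmin x hx hxa
      -- a positive field favours the positive side, which reduces the claim to `-x`
      · have h1 : phase κ h (-x) < phase κ h x := by
          have hκx : κ * x < 0 := mul_neg_of_pos_of_neg hκ hx
          have : Real.cosh (κ * x + h) < Real.cosh (κ * -x + h) := by
            rw [Real.cosh_lt_cosh, mul_neg, abs_of_nonneg (by linarith : 0 ≤ -(κ * x) + h), abs_lt]
            constructor <;> linarith
          have := Real.log_lt_log (Real.cosh_pos _) this
          unfold phase
          rw [neg_sq]
          linarith
        refine lt_of_le_of_lt ?_ h1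
        by_cases hxa' : -x = a
        · rw [hxa']
        · exact (hmin (-x) (by linarith) hxa').le
  obtain ⟨I, hI⟩ := hpeak
  have haeq : a = κ * Real.tanh (κ * a + h) := by
    have := ha0
    unfold phaseDeriv at this
    linarith
  refine ⟨a, I, hI, ha0, ?_, fun z hz => ?_⟩
  -- nondegeneracy: `κ² tanh θ ≤ θ < sinh θ`, hence `κ² < cosh² θ`
  · set θ := κ * a + h with hθ
    have hθpos : 0 < θ := by positivity
    have hs := Real.self_lt_sinh_iff.2 hθpos
    have hc := Real.one_le_cosh θ
    have hcp := Real.cosh_pos θ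
    have h1 : κ ^ 2 * Real.sinh θ ≤ θ * Real.cosh θ := by
      have h2 : κ ^ 2 * Real.tanh θ ≤ θ := by
        calc κ ^ 2 * Real.tanh θ = κ * (κ * Real.tanh θ) := by ring
          _ = κ * a := by rw [← haeq]
          _ ≤ θ := by linarith
      rw [Real.tanh_eq_sinh_div_cosh, mul_div_assoc', div_le_iff₀ hcp] at h2
      exact h2
    rw [sub_pos, div_lt_one (by positivity)]
    have h3 : κ ^ 2 * Real.sinh θ < Real.cosh θ ^ 2 * Real.sinh θ := by
      have : θ * Real.cosh θ < Real.sinh θ * Real.cosh θ := mul_lt_mul_of_pos_right hs hcp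
      nlinarith [mul_pos (hθpos.trans hs) hcp]
    exact lt_of_mul_lt_mul_right h3 (hθpos.trans hs).le
  · rcases le_or_gt z 0 with hz0 | hz0
    · exact hz0.trans (tanh_nonneg (by positivity))
    · have h1 : phaseDeriv κ h (κ * z) = 0 := by
        rw [phaseDeriv, ← mul_assoc, ← sq, hz, sub_self]
      have h2 : κ * z = a := by
        by_contra hne
        rcases lt_or_gt_of_ne hne with h3 | h3
        · exact (hbelow _ (by positivity) h3).ne h1
        · exact (habove _ h3).ne' h1
      rw [← h2, ← mul_assoc, ← sq, hz]

end CurieWeiss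

/-! ### Taylor expansion in the scale -/

namespace CurieWeiss
open MeasureTheory Filter
open scoped ContDiff Topology

theorem deriv_zero_of_even {f : ℝ → ℝ} (hf : ∀ x, f (-x) = f x) : deriv f 0 = 0 := by
  have h1 : (fun x => f (-x)) = f := funext hf
  have h2 := deriv_comp_neg f (0 : ℝ)
  rw [h1, neg_zero] at h2
  linarith

theorem iteratedDeriv_zero_of_even {f : ℝ → ℝ} (hf : ∀ x, f (-x) = f x) {n : ℕ} (hn : Odd n) :
    iteratedDeriv n f 0 = 0 := by
  have h1 : (fun x => f (-x)) = f := funext hf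
  have h2 := iteratedDeriv_comp_neg n f 0
  rw [h1, neg_zero, hn.neg_one_pow, smul_eq_mul] at h2
  linarith

theorem sum_range_eq_sum_even (M : ℕ) {c : ℕ → ℝ} (hc : ∀ n, Odd n → c n = 0) :
    ∑ j ∈ Finset.range (2 * M + 1), c j = ∑ p ∈ Finset.range (M + 1), c (2 * p) := by
  induction M with
  | zero => simp
  | succ M ih =>
    rw [show 2 * (M + 1) + 1 = 2 * M + 1 + 1 + 1 by ring, Finset.sum_range_succ,
      Finset.sum_range_succ, ih, Finset.sum_range_succ _ (M + 1), hc (2 * M + 1) ⟨M, rfl⟩, add_zero]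
    rfl

theorem scale_pow_mul_rpow {r n : ℕ} (hn : 0 < n) (p : ℕ) :
    (n : ℝ) ^ (-(1 / 2) : ℝ) * scale r n ^ (2 * p) = (n : ℝ) ^ (-(p : ℝ) / r - 1 / 2) := by
  have hn' : (0 : ℝ) < n := by exact_mod_cast hn
  rw [scale, ← Real.rpow_natCast, ← Real.rpow_mul hn'.le, ← Real.rpow_add hn']
  congr 1
  push_cast
  rcases eq_or_ne (r : ℝ) 0 with h | h
  · rw [h]; simp
  · field_simp; ring

theorem inv_pow_succ_isLittleO_scale {r : ℕ} (hr : 1 ≤ r) (M : ℕ) :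
    (fun n : ℕ => ((n : ℝ) ^ (M + 1))⁻¹) =o[atTop] fun n : ℕ => scale r n ^ (2 * M) := by
  have h1 : (fun n : ℕ => ((n : ℝ) ^ M)⁻¹) =O[atTop] fun n : ℕ => scale r n ^ (2 * M) := by
    refine Asymptotics.IsBigO.of_bound 1 ?_
    filter_upwards [eventually_gt_atTop 0] with n hn
    have hs := scale_pos r hn
    have hn' : (1 : ℝ) ≤ n := by exact_mod_cast hn
    have hs1 : scale r n ≤ 1 := Real.rpow_le_one_of_one_le_of_nonpos hn' (by
      have : (0 : ℝ) ≤ 1 / (2 * r) := by positivity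
      linarith)
    rw [Real.norm_of_nonneg (by positivity), Real.norm_of_nonneg (by positivity), one_mul,
      ← inv_pow, pow_mul]
    refine pow_le_pow_left₀ (by positivity) ?_ M
    rw [inv_le_iff_one_le_mul₀ (by positivity), ← scale_pow_mul hr hn]
    refine mul_le_mul_of_nonneg_right ?_ (by positivity)
    exact pow_le_pow_of_le_one hs.le hs1 (by omega)
  have h2 : (fun n : ℕ => ((n : ℝ))⁻¹) =o[atTop] fun _ => (1 : ℝ) :=
    (Asymptotics.isLittleO_one_iff ℝ).2 tendsto_inv_atTop_nhds_zero_nat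
  have h3 := h1.mul_isLittleO h2
  simp only [mul_one] at h3
  refine h3.congr_left fun n => ?_
  rw [pow_succ, mul_inv]

/-- A sequence that agrees, up to errors smaller than any power, with `n^{-1/2}` times a smooth
even function of `n^{-1/(2r)}` has a full asymptotic expansion in the powers `n^{-p/r-1/2}`; its
coefficients are the even Taylor coefficients. -/
theorem exists_expansion_of_smooth {r : ℕ} (hr : 1 ≤ r) {q : ℕ → ℝ} {l : Filter ℕ} (hl : l ≤ atTop)
    {R : ℝ → ℝ} {δ : ℝ} (hδ : 0 < δ) (hR : ContDiffOn ℝ ∞ R (Set.Ioo (-δ) δ))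
    (heven : ∀ x, R (-x) = R x)
    (happ : ∀ M : ℕ, (fun n : ℕ => Real.sqrt n * q n - R (scale r n)) =O[l]
      fun n : ℕ => ((n : ℝ) ^ M)⁻¹) :
    ∃ H : ℕ → ℝ, H 0 = R 0 ∧ H 1 = deriv (deriv R) 0 / 2 ∧ ∀ M : ℕ,
      (fun n : ℕ => q n - ∑ p ∈ Finset.range (M + 1), H p * (n : ℝ) ^ (-(p : ℝ) / r - 1 / 2))
        =o[l] fun n : ℕ => (n : ℝ) ^ (-(M : ℝ) / r - 1 / 2) := by
  have h0 : (0 : ℝ) ∈ Set.Ioo (-δ) δ := ⟨by linarith, hδ⟩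
  refine ⟨fun p => ((2 * p).factorial : ℝ)⁻¹ * iteratedDeriv (2 * p) R 0, by simp, ?_, fun M => ?_⟩
  · simp only [mul_one, Nat.factorial_two, iteratedDeriv_succ, iteratedDeriv_zero]
    push_cast; ring
  have hT : (fun x => R x - ∑ p ∈ Finset.range (M + 1),
      (((2 * p).factorial : ℝ)⁻¹ * iteratedDeriv (2 * p) R 0) * x ^ (2 * p))
        =o[𝓝 0] fun x => x ^ (2 * M) := by
    have h1 := taylor_isLittleO (n := 2 * M) (convex_Ioo (-δ) δ) h0
      (contDiffOn_infty.1 hR (2 * M))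
    rw [isOpen_Ioo.nhdsWithin_eq h0] at h1
    simp only [sub_zero, taylor_within_apply, smul_eq_mul] at h1
    refine h1.congr_left fun x => ?_
    congr 1
    rw [sum_range_eq_sum_even M (c := fun j =>
      ((j.factorial : ℝ)⁻¹ * x ^ j) * iteratedDerivWithin j R (Set.Ioo (-δ) δ) 0)]
    · refine Finset.sum_congr rfl fun p _ => ?_
      rw [iteratedDerivWithin_of_isOpen isOpen_Ioo h0]
      ring
    · intro j hj
      rw [iteratedDerivWithin_of_isOpen isOpen_Ioo h0, iteratedDeriv_zero_of_even heven hj,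
        mul_zero]
  have h2 := hT.comp_tendsto ((tendsto_scale hr).mono_left hl)
  have h3 := ((happ (M + 1)).trans_isLittleO ((inv_pow_succ_isLittleO_scale hr M).mono hl)).add h2
  have h4 := (Asymptotics.isBigO_refl (fun n : ℕ => (n : ℝ) ^ (-(1 / 2) : ℝ)) l).mul_isLittleO h3
  refine (EventuallyEq.trans_isLittleO ?_ h4).trans_eventuallyEq ?_
  · filter_upwards [hl (eventually_gt_atTop 0)] with n hn
    have hn' : (0 : ℝ) < n := by exact_mod_cast hn
    have e : (n : ℝ) ^ (-(1 / 2) : ℝ) * Real.sqrt n = 1 := by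
      rw [Real.sqrt_eq_rpow, ← Real.rpow_add hn']; norm_num
    simp only [Function.comp_apply]
    rw [sub_add_sub_cancel, mul_sub, ← mul_assoc, e, one_mul, Finset.mul_sum]
    congr 1
    refine Finset.sum_congr rfl fun p _ => ?_
    rw [← scale_pow_mul_rpow hn p]; ring
  · filter_upwards [hl (eventually_gt_atTop 0)] with n hn
    exact scale_pow_mul_rpow hn M

/-- The second derivative at `0` of a quotient of even functions. -/
theorem deriv_deriv_div_of_even {f g : ℝ → ℝ} (hf : ContDiffAt ℝ 2 f 0) (hg : ContDiffAt ℝ 2 g 0)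
    (hfe : ∀ x, f (-x) = f x) (hge : ∀ x, g (-x) = g x) (hg0 : g 0 ≠ 0) :
    deriv (deriv fun x => f x / g x) 0
      = (deriv (deriv f) 0 - f 0 / g 0 * deriv (deriv g) 0) / g 0 := by
  have hf1 : ∀ᶠ x in 𝓝 0, DifferentiableAt ℝ f x := by
    filter_upwards [hf.eventually (by simp)] with x hx using hx.differentiableAt (by simp)
  have hg1 : ∀ᶠ x in 𝓝 0, DifferentiableAt ℝ g x := by
    filter_upwards [hg.eventually (by simp)] with x hx using hx.differentiableAt (by simp)
  have hf2 : DifferentiableAt ℝ (deriv f) 0 := by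
    exact (hf.fderiv_right (m := 1) (by norm_num)).differentiableAt (by simp) |>.clm_apply
      (differentiableAt_const (1 : ℝ))
  have hg2 : DifferentiableAt ℝ (deriv g) 0 :=
    ((hg.fderiv_right (m := 1) (by norm_num)).differentiableAt (by simp)).clm_apply
      (differentiableAt_const (1 : ℝ))
  have e : deriv (fun x => f x / g x)
      =ᶠ[𝓝 0] fun x => (deriv f x * g x - f x * deriv g x) / g x ^ 2 := by
    filter_upwards [hf1, hg1, hg.continuousAt.eventually_ne hg0] with x h1 h2 h3
    exact deriv_fun_div h1 h2 h3
  have h4 := (((hf2.hasDerivAt.mul hg1.self_of_nhds.hasDerivAt).sub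
    (hf1.self_of_nhds.hasDerivAt.mul hg2.hasDerivAt))).div
      (hg1.self_of_nhds.hasDerivAt.pow 2) (pow_ne_zero 2 hg0)
  have h5 : HasDerivAt (fun x => (deriv f x * g x - f x * deriv g x) / g x ^ 2) _ 0 := h4
  rw [e.deriv_eq, h5.deriv]
  simp only [Pi.sub_apply, Pi.mul_apply, Pi.pow_apply, deriv_zero_of_even hfe,
    deriv_zero_of_even hge]
  field_simp
  ring

theorem evenAtTop_le_map : evenAtTop ≤ map (fun k : ℕ => k + k) atTop := by
  intro s hs
  obtain ⟨N, hN⟩ := mem_atTop_sets.1 (mem_map.1 hs)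
  rw [evenAtTop, mem_inf_principal]
  filter_upwards [eventually_ge_atTop (2 * N)] with n hn hev
  obtain ⟨k, rfl⟩ := hev
  exact hN k (by omega)

/-- The full expansion at a peak of the phase, with its first two coefficients in terms of the two
rescaled Laplace integrals. -/
theorem exists_expansion_of_quotient {d : ℕ} {β : ℝ} (hβ : 0 ≤ β) (h : ℝ) {r : ℕ} (hr : 1 ≤ r)
    {FN FD : ℝ → ℝ} (cN : ContDiffOn ℝ ∞ FN (Set.Ioo (-1) 1))
    (cD : ContDiffOn ℝ ∞ FD (Set.Ioo (-1) 1)) (eN : ∀ ε, FN (-ε) = FN ε)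
    (eD : ∀ ε, FD (-ε) = FD ε) (pD : 0 < FD 0)
    (happ : ∀ M : ℕ, (fun k : ℕ => Real.sqrt ((k + k : ℕ) : ℝ) *
        (mixedBalanced (coupling d β) |h| k / mixedTotal (coupling d β) |h| k)
        - Real.sqrt (2 / Real.pi) * (FN (scale r (k + k)) / FD (scale r (k + k))))
          =O[atTop] fun k : ℕ => (((k + k : ℕ) : ℝ) ^ M)⁻¹) :
    ∃ H : ℕ → ℝ, H 0 = Real.sqrt (2 / Real.pi) * (FN 0 / FD 0) ∧
      H 1 = Real.sqrt (2 / Real.pi) *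
        ((deriv (deriv FN) 0 - FN 0 / FD 0 * deriv (deriv FD) 0) / FD 0) / 2 ∧ ∀ M : ℕ,
      (fun n : ℕ => Q d β h n
          - ∑ p ∈ Finset.range (M + 1), H p * (n : ℝ) ^ (-(p : ℝ) / r - 1 / 2))
        =o[evenAtTop] fun n : ℕ => (n : ℝ) ^ (-(M : ℝ) / r - 1 / 2) := by
  have h01 : Set.Ioo (-1 : ℝ) 1 ∈ 𝓝 (0 : ℝ) := Ioo_mem_nhds (by norm_num) one_pos
  have hD : ∀ᶠ x in 𝓝 (0 : ℝ), x ∈ Set.Ioo (-1 : ℝ) 1 ∧ FD x ≠ 0 :=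
    (eventually_mem_set.2 h01).and ((cD.continuousOn.continuousAt h01).eventually_ne pD.ne')
  obtain ⟨δ, hδ, hball⟩ := Metric.eventually_nhds_iff_ball.1 hD
  rw [Real.ball_eq_Ioo, zero_sub, zero_add] at hball
  have hR : ContDiffOn ℝ ∞ (fun x => Real.sqrt (2 / Real.pi) * (FN x / FD x)) (Set.Ioo (-δ) δ) :=
    contDiffOn_const.mul ((cN.mono fun x hx => (hball x hx).1).div
      (cD.mono fun x hx => (hball x hx).1) fun x hx => (hball x hx).2)
  obtain ⟨H, h0, h1, hH⟩ := exists_expansion_of_smooth hr (q := Q d β h) (l := evenAtTop)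
    inf_le_left hδ hR (fun x => by rw [eN, eD]) fun M => by
      refine Asymptotics.IsBigO.mono ?_ evenAtTop_le_map
      rw [Asymptotics.isBigO_map]
      refine EventuallyEq.trans_isBigO ?_ (happ M)
      filter_upwards [eventually_gt_atTop 0] with k hk
      rw [Function.comp_apply, Q_eq_div_abs hβ h hk]
  refine ⟨H, h0, ?_, hH⟩
  rw [h1]
  congr 1
  have hc : ∀ {F : ℝ → ℝ}, ContDiffOn ℝ ∞ F (Set.Ioo (-1) 1) → ContDiffAt ℝ 2 F 0 :=
    fun hF => contDiffAt_infty.1 (hF.contDiffAt h01) 2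
  rw [← deriv_deriv_div_of_even (hc cN) (hc cD) eN eD pD.ne']
  rw [deriv_const_mul_field', deriv_const_mul_field]

theorem sqrt_ratio_eq_cosh (θ : ℝ) :
    Real.sqrt (Real.pi / (1 / (2 * Real.cosh θ ^ 2))) 
      = Real.cosh θ * Real.sqrt (Real.pi / (1 / 2)) := by
  have h1 := Real.cosh_pos θ
  rw [show Real.pi / (1 / (2 * Real.cosh θ ^ 2)) = Real.cosh θ ^ 2 * (Real.pi / (1 / 2)) by
    field_simp, Real.sqrt_mul (by positivity), Real.sqrt_sq h1.le]

/-- The expansion at a nondegenerate peak. -/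
theorem exists_expansion_of_nondegenerate {d : ℕ} {β : ℝ} (hβ : 0 ≤ β) (h : ℝ) {I : Set ℝ} {a : ℝ}
    (hI : IsPeak (coupling d β) |h| I a) (ha : phaseDeriv (coupling d β) |h| a = 0)
    (hc : 0 < 1 - coupling d β ^ 2 / Real.cosh (coupling d β * a + |h|) ^ 2) :
    ∃ H : ℕ → ℝ, H 0 = Real.sqrt (2 / Real.pi) * Real.cosh (coupling d β * a + |h|) ∧ ∀ M : ℕ,
      (fun n : ℕ => Q d β h n
          - ∑ p ∈ Finset.range (M + 1), H p * (n : ℝ) ^ (-(p : ℝ) - 1 / 2))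
        =o[evenAtTop] fun n : ℕ => (n : ℝ) ^ (-(M : ℝ) - 1 / 2) := by
  obtain ⟨g, hg, hg0, hfac⟩ := exists_phase_factor_of_pos ha hc
  obtain ⟨K, hK, hK0, -, hdamp⟩ := damping_eventually (coupling d β) |h| a
  have hK0' : K 0 = 1 / (2 * Real.cosh (coupling d β * a + |h|) ^ 2) := by
    have := hK0 0
    rwa [add_zero] at this
  have hcosh := Real.cosh_pos (coupling d β * a + |h|)
  obtain ⟨FN, FD, cN, cD, eN, eD, pD, vN, vD, -, -, -, -, happ⟩ :=
    hI.exists_quotient le_rfl hg hg0 hfac hK (by rw [hK0']; positivity) hdamp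
  obtain ⟨H, h0, -, hH⟩ := exists_expansion_of_quotient hβ h le_rfl cN cD eN eD pD happ
  refine ⟨H, ?_, fun M => by simpa using hH M⟩
  rw [h0, vN, hK0', sqrt_ratio_eq_cosh, mul_left_comm, ← vD, mul_div_assoc, div_self pD.ne',
    mul_one]

end CurieWeiss

/-! ### The critical point -/

namespace CurieWeiss
open MeasureTheory Filter
open scoped ContDiff Topology

/-- Along the parabola `ε ↦ (ε s, ε² t)` a germ that is even in its second variable has the same
second derivative at `0` as along the line `ε ↦ (ε s, 0)`: the curvature of the parabola is seen
only by the first derivative in the second variable, which vanishes. -/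
theorem deriv_deriv_parabola {F : ℝ × ℝ → ℝ} (hF : AnalyticAt ℝ F 0)
    (heven : ∀ x u, F (x, -u) = F (x, u)) (s t : ℝ) :
    deriv (deriv fun ε : ℝ => F (ε * s, ε ^ 2 * t)) 0
      = deriv (deriv fun ε : ℝ => F (ε * s, 0)) 0 := by
  have hcurve : ∀ t ε : ℝ, HasDerivAt (fun ε : ℝ => ((ε * s, ε ^ 2 * t) : ℝ × ℝ))
      (s, 2 * ε * t) ε := by
    intro t ε
    refine HasDerivAt.prodMk ?_ ?_
    · simpa using (hasDerivAt_id ε).mul_const s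
    · simpa using (hasDerivAt_pow 2 ε).mul_const t
  have hvert : fderiv ℝ F 0 (0, 1) = 0 := by
    have h1 : HasDerivAt (fun u : ℝ => ((0, u) : ℝ × ℝ)) (0, 1) 0 :=
      (hasDerivAt_const _ _).prodMk (hasDerivAt_id _)
    have h2 := hF.differentiableAt.hasFDerivAt.comp_hasDerivAt_of_eq (0 : ℝ) h1 rfl
    rw [← h2.deriv]
    exact deriv_zero_of_even fun u => heven 0 u
  have key : ∀ t : ℝ, deriv (deriv fun ε : ℝ => F (ε * s, ε ^ 2 * t)) 0
      = fderiv ℝ (fderiv ℝ F) 0 (s, 0) (s, 0) := by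
    intro t
    have htend : Tendsto (fun ε : ℝ => ((ε * s, ε ^ 2 * t) : ℝ × ℝ)) (𝓝 0) (𝓝 0) := by
      have := (hcurve t 0).continuousAt.tendsto
      rwa [zero_mul, zero_pow two_ne_zero, zero_mul, Prod.mk_zero_zero] at this
    have e1 : deriv (fun ε : ℝ => F (ε * s, ε ^ 2 * t))
        =ᶠ[𝓝 0] fun ε => fderiv ℝ F (ε * s, ε ^ 2 * t) (s, 2 * ε * t) := by
      filter_upwards [htend.eventually hF.eventually_analyticAt] with ε hε
      exact (hε.differentiableAt.hasFDerivAt.comp_hasDerivAt ε (hcurve t ε)).deriv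
    have h3 := (hF.fderiv.differentiableAt.hasFDerivAt).comp_hasDerivAt_of_eq (0 : ℝ) (hcurve t 0)
      (y := 0)
      (by rw [zero_mul, zero_pow two_ne_zero, zero_mul, Prod.mk_zero_zero])
    have h4 : HasDerivAt (fun ε : ℝ => ((s, 2 * ε * t) : ℝ × ℝ)) (0, 2 * t) 0 := by
      refine (hasDerivAt_const _ _).prodMk ?_
      simpa using ((hasDerivAt_id (0 : ℝ)).const_mul 2).mul_const t
    have h5 := h3.clm_apply h4
    have h6 : HasDerivAt (fun ε : ℝ => fderiv ℝ F (ε * s, ε ^ 2 * t) (s, 2 * ε * t)) _ 0 := h5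
    rw [e1.deriv_eq, h6.deriv]
    have h7 : fderiv ℝ F 0 (0, 2 * t) = 0 := by
      rw [show ((0, 2 * t) : ℝ × ℝ) = (2 * t) • (0, 1) by simp, map_smul, hvert, smul_zero]
    simp only [Function.comp_apply, zero_mul, mul_zero, ne_eq, OfNat.ofNat_ne_zero,
      not_false_eq_true, zero_pow, Prod.mk_zero_zero, h7, add_zero]
  rw [key t, ← key 0]
  simp

theorem deriv_deriv_mul_of_deriv_eq_zero {f g : ℝ → ℝ} (hf : AnalyticAt ℝ f 0)
    (hg : AnalyticAt ℝ g 0) (hg' : deriv g 0 = 0) :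
    deriv (deriv fun x => f x * g x) 0
      = deriv (deriv f) 0 * g 0 + f 0 * deriv (deriv g) 0 := by
  have e : deriv (fun x => f x * g x) =ᶠ[𝓝 0] fun x => deriv f x * g x + f x * deriv g x := by
    filter_upwards [hf.eventually_analyticAt, hg.eventually_analyticAt] with x h1 h2
    exact deriv_fun_mul h1.differentiableAt h2.differentiableAt
  have h1 := (hf.deriv.differentiableAt.hasDerivAt.mul hg.differentiableAt.hasDerivAt).add
    (hf.differentiableAt.hasDerivAt.mul hg.deriv.differentiableAt.hasDerivAt)
  have h2 : HasDerivAt (fun x => deriv f x * g x + f x * deriv g x) _ 0 := h1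
  rw [e.deriv_eq, h2.deriv, hg']
  ring

theorem deriv_deriv_exp_sech_sq (s t : ℝ) :
    deriv (deriv fun ε : ℝ => Real.exp (-(t ^ 2 * (1 / (2 * Real.cosh (ε * s) ^ 2))))) 0
      = s ^ 2 * t ^ 2 * Real.exp (-(t ^ 2 / 2)) := by
  have hm : ∀ ε : ℝ, HasDerivAt (fun ε : ℝ => ε * s) s ε := fun ε => by
    simpa using (hasDerivAt_id ε).mul_const s
  have d1 : ∀ ε : ℝ,
      HasDerivAt (fun ε : ℝ => Real.exp (-(t ^ 2 * (1 / (2 * Real.cosh (ε * s) ^ 2)))))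
        (Real.exp (-(t ^ 2 * (1 / (2 * Real.cosh (ε * s) ^ 2))))
          * (t ^ 2 * s * Real.sinh (ε * s) / Real.cosh (ε * s) ^ 3)) ε := by
    intro ε
    have hc := Real.cosh_pos (ε * s)
    have h1 := ((((hm ε).cosh.pow 2).const_mul 2).inv
      (mul_ne_zero two_ne_zero (pow_ne_zero 2 hc.ne'))).const_mul (t ^ 2)
    have h2 := h1.neg.exp
    refine (h2.congr_of_eventuallyEq (Eventually.of_forall fun y => ?_)).congr_deriv ?_
    · rw [one_div]; rfl
    simp only [Pi.neg_apply, Pi.pow_apply, Pi.inv_apply, one_div]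
    congr 1
    field_simp
    ring
  have hd : deriv (fun ε : ℝ => Real.exp (-(t ^ 2 * (1 / (2 * Real.cosh (ε * s) ^ 2)))))
      = fun ε => Real.exp (-(t ^ 2 * (1 / (2 * Real.cosh (ε * s) ^ 2))))
          * (t ^ 2 * s * Real.sinh (ε * s) / Real.cosh (ε * s) ^ 3) := funext fun ε => (d1 ε).deriv
  have h4 := ((hm 0).sinh.const_mul (t ^ 2 * s)).div ((hm 0).cosh.pow 3)
    (by simp)
  have h5 := (d1 0).mul h4
  have h6 : HasDerivAt (fun ε : ℝ => Real.exp (-(t ^ 2 * (1 / (2 * Real.cosh (ε * s) ^ 2))))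
      * (t ^ 2 * s * Real.sinh (ε * s) / Real.cosh (ε * s) ^ 3)) _ 0 := h5
  rw [hd, h6.deriv]
  simp
  ring_nf

/-- At the critical point the numerator and the denominator differ at second order in `ε` only
through the `x`-dependence of the damping. -/
theorem deriv_deriv_critical {g : ℝ → ℝ} (hg : AnalyticAt ℝ g 0) {K : ℝ × ℝ → ℝ}
    (hK : AnalyticAt ℝ K 0) (hK0 : ∀ x, K (x, 0) = 1 / (2 * Real.cosh x ^ 2))
    (hKe : ∀ x u, K (x, -u) = K (x, u)) (v : ℝ × ℝ) :
    deriv (deriv fun ε => Real.exp (-laplacePhase 2 (fun z => g z.1) K ε v)) 0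
      - deriv (deriv fun ε => Real.exp (-laplacePhase 2 (fun z => g z.1) (fun _ => 1 / 2) ε v)) 0
      = (v.1 ^ 2 * Real.exp (-(g 0 * v.1 ^ 4))) * (v.2 ^ 2 * Real.exp (-(v.2 ^ 2 / 2))) := by
  obtain ⟨s, t⟩ := v
  have hgs : AnalyticAt ℝ (fun ε : ℝ => g (ε * s)) 0 :=
    AnalyticAt.fun_comp (g := g) (by simpa using hg) (by fun_prop)
  have hP : AnalyticAt ℝ (fun ε : ℝ => Real.exp (-(s ^ 4 * g (ε * s)))) 0 :=
    (analyticAt_const.mul hgs).neg.rexp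
  have hE : AnalyticAt ℝ
      (fun ε : ℝ => Real.exp (-(t ^ 2 * (1 / (2 * Real.cosh (ε * s) ^ 2))))) 0 := by
    have h1 : AnalyticAt ℝ (fun ε : ℝ => Real.cosh (ε * s)) 0 :=
      AnalyticAt.fun_comp (g := Real.cosh) Real.analyticAt_cosh (by fun_prop)
    have h2 : AnalyticAt ℝ (fun ε : ℝ => 1 / (2 * Real.cosh (ε * s) ^ 2)) 0 :=
      analyticAt_const.div (analyticAt_const.mul (h1.pow 2))
        (by have := Real.cosh_pos (0 * s); positivity)
    exact (analyticAt_const.mul h2).neg.rexp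
  have hN := deriv_deriv_parabola
    (F := fun z : ℝ × ℝ => Real.exp (-(s ^ 4 * g z.1 + t ^ 2 * K z))) (by
      have h1 : AnalyticAt ℝ (fun z : ℝ × ℝ => g z.1) 0 :=
        AnalyticAt.fun_comp (g := g) hg analyticAt_fst
      exact ((analyticAt_const.mul h1).add (analyticAt_const.mul hK)).neg.rexp)
    (fun x u => by simp only [hKe]) s t
  have h1 : (fun ε => Real.exp (-laplacePhase 2 (fun z => g z.1) K ε (s, t)))
      = fun ε => Real.exp (-(s ^ 4 * g (ε * s) + t ^ 2 * K (ε * s, ε ^ 2 * t))) := rfl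
  have h2 : (fun ε => Real.exp (-laplacePhase 2 (fun z => g z.1) (fun _ => 1 / 2) ε (s, t)))
      = fun ε => Real.exp (-(s ^ 4 * g (ε * s))) * Real.exp (-(t ^ 2 / 2)) := by
    ext ε
    rw [← Real.exp_add, laplacePhase]
    congr 1
    ring
  have h3 : (fun ε => Real.exp (-(s ^ 4 * g (ε * s) + t ^ 2 * K (ε * s, 0))))
      = fun ε => Real.exp (-(s ^ 4 * g (ε * s)))
          * Real.exp (-(t ^ 2 * (1 / (2 * Real.cosh (ε * s) ^ 2)))) := by
    ext ε
    rw [← Real.exp_add, hK0]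
    congr 1
    ring
  rw [h1, hN, h3, h2, deriv_deriv_mul_of_deriv_eq_zero hP hE
    (deriv_zero_of_even fun x => by rw [neg_mul, Real.cosh_neg]),
    deriv_deriv_mul_of_deriv_eq_zero hP analyticAt_const (by simp), deriv_deriv_exp_sech_sq]
  simp
  ring_nf

theorem integral_even_pow_mul_exp_neg (m : ℕ) {b : ℝ} (hb : 0 < b) {p : ℕ} (hp : 0 < p) :
    ∫ x : ℝ, x ^ (2 * m) * Real.exp (-(b * x ^ (2 * p)))
      = b ^ (-((2 * m + 1 : ℝ) / (2 * p))) / p * Real.Gamma ((2 * m + 1) / (2 * p)) := by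
  have h1 := integral_comp_abs (f := fun x : ℝ => x ^ (2 * m) * Real.exp (-(b * x ^ (2 * p))))
  simp only [pow_mul, sq_abs] at h1
  simp only [pow_mul]
  rw [h1]
  have h2 := integral_rpow_mul_exp_neg_mul_rpow (p := 2 * p) (q := 2 * m) (b := b)
    (by positivity) (by have : (0 : ℝ) ≤ 2 * m := by positivity
                        linarith) hb
  have h3 : ∫ x in Set.Ioi (0 : ℝ), (x ^ 2) ^ m * Real.exp (-(b * (x ^ 2) ^ p))
      = ∫ x in Set.Ioi (0 : ℝ), x ^ (2 * m : ℝ) * Real.exp (-b * x ^ (2 * p : ℝ)) := by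
    refine setIntegral_congr_fun measurableSet_Ioi fun x _ => ?_
    have e : ∀ j : ℕ, x ^ (2 * j : ℝ) = (x ^ 2) ^ j := fun j => by
      rw [← pow_mul, ← Real.rpow_natCast]; push_cast; rfl
    simp only [e, neg_mul]
  rw [h3, h2]
  have : (p : ℝ) ≠ 0 := by positivity
  field_simp

/-- The ratio of the quartic moments, by the reflection formula for `Γ` at `1/4`. -/
theorem quartic_moment_ratio :
    (∫ s : ℝ, s ^ 2 * Real.exp (-(1 / 12 * s ^ 4))) / ∫ s : ℝ, Real.exp (-(1 / 12 * s ^ 4))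
      = 2 * Real.sqrt 3 * (Real.pi * Real.sqrt 2) / Real.Gamma (1 / 4) ^ 2 := by
  have h0 := integral_even_pow_mul_exp_neg 0 (b := 1 / 12) (by norm_num) (p := 2) (by norm_num)
  have h1 := integral_even_pow_mul_exp_neg 1 (b := 1 / 12) (by norm_num) (p := 2) (by norm_num)
  norm_num at h0 h1
  have hG : Real.Gamma (1 / 4) * Real.Gamma (3 / 4) = Real.pi * Real.sqrt 2 := by
    have := Real.Gamma_mul_Gamma_one_sub (1 / 4)
    rw [show (1 - 1 / 4 : ℝ) = 3 / 4 by norm_num, show Real.pi * (1 / 4) = Real.pi / 4 by ring,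
      Real.sin_pi_div_four] at this
    rw [this]
    have h2 := Real.sq_sqrt (show (0 : ℝ) ≤ 2 by norm_num)
    have : 0 < Real.sqrt 2 := by positivity
    field_simp
    linarith
  have hr : ((1 / 12 : ℝ)) ^ (-(3 / 4) : ℝ) = (1 / 12) ^ (-(1 / 4) : ℝ) * (2 * Real.sqrt 3) := by
    rw [show (-(3 / 4) : ℝ) = -(1 / 4) + -(1 / 2) by norm_num, Real.rpow_add (by norm_num)]
    congr 1
    rw [Real.rpow_neg (by norm_num), ← Real.sqrt_eq_rpow, ← Real.sqrt_inv,
      show ((1 / 12 : ℝ))⁻¹ = 2 ^ 2 * 3 by norm_num, Real.sqrt_mul (by norm_num),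
      Real.sqrt_sq (by norm_num)]
  have hGp := Real.Gamma_pos_of_pos (show (0 : ℝ) < 1 / 4 by norm_num)
  have hA : (0 : ℝ) < (1 / 12) ^ (-(1 / 4) : ℝ) := by positivity
  rw [h0, h1, hr, ← hG]
  field_simp

theorem integral_sq_mul_exp_neg_half_sq :
    ∫ t : ℝ, t ^ 2 * Real.exp (-(t ^ 2 / 2)) = Real.sqrt (Real.pi / (1 / 2)) := by
  have h1 := integral_even_pow_mul_exp_neg 1 (b := 1 / 2) (by norm_num) (p := 1) (by norm_num)
  have hG : Real.Gamma (3 / 2) = Real.sqrt Real.pi / 2 := by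
    rw [show (3 / 2 : ℝ) = 1 / 2 + 1 by norm_num, Real.Gamma_add_one (by norm_num),
      Real.Gamma_one_half_eq]
    ring
  have hr : ((1 / 2 : ℝ)) ^ (-(3 / 2) : ℝ) = 2 * Real.sqrt 2 := by
    rw [show (-(3 / 2) : ℝ) = -1 + -(1 / 2) by norm_num, Real.rpow_add (by norm_num),
      Real.rpow_neg (by norm_num : (0 : ℝ) ≤ 1 / 2) (1 / 2), ← Real.sqrt_eq_rpow, ← Real.sqrt_inv,
      Real.rpow_neg_one]
    norm_num
  norm_num at h1
  rw [hG, hr] at h1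
  simp only [div_eq_inv_mul, mul_one] at h1 ⊢
  rw [h1, inv_inv, Real.sqrt_mul (by norm_num)]
  ring

/-- The expansion at the critical point. -/
theorem exists_expansion_of_critical {d : ℕ} {β : ℝ} (hβ : 0 ≤ β) (hc : coupling d β = 1) :
    ∃ H : ℕ → ℝ, H 0 = Real.sqrt (2 / Real.pi) ∧
      H 1 = 2 * Real.sqrt 3 * Real.sqrt Real.pi / Real.Gamma (1 / 4) ^ 2 ∧ ∀ M : ℕ,
      (fun n : ℕ => Q d β 0 n
          - ∑ p ∈ Finset.range (M + 1), H p * (n : ℝ) ^ (-(p : ℝ) / 2 - 1 / 2))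
        =o[evenAtTop] fun n : ℕ => (n : ℝ) ^ (-(M : ℝ) / 2 - 1 / 2) := by
  obtain ⟨g, hg, hg0, hfac⟩ := exists_phase_factor_critical
  obtain ⟨K, hK, hK0, hKe, hdamp⟩ := damping_eventually 1 0 0
  simp only [zero_add, one_mul, add_zero] at hK0
  have hK00 : K 0 = 1 / 2 := by
    have := hK0 0
    rwa [Prod.mk_zero_zero, Real.cosh_zero, one_pow, mul_one] at this
  obtain ⟨FN, FD, cN, cD, eN, eD, pD, vN, vD, iN, iD, sN, sD, happ⟩ :=
    isPeak_critical.exists_quotient one_le_two hg (by rw [hg0]; norm_num) hfac hK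
      (by rw [hK00]; norm_num) hdamp
  obtain ⟨H, h0, h1, hH⟩ := exists_expansion_of_quotient (d := d) hβ 0 one_le_two cN cD eN eD pD
    (by simpa only [hc, abs_zero] using happ)
  have hq : FN 0 / FD 0 = 1 := by
    rw [vN, hK00, ← vD, div_self pD.ne']
  refine ⟨H, by rw [h0, hq, mul_one], ?_, fun M => by simpa using hH M⟩
  have hdiff : deriv (deriv FN) 0 - deriv (deriv FD) 0
      = (∫ s : ℝ, s ^ 2 * Real.exp (-(1 / 12 * s ^ 4))) * Real.sqrt (Real.pi / (1 / 2)) := by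
    rw [sN, sD, ← integral_sub iN iD, ← integral_sq_mul_exp_neg_half_sq, ← integral_prod_mul]
    simp only [deriv_deriv_critical hg hK hK0 hKe, hg0]
    rfl
  have hpos : 0 < Real.sqrt (Real.pi / (1 / 2)) := by have := Real.pi_pos; positivity
  rw [h1, hq, one_mul, hdiff, vD, hg0, mul_div_mul_right _ _ hpos.ne',
    show 2 * 2 = 4 from rfl, quartic_moment_ratio,
    Real.sqrt_div' _ Real.pi_pos.le]
  have hpi : 0 < Real.sqrt Real.pi := Real.sqrt_pos.2 Real.pi_pos
  have h2 := Real.sq_sqrt (show (0 : ℝ) ≤ 2 by norm_num)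
  have h3 := Real.sq_sqrt Real.pi_pos.le
  have hGp := Real.Gamma_pos_of_pos (show (0 : ℝ) < 1 / 4 by norm_num)
  rw [div_mul_div_comm, div_div, div_eq_div_iff (by positivity) (by positivity)]
  nth_rewrite 1 [← h3]
  linear_combination (2 * Real.sqrt 3 * Real.sqrt Real.pi ^ 2 * Real.Gamma (1 / 4) ^ 2) * h2

end CurieWeiss

/-! ### The expansions -/

namespace CurieWeiss

theorem coupling_sq {d : ℕ} {β : ℝ} (hβ : 0 ≤ β) : coupling d β ^ 2 = 2 * d * β :=
  Real.sq_sqrt (by positivity)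

theorem div_betaC (d : ℕ) (β : ℝ) : β / betaC d = 2 * d * β := by
  rw [betaC, div_div_eq_mul_div, div_one, mul_comm]

/-- A positive nondegenerate peak of the phase is the maximal magnetization of the mean-field
equation, rescaled by the coupling. -/
theorem exists_isGreatest_expansion {d : ℕ} {β : ℝ} (hβ : 0 ≤ β) {h : ℝ}
    (hh : |h| = 0 → 1 < coupling d β) :
    ∃ z t : ℝ, IsGreatest (meanFieldSolutions d β h) z ∧ t = 2 * (d : ℝ) * β * z + |h| ∧
      ∃ H : ℕ → ℝ, H 0 = Real.sqrt (2 / Real.pi) * Real.cosh t ∧ ∀ M : ℕ,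
        (fun n : ℕ => Q d β h n
            - ∑ p ∈ Finset.range (M + 1), H p * (n : ℝ) ^ (-(p : ℝ) - 1 / 2))
          =o[evenAtTop] fun n : ℕ => (n : ℝ) ^ (-(M : ℝ) - 1 / 2) := by
  obtain ⟨a, I, hI, ha, hc, hmax⟩ :=
    exists_isPeak (κ := coupling d β) (Real.sqrt_nonneg _) (abs_nonneg h) hh
  obtain ⟨H, h0, hH⟩ := exists_expansion_of_nondegenerate hβ h hI ha hc
  have ht : coupling d β * a + |h|
      = 2 * d * β * Real.tanh (coupling d β * a + |h|) + |h| := by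
    rw [← coupling_sq hβ, add_left_inj, sq, mul_assoc]
    congr 1
    exact sub_eq_zero.1 ha
  refine ⟨Real.tanh (coupling d β * a + |h|), coupling d β * a + |h|, ⟨?_, fun z hz => ?_⟩, ht,
    H, h0, hH⟩
  · rw [meanFieldSolutions, Set.mem_ofPred_eq, div_betaC, ← ht]
  · rw [meanFieldSolutions, Set.mem_ofPred_eq, div_betaC, ← coupling_sq hβ] at hz
    exact hmax z hz

end CurieWeiss

theorem corollary5 (d : ℕ) (hd : 1 ≤ d) (β : ℝ) (hβ : 0 ≤ β) :
    -- (1) high temperature, no external field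
    (β < CurieWeiss.betaC d →
      ∃ H : ℕ → ℝ, H 0 = Real.sqrt (2 / Real.pi) ∧
        ∀ M : ℕ,
          (fun n : ℕ => CurieWeiss.Q d β 0 n
              - ∑ p ∈ Finset.range (M + 1), H p * (n : ℝ) ^ (-(p : ℝ) - 1 / 2))
            =o[CurieWeiss.evenAtTop] (fun n : ℕ => (n : ℝ) ^ (-(M : ℝ) - 1 / 2))) ∧
    -- (2) critical case, no external field
    (β = CurieWeiss.betaC d →
      ∃ H : ℕ → ℝ, H 0 = Real.sqrt (2 / Real.pi) ∧
        H 1 = 2 * Real.sqrt 3 * Real.sqrt Real.pi / (Real.Gamma (1 / 4)) ^ 2 ∧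
        ∀ M : ℕ,
          (fun n : ℕ => CurieWeiss.Q d β 0 n
              - ∑ p ∈ Finset.range (M + 1), H p * (n : ℝ) ^ (-(p : ℝ) / 2 - 1 / 2))
            =o[CurieWeiss.evenAtTop] (fun n : ℕ => (n : ℝ) ^ (-(M : ℝ) / 2 - 1 / 2))) ∧
    -- (3) low temperature, no external field
    (CurieWeiss.betaC d < β →
      ∃ z t : ℝ, IsGreatest (CurieWeiss.meanFieldSolutions d β 0) z ∧
        t = 2 * (d : ℝ) * β * z ∧
        ∃ H : ℕ → ℝ, H 0 = Real.sqrt (2 / Real.pi) * Real.cosh t ∧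
          ∀ M : ℕ,
            (fun n : ℕ => CurieWeiss.Q d β 0 n
                - ∑ p ∈ Finset.range (M + 1), H p * (n : ℝ) ^ (-(p : ℝ) - 1 / 2))
              =o[CurieWeiss.evenAtTop] (fun n : ℕ => (n : ℝ) ^ (-(M : ℝ) - 1 / 2))) ∧
    -- (4) non-zero external field
    (∀ h : ℝ, h ≠ 0 →
      ∃ z t : ℝ, IsGreatest (CurieWeiss.meanFieldSolutions d β h) z ∧
        t = 2 * (d : ℝ) * β * z + |h| ∧
        ∃ H : ℕ → ℝ, H 0 = Real.sqrt (2 / Real.pi) * Real.cosh t ∧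
          ∀ M : ℕ,
            (fun n : ℕ => CurieWeiss.Q d β h n
                - ∑ p ∈ Finset.range (M + 1), H p * (n : ℝ) ^ (-(p : ℝ) - 1 / 2))
              =o[CurieWeiss.evenAtTop] (fun n : ℕ => (n : ℝ) ^ (-(M : ℝ) - 1 / 2))) := by

  have hd' : (0 : ℝ) < 2 * d := by
    have : (1 : ℝ) ≤ d := by exact_mod_cast hd
    linarith
  have hsq := CurieWeiss.coupling_sq (d := d) hβ
  have hnn : 0 ≤ CurieWeiss.coupling d β := Real.sqrt_nonneg _
  refine ⟨fun hlt => ?_, fun heq => ?_, fun hgt => ?_, fun h hh => ?_⟩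
  · rw [CurieWeiss.betaC, lt_div_iff₀ hd'] at hlt
    have hκ : CurieWeiss.coupling d β < 1 := by
      rw [← sq_lt_one_iff₀ hnn, hsq]; linarith
    have hpeak := CurieWeiss.isPeak_zero_of_lt_one hnn hκ
    rw [← abs_zero] at hpeak
    obtain ⟨H, h0, hH⟩ := CurieWeiss.exists_expansion_of_nondegenerate hβ 0 hpeak
      (by simp [CurieWeiss.phaseDeriv]) (by simp only [abs_zero, mul_zero, add_zero,
        Real.cosh_zero, one_pow, div_one, hsq]; linarith)
    exact ⟨H, by simpa using h0, hH⟩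
  · refine CurieWeiss.exists_expansion_of_critical hβ ?_
    rw [CurieWeiss.betaC, eq_div_iff hd'.ne'] at heq
    exact (pow_eq_one_iff_of_nonneg hnn two_ne_zero).1 (hsq.trans (by linarith))
  · rw [CurieWeiss.betaC, div_lt_iff₀ hd'] at hgt
    obtain ⟨z, t, hz, ht, H, hH⟩ := CurieWeiss.exists_isGreatest_expansion (d := d) hβ (h := 0)
      fun _ => by rw [← one_lt_sq_iff₀ hnn, hsq]; linarith
    exact ⟨z, t, hz, by simpa using ht, H, hH⟩
  · exact CurieWeiss.exists_isGreatest_expansion hβ fun h0 => absurd (abs_eq_zero.1 h0) hh
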